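/- Conventions. A germ of regular $k$-web at a point $q$ of a complex surface is given by germs of nowhere vanishing holomorphic $1$-forms $\omega_1,\dots,\omega_k$, pairwise linearly independent at $q$. An abelian relation is a $k$-tuple of germs at $q$ of closed holomorphic $1$-forms $\eta_i$ with $\eta_i\wedge\omega_i=0$ and $\sum_i\eta_i=0$. The rank of the web is the dimension of the space of abelian relations. It is maximal if it equals $\pi(2,k)=\sum_{j\ge 1}\max(0,k-j-1)=\frac{(k-1)(k-2)}2$. The web is algebraizable if it is equivalent, under a germ of biholomorphism, to the web dual to a plane curve of degree $k$ at a line that meets the curve in $k$ distinct points: its foliations at $z$ have as tangents the $k$ lines through $z$ that belong to the curve in the dual plane. It is exceptional if it has maximal rank and is not algebraizable. For a superposition of (possibly singular) foliations these notions refer to its germs at the points outside the discriminant, that is, the points where all the foliations are regular and pairwise transverse. A foliation is linear near a point if its leaves there are pieces of lines. Let $r\ge 3$ and $m\ge 2$. An $(r,m)$-net in the complex projective plane $\mathbb P^2$ consists of $r$ pairwise disjoint sets $\mathcal L_1,\dots,\mathcal L_r$ of $m$ lines each, and of a finite set $\mathcal P$ of points, such that two lines from distinct sets $\mathcal L_i$,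 $\mathcal L_j$ always meet in a point of $\mathcal P$, and through every $p\in\mathcal P$ there passes exactly one line of each $\mathcal L_i$. Theorem. Let $\mathcal L=\bigsqcup_i\mathcal L_i$, with $\mathcal P$, be an $(r,m)$-net in $\mathbb P^2$ with $r\ge 3$, $m\ge 2$. Then $\mathcal P$ has $m^2$ points, and there is a rational function $F=A/B$ of degree $m$ on $\mathbb P^2$ ($A,B$ coprime homogeneous polynomials of degree $m$) with $r$ distinct values $c_1,\dots,c_r\in\mathbb P^1$ such that $F^{-1}(c_i)$ is the union of the lines of $\mathcal L_i$. For every such $F$, let $\mathcal W(\mathcal L)$ be the superposition of the $m^2$ pencils of lines through the points of $\mathcal P$ and of the foliation $\mathcal F(\mathcal L)$ by the level curves of $F$. Then $\mathcal W(\mathcal L)$ is an $(m^2+1)$-web (its discriminant is not the whole plane), and at every point outside its discriminant $\mathcal F(\mathcal L)$ is not linear and $$\mathrm{rk}\,\mathcal W(\mathcal L)\ \ge\ \frac{(m^2-1)(m^2-2)}{2}+(r-1)^2-1 .$$ In particular, if $(r,m)=(3,2)$ or $(r,m)=(4,3)$, then $\mathcal W(\mathcal L)$ has maximal rank. As a consequence,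 the following webs on $\mathbb C^2$ are exceptional at every point outside their discriminants (which are not all of $\mathbb C^2$): Bol's $5$-web $\mathcal B_5$, with first integrals $$x,\quad y,\quad \frac{x}{1-y},\quad \frac{y}{1-x},\quad \frac{xy}{(1-x)(1-y)},$$ and the $10$-web $\mathcal H_{10}$ formed by the Hesse pencil of cubics, with first integral $\frac{x^3+y^3+1}{xy}$, and by the nine pencils of lines through its base points, with first integrals $x+\xi^i y$, $\frac{y+\xi^i}{x}$, $\frac{x+\xi^i}{y}$ ($i=0,1,2$, $\xi=e^{2\pi i/3}$). -/

import Mathlib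

open Filter Topology

noncomputable section

namespace PlanarWeb

/-! ## Germs of webs on the complex plane -/

/-- The affine plane `ℂ²`. -/
abbrev Plane : Type := Fin 2 → ℂ

/-- A differential `1`-form on (some part of) `ℂ²`. -/
abbrev Form : Type := Plane → (Plane →L[ℂ] ℂ)

/-- The coefficient of `dx ∧ dy` in `α ∧ β`. -/
def wedge (α β : Plane →L[ℂ] ℂ) : ℂ :=
  α ![1, 0] * β ![0, 1] - α ![0, 1] * β ![1, 0]

/-- `dη = 0` at the point `v`: the derivative of `η` is a symmetric bilinear form. -/
def IsClosedAt (η : Form) (v : Plane) : Prop :=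
  ∀ u w : Plane, fderiv ℂ η v u w = fderiv ℂ η v w u

/-- The forms `ω i` define a germ of regular web at `q`: they are holomorphic and do not vanish
at `q`, and their kernels are pairwise transverse at `q`. -/
structure IsRegularWebAt {ι : Type} (ω : ι → Form) (q : Plane) : Prop where
  analytic : ∀ i, AnalyticAt ℂ (ω i) q
  ne_zero : ∀ i, ω i q ≠ 0
  transverse : ∀ i j, i ≠ j → wedge (ω i q) (ω j q) ≠ 0

/-- The forms `η i` are representatives, near `q`, of an abelian relation of the web defined by
the forms `ω i`: they are holomorphic, closed, `η i ∧ ω i = 0` and `∑ i, η i = 0`. -/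
structure IsAbelianRelationAt {ι : Type} [Fintype ι] (ω η : ι → Form) (q : Plane) : Prop where
  analytic : ∀ i, AnalyticAt ℂ (η i) q
  closed : ∀ i, ∀ᶠ v in 𝓝 q, IsClosedAt (η i) v
  wedge_eq_zero : ∀ i, ∀ᶠ v in 𝓝 q, wedge (η i v) (ω i v) = 0
  sum_eq_zero : ∀ᶠ v in 𝓝 q, ∑ i, η i v = 0

theorem IsAbelianRelationAt.zero {ι : Type} [Fintype ι] (ω : ι → Form) (q : Plane) :
    IsAbelianRelationAt ω (fun _ _ => 0) q where
  analytic _ := analyticAt_const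
  closed _ := .of_forall fun v u w => by simp
  wedge_eq_zero _ := .of_forall fun v => by simp [wedge]
  sum_eq_zero := .of_forall fun v => by simp

theorem IsAbelianRelationAt.add {ι : Type} [Fintype ι] {ω η θ : ι → Form} {q : Plane}
    (hη : IsAbelianRelationAt ω η q) (hθ : IsAbelianRelationAt ω θ q) :
    IsAbelianRelationAt ω (fun i v => η i v + θ i v) q where
  analytic i := (hη.analytic i).add (hθ.analytic i)
  closed i := by
    filter_upwards [hη.closed i, hθ.closed i, (hη.analytic i).eventually_analyticAt,
      (hθ.analytic i).eventually_analyticAt] with v h₁ h₂ h₃ h₄ u w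
    rw [fderiv_fun_add h₃.differentiableAt h₄.differentiableAt]
    simp [h₁ u w, h₂ u w]
  wedge_eq_zero i := by
    filter_upwards [hη.wedge_eq_zero i, hθ.wedge_eq_zero i] with v h₁ h₂
    simp only [wedge, add_apply] at *
    linear_combination h₁ + h₂
  sum_eq_zero := by
    filter_upwards [hη.sum_eq_zero, hθ.sum_eq_zero] with v h₁ h₂
    rw [Finset.sum_add_distrib, h₁, h₂, add_zero]

theorem IsAbelianRelationAt.smul {ι : Type} [Fintype ι] {ω η : ι → Form} {q : Plane} (c : ℂ)
    (hη : IsAbelianRelationAt ω η q) : IsAbelianRelationAt ω (fun i v => c • η i v) q where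
  analytic i := (analyticAt_const (v := c)).fun_smul (hη.analytic i)
  closed i := by
    filter_upwards [hη.closed i, (hη.analytic i).eventually_analyticAt] with v h₁ h₃ u w
    rw [fderiv_fun_const_smul h₃.differentiableAt]
    simp [h₁ u w]
  wedge_eq_zero i := by
    filter_upwards [hη.wedge_eq_zero i] with v h₁
    simp only [wedge, smul_apply, smul_eq_mul] at *
    linear_combination c * h₁
  sum_eq_zero := by
    filter_upwards [hη.sum_eq_zero] with v h₁
    rw [← Finset.smul_sum, h₁, smul_zero]

/-- The space of abelian relations of a germ of web at `q`, a space of tuples of germs of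
`1`-forms at `q`. -/
def abelianRelations {ι : Type} [Fintype ι] (ω : ι → Form) (q : Plane) :
    Submodule ℂ (ι → Germ (𝓝 q) (Plane →L[ℂ] ℂ)) where
  carrier := {a | ∃ η : ι → Form, IsAbelianRelationAt ω η q ∧
    a = fun i => ((η i : Form) : Germ (𝓝 q) (Plane →L[ℂ] ℂ))}
  zero_mem' := ⟨_, .zero ω q, rfl⟩
  add_mem' := by
    rintro _ _ ⟨η, hη, rfl⟩ ⟨θ, hθ, rfl⟩
    exact ⟨_, hη.add hθ, rfl⟩
  smul_mem' := by
    rintro c _ ⟨η, hη, rfl⟩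
    exact ⟨_, hη.smul c, rfl⟩

/-- The rank of a germ of web: the dimension of its space of abelian relations. -/
def webRank {ι : Type} [Fintype ι] (ω : ι → Form) (q : Plane) : Cardinal :=
  Module.rank ℂ (abelianRelations ω q)

/-- The Castelnuovo number `π(2, k) = ∑_{j ≥ 1} max (0, k - j - 1)`
(the truncated subtraction of `ℕ` is the maximum with `0`). -/
def castelnuovoNumber (k : ℕ) : ℕ := ∑ j ∈ Finset.Icc 1 k, (k - j - 1)

/-- The rank of the germ of web attains the bound `π(2, k)`. -/
def HasMaximalRank {ι : Type} [Fintype ι] (ω : ι → Form) (q : Plane) : Prop :=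
  webRank ω q = (castelnuovoNumber (Fintype.card ι) : Cardinal)

/-- The foliation defined near `q` by the nonvanishing form `ω` is linear: for every `v` near
`q`, the line through `v` tangent to the foliation at `v` is, near `v`, a leaf. -/
def IsLinearAt (ω : Form) (q : Plane) : Prop :=
  ∀ᶠ v in 𝓝 q, ∀ u : Plane, ω v u = 0 → ∀ᶠ t in 𝓝 (0 : ℂ), ω (v + t • u) u = 0

/-! ## Affine charts of the projective plane -/

/-- Homogeneous coordinates in `ℂ³`: the representative of the point with affine coordinates `v`
in the chart of `ℙ²` where the `c`-th homogeneous coordinate is `1`. -/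
def chart (c : Fin 3) (v : Plane) : Fin 3 → ℂ :=
  Fin.insertNth (α := fun _ => ℂ) c 1 v

/-! ## Algebraizable and exceptional webs -/

/-- In the chart `(z₀, z₁) ↦ [z₀ : z₁ : 1]` and for a field of lines `ℓ` (given by coefficients
of linear equations, `z ∈ ℓ z`), the form `∑ j, ℓ z j * dx_j`, whose kernel is the direction
of `ℓ z`. -/
def lineFieldForm (ℓ : Plane → Fin 3 → ℂ) : Form :=
  fun z => fderiv ℂ (fun y : Plane => ℓ z ⬝ᵥ chart 2 y) z

/-- The germ at `y` of the web defined by the forms `α i` is the algebraic web dual to a plane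
curve: there is a curve `G = 0` of degree `k` in the dual projective plane, `k` being the number
of foliations, such that the directions of the foliations at `z` are those of the `k` lines
through `z` that belong to the curve. (As these `k` lines are pairwise distinct, the curve is
reduced.) -/
def IsAlgebraicAt {ι : Type} [Fintype ι] (α : ι → Form) (y : Plane) : Prop :=
  IsRegularWebAt α y ∧
  ∃ G : MvPolynomial (Fin 3) ℂ, G ≠ 0 ∧ G.IsHomogeneous (Fintype.card ι) ∧
    ∃ ℓ : ι → Plane → Fin 3 → ℂ, ∀ i, AnalyticAt ℂ (ℓ i) y ∧ ℓ i y ≠ 0 ∧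
      ∀ᶠ z in 𝓝 y, ℓ i z ⬝ᵥ chart 2 z = 0 ∧ MvPolynomial.eval (ℓ i z) G = 0 ∧
        wedge (α i z) (lineFieldForm (ℓ i) z) = 0

/-- The germ at `q` of the web defined by the forms `ω i` is analytically equivalent to the germ
at `y` of the web defined by the forms `α i`: a germ of biholomorphism `φ` pulls the foliations
of the second one back to those of the first one. -/
def AreEquivalentAt {ι : Type} (ω : ι → Form) (q : Plane) (α : ι → Form) (y : Plane) : Prop :=
  ∃ φ : Plane → Plane, φ q = y ∧ AnalyticAt ℂ φ q ∧
    Function.Bijective (fderiv ℂ φ q) ∧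
    ∃ σ : Equiv.Perm ι, ∀ i, ∀ᶠ v in 𝓝 q,
      wedge (ω i v) ((α (σ i) (φ v)).comp (fderiv ℂ φ v)) = 0

/-- The germ of web is analytically equivalent to an algebraic one. -/
def IsAlgebraizableAt {ι : Type} [Fintype ι] (ω : ι → Form) (q : Plane) : Prop :=
  ∃ (α : ι → Form) (y : Plane), IsAlgebraicAt α y ∧ AreEquivalentAt ω q α y

/-- A germ of exceptional web: of maximal rank, and not algebraizable. -/
def IsExceptionalAt {ι : Type} [Fintype ι] (ω : ι → Form) (q : Plane) : Prop :=
  HasMaximalRank ω q ∧ ¬ IsAlgebraizableAt ω q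

/-! ## Global webs -/

/-- The global forms `Ω i` define foliations with singularities, possibly with superfluous
divisors of zeros. `DefinesNear Ω ω q` says that `q` lies outside the discriminant of their
superposition, and that the `ω i` are generators near `q` of these foliations. -/
structure DefinesNear {ι : Type} (Ω ω : ι → Form) (q : Plane) : Prop where
  regular : IsRegularWebAt ω q
  nontrivial : ∀ i, ∃ᶠ v in 𝓝 q, Ω i v ≠ 0
  wedge_eq_zero : ∀ i, ∀ᶠ v in 𝓝 q, wedge (ω i v) (Ω i v) = 0

/-- The form `g df - f dg`, which defines the foliation by the level curves of `f / g`. -/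
def pencilForm (f g : Plane → ℂ) : Form :=
  fun v => g v • fderiv ℂ f v - f v • fderiv ℂ g v

/-! ## Nets in the projective plane and their webs -/

/-- The complex projective plane. It also serves as the dual plane: the line `ℓ` with
coefficients `[a : b : c]` is the set of points `p` with `p.orthogonal ℓ`. -/
abbrev ProjPlane : Type := Projectivization ℂ (Fin 3 → ℂ)

/-- `(L, P)` is an `(r, m)`-net, with the classes of lines `L i`, and the set `P` of points. -/
structure IsNet (r m : ℕ) (L : Fin r → Finset ProjPlane) (P : Finset ProjPlane) : Prop where
  three_le : 3 ≤ r
  card_eq : ∀ i, (L i).card = m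
  disjoint : ∀ i j, i ≠ j → Disjoint (L i) (L j)
  meet_mem : ∀ i j, i ≠ j → ∀ ℓ ∈ L i, ∀ ℓ' ∈ L j, ∀ p : ProjPlane,
    p.orthogonal ℓ → p.orthogonal ℓ' → p ∈ P
  existsUnique : ∀ p ∈ P, ∀ i, ∃! ℓ : ProjPlane, ℓ ∈ L i ∧ p.orthogonal ℓ

/-- A linear form cutting out the line `ℓ`. -/
def lineEq (ℓ : ProjPlane) : MvPolynomial (Fin 3) ℂ :=
  ∑ j, MvPolynomial.C (ℓ.rep j) * MvPolynomial.X j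

/-- The rational function `F = A / B` of degree `m` on `ℙ²` takes `r` distinct values
`c i = [a i : b i]` in `ℙ¹` whose fibres `b i * A - a i * B = 0` are the unions of the lines
in the classes `L i`. -/
def IsNetMap {r : ℕ} (m : ℕ) (L : Fin r → Finset ProjPlane) (A B : MvPolynomial (Fin 3) ℂ) :
    Prop :=
  A.IsHomogeneous m ∧ B.IsHomogeneous m ∧ IsRelPrime A B ∧
  ∃ a b : Fin r → ℂ, (∀ i j, i ≠ j → a i * b j ≠ a j * b i) ∧
    ∀ i, MvPolynomial.C (b i) * A - MvPolynomial.C (a i) * B = ∏ ℓ ∈ L i, lineEq ℓ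

/-- In the chart `c`, the form `det (p, x, dx)`, which defines the pencil of lines through `p`. -/
def radialForm (p : ProjPlane) (c : Fin 3) : Form :=
  fun v => fderiv ℂ (fun y : Plane => p.rep ⬝ᵥ crossProduct (chart c v) (chart c y)) v

/-- In the chart `c`, the superposition of the pencils of lines through the points of `P` and of
the foliation by the level curves of `A / B`. -/
def netWeb (P : Finset ProjPlane) (A B : MvPolynomial (Fin 3) ℂ) (c : Fin 3) :
    Option P → Form
  | some p => radialForm p.1 c
  | none => pencilForm (fun v => MvPolynomial.eval (chart c v) A)
      (fun v => MvPolynomial.eval (chart c v) B)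

/-! ## Bol's web and the web of the Hesse pencil -/

/-- Bol's `5`-web: the foliations with first integrals
`x`, `y`, `x / (1 - y)`, `y / (1 - x)`, `x y / ((1 - x) (1 - y))`. -/
def bolWeb : Fin 5 → Form :=
  ![pencilForm (fun v => v 0) (fun _ => 1),
    pencilForm (fun v => v 1) (fun _ => 1),
    pencilForm (fun v => v 0) (fun v => 1 - v 1),
    pencilForm (fun v => v 1) (fun v => 1 - v 0),
    pencilForm (fun v => v 0 * v 1) (fun v => (1 - v 0) * (1 - v 1))]

/-- `exp (2 i π / 3)`. -/
def cubeRoot : ℂ := Complex.exp (2 * Complex.I * Real.pi / 3)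

/-- The `10`-web `ℋ₁₀`: the foliations with first integrals `x + ξ^i y`, `(y + ξ^i) / x`,
`(x + ξ^i) / y` for `i = 0, 1, 2`, which are the pencils of lines through the nine base points of
the Hesse pencil, and the Hesse pencil `(x³ + y³ + 1) / (x y)`. -/
def hesseWeb : Fin 3 ⊕ Fin 3 ⊕ Fin 3 ⊕ Unit → Form
  | .inl i => pencilForm (fun v => v 0 + cubeRoot ^ (i : ℕ) * v 1) (fun _ => 1)
  | .inr (.inl i) => pencilForm (fun v => v 1 + cubeRoot ^ (i : ℕ)) (fun v => v 0)
  | .inr (.inr (.inl i)) => pencilForm (fun v => v 0 + cubeRoot ^ (i : ℕ)) (fun v => v 1)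
  | .inr (.inr (.inr _)) => pencilForm (fun v => v 0 ^ 3 + v 1 ^ 3 + 1) (fun v => v 0 * v 1)

/-- A web on `ℂ²` (with singularities) is exceptional: it has a regular point, and its germs at
all regular points are exceptional. -/
def IsExceptional {ι : Type} [Fintype ι] (Ω : ι → Form) : Prop :=
  (∃ q ω, DefinesNear Ω ω q) ∧ ∀ q ω, DefinesNear Ω ω q → IsExceptionalAt ω q

end PlanarWeb

end

/-!
The rank of a regular `k`-web is at most `(k - 1) (k - 2) / 2` (`webRank_le`): the leading Taylor
part of a component of an abelian relation is `c L ^ j dL`, where `L` is the linear form of the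
foliation at the point, and any `j + 2` of the forms `L ^ j dL` are linearly independent, so
`k - j - 2` linear conditions of order `j`, for each `j`, force an abelian relation to vanish.

The lower bound comes from two explicit families of abelian relations of the web of an
`(r, m)`-net. Let `n = m ^ 2` be the number of its points.

* A form `Q` of degree `n - 3` gives a relation between the `n` pencils of lines
  (`pencilRelation`), whose components are the residues, on the lines dual to the points, of a
  rational `2`-form with numerator `Q`. The components sum to zero by Lagrange's interpolation
  formula (`sum_div_prod_eq_zero`), and they are closed by Euler's identity
  (`isClosedAt_smul_radial`). A form of degree `n - 3` that vanishes on `n` lines is zero, so this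
  family has dimension `(n - 1) (n - 2) / 2`.
* Let `u_1, …, u_r` be the logarithms of the equations of the lines of the net through one of its
  points. Their differences are constant along the pencil of lines through this point. So, if the
  matrix `M` has zero row and column sums and the vector `a` has zero sum, then
  `∑ M i j u_i du_j + ∑ a_j du_j` is a closed form along this pencil (`wedge_logForm`,
  `isClosedAt_logForm`). For the same reason, the same expression in the logarithms of the
  equations of the classes is a closed form along the pencil of curves. If moreover `M` has zero
  diagonal, then the former, with `a` replaced by `a / m`, sum over the points to the latter, as
  any two lines of distinct classes meet in exactly one point of the net (`sum_logForm`). The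
  latter is not zero unless `M` and `a` are, since the logarithms of the functions `t - c_i` are
  linearly independent over the rational functions (`eq_zero_of_log_relation`). This
  family has dimension `r (r - 2) = (r - 1) ^ 2 - 1`.

The component along the pencil of curves separates the two families, so the dimensions add up
(`Net.le_webRank`). For `(r, m) = (3, 2)` and `(4, 3)` the sum is the upper bound
(`Net.hasMaximalRank`).

The pencil of curves is not linear: the equations of the classes are proportional along a line that
contains a leaf, so this line meets two classes at once, that is, at a point of the net, and the
leaf is tangent to the pencil of lines through this point (`Net.not_isLinearAt`). The pencil of
curves exists because the equations of two classes are proportional on each line of a third one,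
where they have the same zeros, with a ratio that does not depend on the line; so they differ by a
multiple of the equation of the third class (`LineNet.exists_poly_eq`).

An algebraic web is linear (`IsAlgebraicAt.isInflectionAt`). A local biholomorphism that maps four
linear foliations to linear ones maps all lines to lines, because the inflection of the
image of a line is a binary cubic in its direction, which has four zeros. So a web that contains
four pencils of lines and a foliation that is not linear is not algebraizable
(`not_isAlgebraizableAt`). Bol's web and the web of the Hesse pencil are the webs of a
`(3, 2)`-net (`bolNet`) and of a `(4, 3)`-net (`hesseNet`), so they are exceptional.
-/

noncomputable section

namespace PlanarWeb

open Asymptotics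

/-! ### Covectors in the plane -/

theorem covector_apply (α : Plane →L[ℂ] ℂ) (u : Plane) :
    α u = u 0 * α ![1, 0] + u 1 * α ![0, 1] := by
  have h : u = u 0 • ![1, 0] + u 1 • ![0, 1] := by
    ext i; fin_cases i <;> simp
  calc α u = α (u 0 • ![1, 0] + u 1 • ![0, 1]) := congrArg α h
    _ = _ := by rw [map_add, map_smul, map_smul, smul_eq_mul, smul_eq_mul]

theorem covector_ext {α β : Plane →L[ℂ] ℂ} (h₀ : α ![1, 0] = β ![1, 0])
    (h₁ : α ![0, 1] = β ![0, 1]) : α = β := by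
  ext u
  rw [covector_apply α, covector_apply β, h₀, h₁]

theorem wedge_self (α : Plane →L[ℂ] ℂ) : wedge α α = 0 := by
  simp only [wedge]; ring

theorem wedge_comm (α β : Plane →L[ℂ] ℂ) : wedge α β = -wedge β α := by
  simp only [wedge]; ring

/-- The value of `α ∧ β` on a pair of vectors. -/
theorem apply_mul_apply_sub (α β : Plane →L[ℂ] ℂ) (u w : Plane) :
    α u * β w - α w * β u = wedge α β * (u 0 * w 1 - u 1 * w 0) := by
  rw [covector_apply α u, covector_apply β w, covector_apply α w, covector_apply β u, wedge]
  ring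

theorem wedge_cyclic (α β γ : Plane →L[ℂ] ℂ) (u : Plane) :
    wedge α β * γ u + wedge β γ * α u + wedge γ α * β u = 0 := by
  rw [covector_apply α u, covector_apply β u, covector_apply γ u]
  simp only [wedge]
  ring

theorem wedge_eq_zero_of_wedge_eq_zero {α β γ : Plane →L[ℂ] ℂ} (hγ : γ ≠ 0)
    (h₁ : wedge α γ = 0) (h₂ : wedge β γ = 0) : wedge α β = 0 := by
  by_contra h
  refine hγ (ContinuousLinearMap.ext fun u => ?_)
  have := wedge_cyclic α β γ u
  rw [h₂, wedge_comm γ α, h₁] at this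
  simpa [h] using this

theorem exists_eq_smul_of_wedge_eq_zero {α β : Plane →L[ℂ] ℂ} (hα : α ≠ 0)
    (h : wedge α β = 0) : ∃ c : ℂ, β = c • α := by
  obtain ⟨e, he⟩ : ∃ e, α e ≠ 0 := by
    by_contra! h'
    exact hα (ContinuousLinearMap.ext h')
  refine ⟨β e / α e, ContinuousLinearMap.ext fun u => ?_⟩
  have := apply_mul_apply_sub α β e u
  rw [h, zero_mul] at this
  simp only [smul_apply, smul_eq_mul]
  field_simp
  linear_combination this

theorem apply_eq_zero_of_wedge_eq_zero {α β : Plane →L[ℂ] ℂ} (hα : α ≠ 0)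
    (h : wedge α β = 0) {u : Plane} (hu : α u = 0) : β u = 0 := by
  obtain ⟨c, rfl⟩ := exists_eq_smul_of_wedge_eq_zero hα h
  simp [hu]

/-- Two covectors that vanish on the same nonzero vector are proportional. -/
theorem wedge_eq_zero_of_apply_eq_zero {α β : Plane →L[ℂ] ℂ} {u : Plane} (hu : u ≠ 0)
    (hα : α u = 0) (hβ : β u = 0) : wedge α β = 0 := by
  by_contra h
  refine hu (funext fun i => ?_)
  have h₀ := apply_mul_apply_sub α β u ![1, 0]
  have h₁ := apply_mul_apply_sub α β u ![0, 1]
  simp only [hα, hβ] at h₀ h₁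
  fin_cases i <;> simp_all

/-- A vector spanning the kernel of a nonzero covector. -/
def kerVec (α : Plane →L[ℂ] ℂ) : Plane := ![-α ![0, 1], α ![1, 0]]

theorem apply_kerVec (α β : Plane →L[ℂ] ℂ) : β (kerVec α) = wedge α β := by
  rw [covector_apply β]
  simp [kerVec, wedge]
  ring

theorem kerVec_ne_zero {α : Plane →L[ℂ] ℂ} (h : α ≠ 0) : kerVec α ≠ 0 := by
  intro h'
  refine h (covector_ext ?_ ?_)
  · simpa [kerVec] using congrFun h' 1
  · simpa [kerVec] using congrFun h' 0

theorem exists_apply_eq_one {α : Plane →L[ℂ] ℂ} (h : α ≠ 0) : ∃ e, α e = 1 := by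
  obtain ⟨e, he⟩ : ∃ e, α e ≠ 0 := by
    by_contra! h'
    exact h (ContinuousLinearMap.ext h')
  exact ⟨(α e)⁻¹ • e, by simp [he]⟩

/-- In coordinates adapted to a covector `α` with `α e = 1`. -/
theorem eq_smul_add_smul_kerVec {α : Plane →L[ℂ] ℂ} {e : Plane} (he : α e = 1) (u : Plane) :
    u = α u • e + (e 0 * u 1 - e 1 * u 0) • kerVec α := by
  have h := covector_apply α e
  rw [he] at h
  rw [covector_apply α u]
  ext i
  fin_cases i
  · simp [kerVec]; linear_combination (u 0) * h
  · simp [kerVec]; linear_combination (u 1) * h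

/-! ### Identity principles -/

theorem _root_.AnalyticAt.form_apply {E F : Type*} [NormedAddCommGroup E] [NormedSpace ℂ E]
    [NormedAddCommGroup F] [NormedSpace ℂ F] {X : Type*} [NormedAddCommGroup X] [NormedSpace ℂ X]
    {θ : X → E →L[ℂ] F} {q : X} (hθ : AnalyticAt ℂ θ q) (u : E) :
    AnalyticAt ℂ (fun v => θ v u) q :=
  ((ContinuousLinearMap.apply ℂ F u).analyticAt _).comp hθ

theorem hasDerivAt_comp_line {E F : Type*} [NormedAddCommGroup E] [NormedSpace ℂ E]
    [NormedAddCommGroup F] [NormedSpace ℂ F] {g : E → F} {v u : E} {s : ℂ}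
    (h : DifferentiableAt ℂ g (v + s • u)) :
    HasDerivAt (fun s : ℂ => g (v + s • u)) (fderiv ℂ g (v + s • u) u) s := by
  have h₁ : HasDerivAt (fun s : ℂ => v + s • u) u s := by
    simpa using ((hasDerivAt_id s).smul_const u).const_add v
  exact h.hasFDerivAt.comp_hasDerivAt s h₁

theorem wedge_analyticAt {η ω : Form} {q : Plane} (hη : AnalyticAt ℂ η q)
    (hω : AnalyticAt ℂ ω q) : AnalyticAt ℂ (fun v => wedge (η v) (ω v)) q := by
  unfold wedge
  exact ((hη.form_apply _).mul (hω.form_apply _)).sub ((hη.form_apply _).mul (hω.form_apply _))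

/-- An analytic germ vanishes if its product with a form does, and if the form is not
identically zero near the point. -/
theorem eventually_eq_zero_of_frequently {f : Plane → ℂ} {Ω : Form} {q : Plane}
    (hf : AnalyticAt ℂ f q) (hΩa : ∀ᶠ v in 𝓝 q, ContinuousAt Ω v) (hne : ∃ᶠ v in 𝓝 q, Ω v ≠ 0)
    (h : ∀ᶠ v in 𝓝 q, Ω v ≠ 0 → f v = 0) : ∀ᶠ v in 𝓝 q, f v = 0 := by
  obtain ⟨ε, hε, hball⟩ := Metric.eventually_nhds_iff_ball.1
    (hf.eventually_analyticAt.and (hΩa.and h))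
  obtain ⟨v, hv, hvb⟩ := (hne.and_eventually (Metric.ball_mem_nhds q hε)).exists
  have hz : f =ᶠ[𝓝 v] 0 := by
    filter_upwards [Metric.isOpen_ball.mem_nhds hvb, (hball v hvb).2.1.eventually_ne hv] with w h₁ h₂
    exact (hball w h₁).2.2 h₂
  have := AnalyticOnNhd.eqOn_zero_of_preconnected_of_eventuallyEq_zero
    (fun w hw => (hball w hw).1) (convex_ball q ε).isPreconnected hvb hz
  filter_upwards [Metric.ball_mem_nhds q hε] with w hw using this hw

/-- A form that is tangent to `Ω i` is tangent to the regular foliation `ω i`, also where `Ω i`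
vanishes. -/
theorem DefinesNear.wedge_eq_zero_of_wedge_eq_zero {ι : Type} {Ω ω : ι → Form} {q : Plane}
    (h : DefinesNear Ω ω q) (i : ι) (hΩ : AnalyticAt ℂ (Ω i) q) {η : Form}
    (hη : AnalyticAt ℂ η q) (hw : ∀ᶠ v in 𝓝 q, wedge (η v) (Ω i v) = 0) :
    ∀ᶠ v in 𝓝 q, wedge (η v) (ω i v) = 0 := by
  refine eventually_eq_zero_of_frequently (Ω := Ω i) (wedge_analyticAt hη (h.regular.analytic i))
    (hΩ.eventually_analyticAt.mono fun v hv => hv.continuousAt)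
    (h.nontrivial i) ?_
  filter_upwards [hw, h.wedge_eq_zero i] with v h₁ h₂ h₃
  exact PlanarWeb.wedge_eq_zero_of_wedge_eq_zero h₃ h₁ h₂

/-! ### Closed forms -/

theorem fderiv_form_apply {η : Form} {v : Plane} (h : DifferentiableAt ℂ η v) (u w : Plane) :
    fderiv ℂ (fun x => η x w) v u = fderiv ℂ η v u w := by
  rw [fderiv_clm_apply h (differentiableAt_const w)]
  simp

/-! ### Taylor expansions -/

theorem isBigO_norm_pow {n j : ℕ} (h : n ≤ j) :
    (fun y : Plane => ‖y‖ ^ j) =O[𝓝 0] fun y => ‖y‖ ^ n := by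
  refine .of_bound 1 ?_
  filter_upwards [Metric.ball_mem_nhds (0 : Plane) one_pos] with y hy
  rw [mem_ball_zero_iff] at hy
  simpa using pow_le_pow_of_le_one (norm_nonneg y) hy.le h

/-- The leading homogeneous part, of degree `j`, of an analytic germ that vanishes to
order `j`. -/
theorem exists_leading_part {g : Plane → ℂ} {q : Plane} (hg : AnalyticAt ℂ g q) {j : ℕ}
    (hj : (fun y => g (q + y)) =O[𝓝 0] fun y => ‖y‖ ^ j) :
    ∃ P : Plane → ℂ, AnalyticOnNhd ℂ P Set.univ ∧ (∀ (s : ℂ) u, P (s • u) = s ^ j * P u) ∧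
      (fun y => g (q + y) - P y) =O[𝓝 0] fun y => ‖y‖ ^ (j + 1) := by
  obtain ⟨p, hp⟩ := hg
  have key : ∀ n, n < j → ∀ y, p n (fun _ => y) = 0 := by
    intro n
    induction n using Nat.strong_induction_on with
    | _ n ih =>
      intro hn
      refine Asymptotics.IsBigO.continuousMultilinearMap_apply_eq_zero ?_
      have h₁ := hp.isBigO_sub_partialSum_pow (n + 1)
      have h₂ : (fun y : Plane => ‖y‖ ^ j) =O[𝓝 0] fun y => ‖y‖ ^ (n + 1) :=
        isBigO_norm_pow hn
      refine ((hj.trans h₂).sub h₁).congr_left fun y => ?_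
      rw [FormalMultilinearSeries.partialSum, Finset.sum_range_succ,
        Finset.sum_eq_zero fun k hk => ih k (Finset.mem_range.1 hk)
          ((Finset.mem_range.1 hk).trans hn) y]
      ring
  refine ⟨fun y => p j fun _ => y, ?_, fun s u => ?_, ?_⟩
  · rw [← contDiff_omega_iff_analyticOnNhd]
    exact (p j).contDiff.comp (contDiff_pi.2 fun _ => contDiff_id)
  · simpa using (p j).map_smul_univ (fun _ => s) (fun _ => u)
  · refine (hp.isBigO_sub_partialSum_pow (j + 1)).congr_left fun y => ?_
    rw [FormalMultilinearSeries.partialSum, Finset.sum_range_succ,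
        Finset.sum_eq_zero fun k hk => key k (Finset.mem_range.1 hk) y]
    ring

theorem eventually_eq_zero_of_isBigO {g : Plane → ℂ} {q : Plane} (hg : AnalyticAt ℂ g q)
    (h : ∀ j : ℕ, (fun y => g (q + y)) =O[𝓝 0] fun y => ‖y‖ ^ j) : ∀ᶠ v in 𝓝 q, g v = 0 := by
  obtain ⟨p, hp⟩ := hg
  have key : ∀ n, ∀ y, p n (fun _ => y) = 0 := by
    intro n
    induction n using Nat.strong_induction_on with
    | _ n ih =>
      refine Asymptotics.IsBigO.continuousMultilinearMap_apply_eq_zero ?_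
      have h₁ := hp.isBigO_sub_partialSum_pow (n + 1)
      refine ((h (n + 1)).sub h₁).congr_left fun y => ?_
      rw [FormalMultilinearSeries.partialSum, Finset.sum_range_succ,
        Finset.sum_eq_zero fun k hk => ih k (Finset.mem_range.1 hk) y]
      ring
  filter_upwards [hp.eventually_hasSum_sub] with v hv
  simp only [key] at hv
  exact hv.unique hasSum_zero

/-- A directional derivative lowers the order of vanishing by at most one (Cauchy's
estimate). -/
theorem isBigO_fderiv_apply {g : Plane → ℂ} {q : Plane} (hg : AnalyticAt ℂ g q) {j : ℕ}
    (hj : (fun y => g (q + y)) =O[𝓝 0] fun y => ‖y‖ ^ (j + 1)) (u : Plane) :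
    (fun y => fderiv ℂ g (q + y) u) =O[𝓝 0] fun y => ‖y‖ ^ j := by
  obtain ⟨C, hC⟩ := hj.bound
  obtain ⟨ε, hε, hball⟩ := Metric.eventually_nhds_iff_ball.1 hC
  obtain ⟨δ, hδ, hball'⟩ := Metric.eventually_nhds_iff_ball.1 hg.eventually_analyticAt
  set K : ℝ := C * 2 ^ (j + 1) * (‖u‖ + 1) with hK
  have hlt : ∀ y : Plane, ∀ s : ℂ, ‖s‖ ≤ ‖y‖ / (‖u‖ + 1) → ‖y + s • u‖ ≤ 2 * ‖y‖ := by
    intro y s hs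
    have h₁ : ‖s‖ * ‖u‖ ≤ ‖y‖ := by
      rw [le_div_iff₀ (by positivity)] at hs
      nlinarith [norm_nonneg s]
    calc ‖y + s • u‖ ≤ ‖y‖ + ‖s • u‖ := norm_add_le _ _
      _ ≤ 2 * ‖y‖ := by rw [norm_smul]; linarith
  have hC0 : ∀ y : Plane, y ≠ 0 → ‖y‖ < ε → 0 ≤ C := fun y hy hy' => by
    have := (norm_nonneg _).trans (hball y (by simpa using hy'))
    exact nonneg_of_mul_nonneg_left this (norm_pos_iff.2 (pow_ne_zero _ (norm_ne_zero_iff.2 hy)))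
  have hpunct : ∀ᶠ y in 𝓝[≠] (0 : Plane), ‖fderiv ℂ g (q + y) u‖ ≤ K * ‖y‖ ^ j := by
    filter_upwards [self_mem_nhdsWithin, nhdsWithin_le_nhds
      (Metric.ball_mem_nhds (0 : Plane) (half_pos (lt_min hε hδ)))] with y hy hy'
    have hy0 : 0 < ‖y‖ := norm_pos_iff.2 hy
    rw [mem_ball_zero_iff, lt_div_iff₀ two_pos, lt_min_iff] at hy'
    have hd : ∀ s : ℂ, ‖s‖ ≤ ‖y‖ / (‖u‖ + 1) →
        HasDerivAt (fun s : ℂ => g (q + y + s • u)) (fderiv ℂ g (q + y + s • u) u) s := by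
      intro s hs
      refine hasDerivAt_comp_line (hball' _ ?_).differentiableAt
      rw [mem_ball_iff_norm, show q + y + s • u - q = y + s • u by abel]
      linarith [hlt y s hs]
    have hR : 0 < ‖y‖ / (‖u‖ + 1) := div_pos hy0 (by positivity)
    have := Complex.norm_deriv_le_of_forall_mem_sphere_norm_le (c := 0)
      (f := fun s : ℂ => g (q + y + s • u)) (C := C * (2 * ‖y‖) ^ (j + 1)) hR ?_ ?_
    · rw [(hd 0 (by simpa using hR.le)).deriv] at this
      simp only [zero_smul, add_zero] at this
      refine this.trans (le_of_eq ?_)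
      rw [hK]
      field_simp
      ring
    · refine DifferentiableOn.diffContOnCl fun s hs => ?_
      rw [closure_ball _ hR.ne', mem_closedBall_zero_iff] at hs
      exact (hd s hs).differentiableAt.differentiableWithinAt
    · intro s hs
      rw [mem_sphere_zero_iff_norm] at hs
      have h₂ := hlt y s hs.le
      have := hball (y + s • u) (by rw [mem_ball_zero_iff]; linarith)
      rw [← add_assoc] at this
      refine this.trans ?_
      have := hC0 y hy (by linarith)
      simp only [norm_pow, norm_norm]
      gcongr
  have hcont : ContinuousAt (fun y => ‖fderiv ℂ g (q + y) u‖) 0 := by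
    have h₁ : ContinuousAt (fun y => fderiv ℂ g (q + y)) 0 :=
      ContinuousAt.comp (by simpa using hg.fderiv.continuousAt) (by fun_prop)
    exact (h₁.clm_apply continuousAt_const).norm
  refine .of_bound K ?_
  have h0 : ‖fderiv ℂ g (q + 0) u‖ ≤ K * ‖(0 : Plane)‖ ^ j :=
    le_of_tendsto_of_tendsto (hcont.tendsto.mono_left nhdsWithin_le_nhds)
      ((show ContinuousAt (fun y : Plane => K * ‖y‖ ^ j) 0 by fun_prop).tendsto.mono_left
        nhdsWithin_le_nhds) hpunct
  filter_upwards [eventually_nhdsWithin_iff.1 hpunct] with y hy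
  rw [norm_pow, norm_norm]
  by_cases h : y = 0
  · subst h; exact h0
  · exact hy h

/-! ### Bol's bound on the rank -/

/-- A function that is homogeneous of degree `j - 1` and `O (‖y‖ ^ j)` at `0` vanishes. -/
theorem eq_zero_of_homogeneous_of_isBigO {f : Plane → ℂ} {j : ℕ} {u : Plane}
    (hf : ∀ s : ℂ, s ≠ 0 → s * f (s • u) = s ^ j * f u)
    (hO : f =O[𝓝 0] fun y => ‖y‖ ^ j) : f u = 0 := by
  have h₁ : Tendsto (fun s : ℂ => s • u) (𝓝[≠] 0) (𝓝 0) := by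
    have : Tendsto (fun s : ℂ => s • u) (𝓝 0) (𝓝 ((0 : ℂ) • u)) :=
      (continuous_id.smul continuous_const).tendsto 0
    rw [zero_smul] at this
    exact this.mono_left nhdsWithin_le_nhds
  obtain ⟨C, hC⟩ := (hO.comp_tendsto h₁).bound
  have h₂ : ∀ᶠ s in 𝓝[≠] (0 : ℂ), ‖f u‖ ≤ C * ‖u‖ ^ j * ‖s‖ := by
    filter_upwards [hC, self_mem_nhdsWithin] with s hs hs0
    have h0 : 0 < ‖s‖ := norm_pos_iff.2 hs0
    simp only [Function.comp, norm_smul, norm_pow, norm_norm, norm_mul] at hs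
    have h3 : ‖s‖ ^ j * ‖f u‖ ≤ ‖s‖ ^ j * (C * ‖u‖ ^ j * ‖s‖) := by
      rw [← norm_pow, ← norm_mul, ← hf s hs0, norm_mul, norm_pow]
      refine (mul_le_mul_of_nonneg_left hs h0.le).trans (le_of_eq ?_)
      ring
    exact le_of_mul_le_mul_left h3 (pow_pos h0 j)
  have h₃ : Tendsto (fun s : ℂ => C * ‖u‖ ^ j * ‖s‖) (𝓝[≠] 0) (𝓝 0) := by
    have : Tendsto (fun s : ℂ => C * ‖u‖ ^ j * ‖s‖) (𝓝 0) (𝓝 (C * ‖u‖ ^ j * ‖(0 : ℂ)‖)) :=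
      (continuous_const.mul continuous_norm).tendsto 0
    rw [norm_zero, mul_zero] at this
    exact this.mono_left nhdsWithin_le_nhds
  exact norm_le_zero_iff.1 (ge_of_tendsto h₃ h₂)

/-- The leading part of a closed form `η` with `η ∧ ω = 0` is `c L ^ j dL`, where `L` is the
linear form `ω q`. -/
theorem exists_leading_coeff {η ω : Form} {q : Plane} (hη : AnalyticAt ℂ η q)
    (hω : AnalyticAt ℂ ω q) (h0 : ω q ≠ 0) (hcl : ∀ᶠ v in 𝓝 q, IsClosedAt η v)
    (hw : ∀ᶠ v in 𝓝 q, wedge (η v) (ω v) = 0) {j : ℕ}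
    (hj : (fun y => η (q + y)) =O[𝓝 0] fun y => ‖y‖ ^ j) :
    ∃ c : ℂ, (fun y => η (q + y) - (c * ω q y ^ j) • ω q) =O[𝓝 0] fun y => ‖y‖ ^ (j + 1) := by
  obtain ⟨e, he⟩ := exists_apply_eq_one h0
  set k := kerVec (ω q) with hk
  have hshift : Tendsto (fun y => q + y) (𝓝 0) (𝓝 q) := by
    simpa using (continuous_const_add q).tendsto (0 : Plane)
  have happ : ∀ u : Plane, (fun y => η (q + y) u) =O[𝓝 0] fun y => ‖y‖ ^ j := fun u =>
    (IsBigO.of_bound ‖u‖ (.of_forall fun y => by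
      rw [mul_comm]; exact (η (q + y)).le_opNorm u)).trans hj
  obtain ⟨P, hPa, hPh, hPO⟩ := exists_leading_part (hη.form_apply e) (happ e)
  -- near `q` the form `η` is the multiple `η e • W` of the normalized form `W`
  set W : Form := fun v => (ω v e)⁻¹ • ω v with hW
  have hωe : ω q e ≠ 0 := by simp [he]
  have hWa : AnalyticAt ℂ W q := ((hω.form_apply e).inv hωe).smul hω
  have hWq : W q = ω q := by simp [hW, he]
  have hηW : ∀ᶠ v in 𝓝 q, η v = η v e • W v := by
    filter_upwards [hw, (hω.form_apply e).continuousAt.eventually_ne hωe] with v h₁ h₂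
    ext u
    have := apply_mul_apply_sub (η v) (ω v) u e
    rw [h₁] at this
    simp only [hW, smul_apply, smul_eq_mul]
    field_simp
    linear_combination this
  have hWO : (fun y => W (q + y) - ω q) =O[𝓝 0] fun y => ‖y‖ := by
    have := (hWa.differentiableAt.isBigO_sub).comp_tendsto hshift
    simpa [Function.comp_def, hWq] using this.norm_right
  have hηk : (fun y => η (q + y) k) =O[𝓝 0] fun y => ‖y‖ ^ (j + 1) := by
    have h₁ : (fun y => W (q + y) k) =O[𝓝 0] fun y => ‖y‖ := by
      refine (IsBigO.of_bound ‖k‖ (.of_forall fun y => ?_)).trans hWO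
      have : W (q + y) k = (W (q + y) - ω q) k := by
        rw [sub_apply, hk, apply_kerVec (ω q) (ω q), wedge_self, sub_zero]
      rw [this, mul_comm]
      exact (W (q + y) - ω q).le_opNorm k
    refine ((happ e).mul h₁).congr' ?_ (.of_forall fun y => by simp [pow_succ])
    filter_upwards [hshift.eventually hηW] with y hy
    conv_rhs => rw [hy]
    rfl
  -- closedness: the derivative of `η e` along `k` is that of `η k` along `e`
  have hDP : ∀ y, fderiv ℂ P y k = 0 := by
    have h₁ := isBigO_fderiv_apply (hη.form_apply k) hηk e
    have hPs : AnalyticAt ℂ (fun v => P (v - q)) q :=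
      (hPa _ (Set.mem_univ _)).comp (analyticAt_id.sub analyticAt_const)
    have h₂ := isBigO_fderiv_apply (g := fun v => η v e - P (v - q))
      ((hη.form_apply e).sub hPs) (by simpa using hPO) k
    have h₃ : (fun y => fderiv ℂ P y k) =O[𝓝 0] fun y => ‖y‖ ^ j := by
      refine (h₁.sub h₂).congr' ?_ .rfl
      filter_upwards [hshift.eventually hcl, hshift.eventually hη.eventually_analyticAt] with y h₄ h₅
      have hPd : HasFDerivAt (fun v => P (v - q)) (fderiv ℂ P y) (q + y) := by
        have hd : HasFDerivAt P (fderiv ℂ P y) (q + y - q) := by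
          rw [add_sub_cancel_left]
          exact (hPa y (Set.mem_univ _)).differentiableAt.hasFDerivAt
        have := hd.comp (q + y) ((hasFDerivAt_id (q + y)).sub_const q)
        rwa [ContinuousLinearMap.comp_id] at this
      rw [fderiv_fun_sub (h₅.form_apply e).differentiableAt hPd.differentiableAt, hPd.fderiv,
        sub_apply, fderiv_form_apply h₅.differentiableAt, fderiv_form_apply h₅.differentiableAt,
        h₄ e k]
      ring
    intro y
    refine eq_zero_of_homogeneous_of_isBigO (f := fun y => fderiv ℂ P y k) (fun s _ => ?_) h₃
    have h₄ := hasDerivAt_comp_line (g := P) (v := s • y) (u := s • k) (s := 0)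
      (hPa _ (Set.mem_univ _)).differentiableAt
    have h₅ := (hasDerivAt_comp_line (g := P) (v := y) (u := k) (s := 0)
      (hPa _ (Set.mem_univ _)).differentiableAt).const_mul (s ^ j)
    have := h₄.unique (h₅.congr_of_eventuallyEq (.of_forall fun t => by
      change P _ = s ^ j * P _
      rw [← hPh]; congr 1; module))
    simpa using this
  have hPk : ∀ (y : Plane) (s : ℂ), P (y + s • k) = P y := by
    intro y s
    have hd : ∀ s, HasDerivAt (fun s : ℂ => P (y + s • k)) 0 s := fun s => by
      have := hasDerivAt_comp_line (g := P) (v := y) (u := k) (s := s)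
        (hPa _ (Set.mem_univ _)).differentiableAt
      rwa [hDP] at this
    have := is_const_of_deriv_eq_zero (fun s => (hd s).differentiableAt) (fun s => (hd s).deriv) s 0
    simpa using this
  have hPc : ∀ y, P y = P e * ω q y ^ j := fun y => by
    conv_lhs => rw [eq_smul_add_smul_kerVec he y, ← hk, hPk, hPh, mul_comm]
  refine ⟨P e, ?_⟩
  have hPj : P =O[𝓝 0] fun y => ‖y‖ ^ j :=
    ((happ e).sub (hPO.trans (isBigO_norm_pow j.le_succ))).congr_left fun y => by ring
  have hW1 : (fun y => W (q + y)) =O[𝓝 0] fun _ => (1 : ℝ) :=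
    (ContinuousAt.comp (g := W) (by simpa using hWa.continuousAt)
      (by fun_prop : ContinuousAt (fun y => q + y) 0)).isBigO_one ℝ
  have h₁ : (fun y => (η (q + y) e - P y) • W (q + y)) =O[𝓝 0] fun y => ‖y‖ ^ (j + 1) :=
    (hPO.smul hW1).congr_right fun y => by simp
  have h₂ : (fun y => P y • (W (q + y) - ω q)) =O[𝓝 0] fun y => ‖y‖ ^ (j + 1) :=
    (hPj.smul hWO).congr_right fun y => by simp [pow_succ]
  refine (h₁.add h₂).congr' ?_ .rfl
  filter_upwards [hshift.eventually hηW] with y hy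
  rw [← hPc]
  conv_rhs => rw [hy]
  module

/-- Any `n + 1` powers of degree `n` of pairwise independent linear forms are linearly
independent. -/
theorem eq_zero_of_sum_mul_pow_eq_zero {ι : Type*} {L : ι → Plane →L[ℂ] ℂ}
    (hL : ∀ i j, i ≠ j → wedge (L i) (L j) ≠ 0) (h0 : ∀ i, L i ≠ 0) (n : ℕ) :
    ∀ (S : Finset ι) (c : ι → ℂ), S.card ≤ n + 1 → (∀ u, ∑ i ∈ S, c i * L i u ^ n = 0) →
      ∀ i ∈ S, c i = 0 := by
  classical
  induction n with
  | zero =>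
    intro S c hS h i hi
    obtain rfl : S = {i} := by
      refine (Finset.eq_of_subset_of_card_le (by simpa using hi) (by simpa using hS)).symm
    simpa using h 0
  | succ n ih =>
    intro S c hS h
    -- differentiating along the kernel of `L i` removes the `i`-th term
    have key : ∀ i ∈ S, ∀ l ∈ S, l ≠ i → c l = 0 := by
      intro i hi l hl hli
      have := ih (S.erase i) (fun l => c l * L l (kerVec (L i)))
        (by rw [Finset.card_erase_of_mem hi]; omega) (fun u => ?_) l
        (Finset.mem_erase.2 ⟨hli, hl⟩)
      · rw [apply_kerVec] at this
        exact (mul_eq_zero.1 this).resolve_right (hL i l hli.symm)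
      · have hd : HasDerivAt (fun s : ℂ => ∑ l ∈ S, c l * L l (u + s • kerVec (L i)) ^ (n + 1))
            (∑ l ∈ S, c l * (((n + 1 : ℕ) : ℂ) * L l u ^ n * L l (kerVec (L i)))) 0 := by
          refine HasDerivAt.fun_sum fun l _ => HasDerivAt.const_mul _ ?_
          have := (hasDerivAt_comp_line (g := L l) (v := u) (u := kerVec (L i)) (s := 0)
            (L l).differentiableAt).fun_pow (n + 1)
          simpa using this
        have h₂ := hd.unique ((hasDerivAt_const (0 : ℂ) (0 : ℂ)).congr_of_eventuallyEq
          (.of_forall fun s => h _))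
        rw [← Finset.add_sum_erase S _ hi, apply_kerVec, wedge_self, mul_zero, mul_zero,
          zero_add] at h₂
        have h₃ : ((n + 1 : ℕ) : ℂ) ≠ 0 := by exact_mod_cast n.succ_ne_zero
        refine mul_left_cancel₀ h₃ ?_
        rw [mul_zero, ← h₂, Finset.mul_sum]
        exact Finset.sum_congr rfl fun l _ => by ring
    intro i hi
    obtain ⟨e, he⟩ := exists_apply_eq_one (h0 i)
    have := h e
    rw [← Finset.add_sum_erase S _ hi, Finset.sum_eq_zero fun l hl => by
      rw [key i hi l (Finset.mem_of_mem_erase hl) (Finset.ne_of_mem_erase hl), zero_mul]] at this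
    simpa [he] using this

/-- The coefficients of the leading parts of the components of an abelian relation, all of which
vanish to order `j`, satisfy `∑ i, c i * L i ^ (j + 1) = 0`. -/
theorem sum_leading_coeff_eq_zero {ι : Type} [Fintype ι] {ω η : ι → Form} {q : Plane}
    (hη : IsAbelianRelationAt ω η q) {j : ℕ} {c : ι → ℂ}
    (hc : ∀ i, (fun y => η i (q + y) - (c i * ω i q y ^ j) • ω i q) =O[𝓝 0]
      fun y => ‖y‖ ^ (j + 1)) (u : Plane) : ∑ i, c i * ω i q u ^ (j + 1) = 0 := by
  have hshift : Tendsto (fun y => q + y) (𝓝 0) (𝓝 q) := by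
    simpa using (continuous_const_add q).tendsto (0 : Plane)
  have h₁ : (fun y => ∑ i, (η i (q + y) - (c i * ω i q y ^ j) • ω i q)) =O[𝓝 0]
      fun y => ‖y‖ ^ (j + 1) := IsBigO.fun_sum fun i _ => hc i
  refine eq_zero_of_homogeneous_of_isBigO (j := j + 2)
    (f := fun u => ∑ i, c i * ω i q u ^ (j + 1)) (fun s _ => ?_) ?_
  · rw [Finset.mul_sum, Finset.mul_sum]
    refine Finset.sum_congr rfl fun i _ => ?_
    rw [map_smul, smul_eq_mul]
    ring
  · have h₂ : (fun y => (∑ i, (η i (q + y) - (c i * ω i q y ^ j) • ω i q)) y) =O[𝓝 0]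
        fun y => ‖y‖ ^ (j + 2) := by
      refine IsBigO.trans (IsBigO.of_bound 1 (.of_forall fun y => ?_))
        ((h₁.norm_left.mul (isBigO_refl (fun y : Plane => ‖y‖) (𝓝 0))).congr_right fun y =>
          (pow_succ _ _).symm)
      rw [one_mul, norm_mul, norm_norm, norm_norm]
      exact ContinuousLinearMap.le_opNorm _ _
    refine h₂.neg_left.congr' ?_ .rfl
    filter_upwards [hshift.eventually hη.sum_eq_zero] with y hy
    rw [Finset.sum_sub_distrib, hy, zero_sub, neg_apply, neg_neg, sum_apply]
    refine Finset.sum_congr rfl fun i _ => ?_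
    rw [smul_apply, smul_eq_mul]
    ring

theorem le_analyticOrderAt_of_isBigO {f : ℂ → ℂ} (hf : AnalyticAt ℂ f 0) {n : ℕ}
    (hO : f =O[𝓝 0] fun t : ℂ => t ^ n) : (n : ℕ∞) ≤ analyticOrderAt f 0 := by
  by_contra! hlt
  obtain ⟨m, hm⟩ := ENat.ne_top_iff_exists.1 hlt.ne_top
  rw [← hm, ENat.natCast_lt_natCast] at hlt
  obtain ⟨g, hg, hg0, hfg⟩ := (hf.analyticOrderAt_eq_natCast).1 hm.symm
  obtain ⟨C, hC⟩ := hO.bound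
  have h₁ : ∀ᶠ t in 𝓝[≠] (0 : ℂ), ‖g t‖ ≤ C * ‖t‖ ^ (n - m) := by
    filter_upwards [nhdsWithin_le_nhds hC, nhdsWithin_le_nhds hfg, self_mem_nhdsWithin]
      with t h₁ h₂ h₃
    have h0 : 0 < ‖t‖ := norm_pos_iff.2 h₃
    rw [h₂, sub_zero, norm_smul, norm_pow, norm_pow, ← Nat.add_sub_cancel' hlt.le, pow_add] at h₁
    exact le_of_mul_le_mul_left (h₁.trans (le_of_eq (by ring))) (pow_pos h0 m)
  have h₂ : Tendsto (fun t : ℂ => C * ‖t‖ ^ (n - m)) (𝓝[≠] 0) (𝓝 0) := by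
    have : Tendsto (fun t : ℂ => C * ‖t‖ ^ (n - m)) (𝓝 0) (𝓝 (C * ‖(0 : ℂ)‖ ^ (n - m))) :=
      (by fun_prop : Continuous fun t : ℂ => C * ‖t‖ ^ (n - m)).tendsto 0
    rw [norm_zero, zero_pow (Nat.sub_pos_of_lt hlt).ne', mul_zero] at this
    exact this.mono_left nhdsWithin_le_nhds
  have h₃ : Tendsto (fun t => ‖g t‖) (𝓝[≠] 0) (𝓝 ‖g 0‖) :=
    hg.continuousAt.norm.tendsto.mono_left nhdsWithin_le_nhds
  exact hg0 (norm_le_zero_iff.1 (le_of_tendsto_of_tendsto h₃ h₂ h₁))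

theorem iteratedDeriv_const_mul_pow_self (c : ℂ) (j : ℕ) :
    iteratedDeriv j (fun t : ℂ => c * t ^ j) 0 = c * (j.factorial : ℂ) := by
  rw [iteratedDeriv_const_mul_field, iteratedDeriv_fun_pow_zero, if_pos rfl]

/-- If the form `η` vanishes to order `j` at `q` with leading part `c L ^ j dL`, then `j! * c` is
a derivative of order `j` of `η`. -/
theorem leading_coeff_eq_zero {η : Form} {q e : Plane} (hη : AnalyticAt ℂ η q)
    {α : Plane →L[ℂ] ℂ} (he : α e = 1) {j : ℕ} {c : ℂ}
    (hc : (fun y => η (q + y) - (c * α y ^ j) • α) =O[𝓝 0] fun y => ‖y‖ ^ (j + 1))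
    (h : iteratedDeriv j (fun t : ℂ => η (q + t • e) e) 0 = 0) : c = 0 := by
  set f : ℂ → ℂ := fun t => η (q + t • e) e with hf
  have hline : AnalyticAt ℂ (fun t : ℂ => q + t • e) 0 := by fun_prop
  have hfa : AnalyticAt ℂ f 0 :=
    AnalyticAt.fun_comp (g := fun v => η v e) (by simpa using hη.form_apply e) hline
  have hlim : Tendsto (fun t : ℂ => t • e) (𝓝 0) (𝓝 0) := by
    simpa using (by fun_prop : Continuous fun t : ℂ => t • e).tendsto 0
  -- `f t = c * t ^ j + O (t ^ (j + 1))`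
  have hfO : (fun t => f t - c * t ^ j) =O[𝓝 0] fun t : ℂ => t ^ (j + 1) := by
    have h₁ := hc.comp_tendsto hlim
    have h₂ : (fun t : ℂ => f t - c * t ^ j) =O[𝓝 0] fun t : ℂ => ‖t • e‖ ^ (j + 1) := by
      refine IsBigO.trans (IsBigO.of_bound ‖e‖ (.of_forall fun t => ?_)) h₁
      have := (η (q + t • e) - (c * α (t • e) ^ j) • α).le_opNorm e
      simpa [he, hf, mul_comm] using this
    refine h₂.trans (IsBigO.of_bound (‖e‖ ^ (j + 1)) (.of_forall fun t => ?_))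
    rw [norm_smul, norm_pow, norm_mul, norm_norm, norm_norm, norm_pow, mul_pow, mul_comm]
  have hfa' : AnalyticAt ℂ (fun t => f t - c * t ^ j) 0 := hfa.sub (by fun_prop)
  have h₁ := (natCast_le_analyticOrderAt_iff_iteratedDeriv_eq_zero hfa').1
    (le_analyticOrderAt_of_isBigO hfa' hfO) j j.lt_succ_self
  rw [iteratedDeriv_fun_sub hfa.contDiffAt (by fun_prop), h, iteratedDeriv_const_mul_pow_self,
    zero_sub, neg_eq_zero] at h₁
  exact (mul_eq_zero.1 h₁).resolve_right (by exact_mod_cast j.factorial_ne_zero)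

/-- Two representatives of the same tuple of germs agree near the point. -/
theorem exists_rep {ι : Type} [Fintype ι] {ω : ι → Form} {q : Plane}
    (a : abelianRelations ω q) : ∃ η : ι → Form, IsAbelianRelationAt ω η q ∧
      ∀ i, a.1 i = ((η i : Form) : Germ (𝓝 q) (Plane →L[ℂ] ℂ)) := by
  obtain ⟨η, hη, h⟩ := a.2
  exact ⟨η, hη, congrFun h⟩

/-- An abelian relation is determined by the derivatives of order `j` of its `i`-th components
along a fixed transversal of the `i`-th foliation, where `i ≥ j + 2` in some enumeration of the
foliations. -/
theorem eventually_eq_zero_of_iteratedDeriv_eq_zero {ι : Type} [Fintype ι] {ω η : ι → Form}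
    {q : Plane} (hω : IsRegularWebAt ω q) (hη : IsAbelianRelationAt ω η q)
    (σ : ι ≃ Fin (Fintype.card ι)) {e : ι → Plane} (he : ∀ i, ω i q (e i) = 1)
    (h : ∀ (j : ℕ) (i : ι), j + 2 ≤ σ i →
      iteratedDeriv j (fun t : ℂ => η i (q + t • e i) (e i)) 0 = 0) (i : ι) :
    ∀ᶠ v in 𝓝 q, η i v = 0 := by
  have key : ∀ (j : ℕ) i, (fun y => η i (q + y)) =O[𝓝 0] fun y => ‖y‖ ^ j := by
    intro j
    induction j with
    | zero =>
      intro i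
      simpa using (ContinuousAt.comp (g := η i) (by simpa using (hη.analytic i).continuousAt)
        (by fun_prop : ContinuousAt (fun y => q + y) 0)).isBigO_one ℝ
    | succ j ih =>
      choose c hc using fun i => exists_leading_coeff (hη.analytic i) (hω.analytic i)
        (hω.ne_zero i) (hη.closed i) (hη.wedge_eq_zero i) (ih i)
      have h₁ : ∀ i, j + 2 ≤ σ i → c i = 0 := fun i hi =>
        leading_coeff_eq_zero (hη.analytic i) (he i) (hc i) (h j i hi)
      have h₂ := sum_leading_coeff_eq_zero hη hc
      set S : Finset ι := Finset.univ.filter fun i => (σ i : ℕ) < j + 2 with hS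
      have hcard : S.card ≤ j + 1 + 1 := by
        have : (S.image fun i => (σ i : ℕ)) ⊆ Finset.range (j + 2) := by
          intro x hx
          obtain ⟨i, hi, rfl⟩ := Finset.mem_image.1 hx
          simpa [hS] using hi
        rw [← Finset.card_image_of_injective S (Fin.val_injective.comp σ.injective)]
        exact (Finset.card_le_card this).trans (by simp)
      have h₃ := eq_zero_of_sum_mul_pow_eq_zero hω.transverse hω.ne_zero (j + 1) S c hcard
        (fun u => by
          rw [← h₂ u]
          refine Finset.sum_subset (Finset.subset_univ S) fun i _ hi => ?_
          rw [h₁ i (by simpa [hS] using hi), zero_mul])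
      have h₄ : ∀ i, c i = 0 := fun i => by
        by_cases hi : (σ i : ℕ) < j + 2
        · exact h₃ i (by simpa [hS] using hi)
        · exact h₁ i (not_lt.1 hi)
      intro i
      refine (hc i).congr_left fun y => ?_
      ext u
      simp [h₄ i]
  have happ : ∀ u, ∀ᶠ v in 𝓝 q, η i v u = 0 := fun u =>
    eventually_eq_zero_of_isBigO ((hη.analytic i).form_apply u) fun j =>
      (IsBigO.of_bound ‖u‖ (.of_forall fun y => by
        rw [mul_comm]; exact (η i (q + y)).le_opNorm u)).trans (key j i)
  filter_upwards [happ ![1, 0], happ ![0, 1]] with v h₁ h₂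
  exact covector_ext h₁ h₂

theorem castelnuovoNumber_eq (k : ℕ) : castelnuovoNumber k = ∑ j : Fin k, (k - (j + 2)) := by
  rw [castelnuovoNumber, Fin.sum_univ_eq_sum_range (fun j => k - (j + 2)) k,
    ← Finset.Ico_add_one_right_eq_Icc, Finset.sum_Ico_eq_sum_range, Nat.add_sub_cancel]
  exact Finset.sum_congr rfl fun j _ => by omega

/-- Bol's bound: an abelian relation is determined by the `k - j - 2` derivatives of order `j`,
for all `j`, of `eventually_eq_zero_of_iteratedDeriv_eq_zero`. -/
theorem webRank_le {ι : Type} [Fintype ι] {ω : ι → Form} {q : Plane} (hω : IsRegularWebAt ω q) :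
    webRank ω q ≤ (castelnuovoNumber (Fintype.card ι) : Cardinal) := by
  set k := Fintype.card ι with hk
  choose e he using fun i => exists_apply_eq_one (hω.ne_zero i)
  have σ : ι ≃ Fin k := Fintype.equivFin ι
  choose rep hrep hrepa using exists_rep (ω := ω) (q := q)
  have hder : ∀ (f g : Form), (f : Germ (𝓝 q) (Plane →L[ℂ] ℂ)) = (g : Germ (𝓝 q) _) →
      ∀ (j : ℕ) (u : Plane), iteratedDeriv j (fun t : ℂ => f (q + t • u) u) 0 =
        iteratedDeriv j (fun t : ℂ => g (q + t • u) u) 0 := by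
    intro f g h j u
    have hlim : Tendsto (fun t : ℂ => q + t • u) (𝓝 0) (𝓝 q) := by
      simpa using (by fun_prop : Continuous fun t : ℂ => q + t • u).tendsto 0
    refine Filter.EventuallyEq.iteratedDeriv_eq j ?_
    filter_upwards [hlim.eventually (Germ.coe_eq.1 h)] with t ht
    rw [ht]
  have han : ∀ f : Form, AnalyticAt ℂ f q → ∀ u : Plane,
      AnalyticAt ℂ (fun t : ℂ => f (q + t • u) u) 0 := fun f hf u =>
    AnalyticAt.fun_comp (g := fun v => f v u) (by simpa using hf.form_apply u)
      (by fun_prop : AnalyticAt ℂ (fun t : ℂ => q + t • u) 0)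
  let idx : (Σ j : Fin k, Fin (k - (j + 2))) → ι := fun x => σ.symm ⟨x.1 + 2 + x.2, by omega⟩
  let T : abelianRelations ω q →ₗ[ℂ] ((Σ j : Fin k, Fin (k - (j + 2))) → ℂ) :=
    { toFun := fun a x =>
        iteratedDeriv x.1 (fun t : ℂ => rep a (idx x) (q + t • e (idx x)) (e (idx x))) 0
      map_add' := by
        intro a b
        ext x
        have h₁ : ((rep (a + b) (idx x) : Form) : Germ (𝓝 q) (Plane →L[ℂ] ℂ)) =
            ((rep a (idx x) + rep b (idx x) : Form) : Germ (𝓝 q) _) := by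
          rw [Germ.coe_add, ← hrepa, ← hrepa, ← hrepa]; rfl
        rw [hder _ _ h₁, Pi.add_apply]
        exact iteratedDeriv_fun_add (han _ ((hrep a).analytic _) _).contDiffAt
          (han _ ((hrep b).analytic _) _).contDiffAt
      map_smul' := by
        intro c a
        ext x
        have h₁ : ((rep (c • a) (idx x) : Form) : Germ (𝓝 q) (Plane →L[ℂ] ℂ)) =
            ((c • rep a (idx x) : Form) : Germ (𝓝 q) _) := by
          rw [Germ.coe_smul, ← hrepa, ← hrepa]; rfl
        rw [hder _ _ h₁]
        exact iteratedDeriv_const_mul_field c _ }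
  have hT : Function.Injective T := by
    intro a b hab
    refine Subtype.ext (funext fun i => ?_)
    rw [hrepa a i, hrepa b i]
    have hz := eventually_eq_zero_of_iteratedDeriv_eq_zero hω
      ((hrep a).add ((hrep b).smul (-1))) σ he ?_ i
    · refine Germ.coe_eq.2 ?_
      filter_upwards [hz] with v hv
      ext u
      have := DFunLike.congr_fun hv u
      simp only [add_apply, smul_apply, smul_eq_mul, zero_apply] at this
      linear_combination this
    intro j i hji
    have hlt := (σ i).2
    have := congrFun hab ⟨⟨j, by omega⟩, ⟨σ i - (j + 2), by simp only; omega⟩⟩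
    have hidx : idx ⟨⟨j, by omega⟩, ⟨σ i - (j + 2), by simp only; omega⟩⟩ = i := by
      simp only [idx]
      rw [Equiv.symm_apply_eq]
      ext
      simp only
      omega
    simp only [T, LinearMap.coe_mk, AddHom.coe_mk] at this
    rw [hidx, ← sub_eq_zero, ← iteratedDeriv_fun_sub
      (han _ ((hrep a).analytic _) _).contDiffAt (han _ ((hrep b).analytic _) _).contDiffAt] at this
    simpa [sub_eq_add_neg] using this
  refine (LinearMap.rank_le_of_injective T hT).trans (le_of_eq ?_)
  rw [rank_fun', Fintype.card_sigma, castelnuovoNumber_eq]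
  simp

/-! ### Inflections and linear foliations -/

/-- The leaf at `v` of the foliation defined by `ω` has an inflection at `v`: its second
fundamental form with respect to the flat structure of `ℂ²` vanishes there. -/
def IsInflectionAt (ω : Form) (v : Plane) : Prop :=
  ∀ u, ω v u = 0 → fderiv ℂ ω v u u = 0

/-- Uniqueness for the linear differential equation `ψ' = h ψ`. -/
theorem eventually_eq_zero_of_deriv_eq_mul {ψ h : ℂ → ℂ} (hψ : AnalyticAt ℂ ψ 0)
    (hh : ContinuousAt h 0) (h0 : ψ 0 = 0) (hd : ∀ᶠ t in 𝓝 0, deriv ψ t = h t * ψ t) :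
    ∀ᶠ t in 𝓝 0, ψ t = 0 := by
  by_contra hne
  have htop : analyticOrderAt ψ 0 ≠ ⊤ := fun h => hne (analyticOrderAt_eq_top.1 h)
  obtain ⟨n, hn⟩ := ENat.ne_top_iff_exists.1 htop
  have h₁ : (fun t => ψ t) =O[𝓝 0] fun t : ℂ => t ^ n := by
    obtain ⟨g, hg, -, hgψ⟩ := (hψ.analyticOrderAt_eq_natCast).1 hn.symm
    have := ((isBigO_refl (fun t : ℂ => t ^ n) (𝓝 0)).mul (hg.continuousAt.isBigO_one ℂ))
    refine this.congr' ?_ (.of_forall fun t => by simp)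
    filter_upwards [hgψ] with t ht
    rw [ht, sub_zero, smul_eq_mul]
  have h₂ : deriv ψ =O[𝓝 0] fun t : ℂ => t ^ n :=
    (((hh.isBigO_one ℂ).mul h₁).congr_left fun t => rfl).congr'
      (by filter_upwards [hd] with t ht; exact ht.symm) (.of_forall fun t => by simp)
  have h₃ := le_analyticOrderAt_of_isBigO hψ.deriv h₂
  have h₄ := hψ.analyticOrderAt_deriv_add_one
  simp only [h0, sub_zero] at h₄
  rw [← hn] at h₄
  have h₅ : ((n : ℕ∞)) + 1 ≤ n := by
    rw [← h₄]; gcongr; rwa [h₄]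
  have : n + 1 ≤ n := by exact_mod_cast h₅
  omega

/-- A foliation all of whose leaves consist of inflections is linear. -/
theorem isLinearAt_of_isInflectionAt {ω : Form} {q : Plane} (hω : AnalyticAt ℂ ω q)
    (h0 : ω q ≠ 0) (h : ∀ᶠ v in 𝓝 q, IsInflectionAt ω v) : IsLinearAt ω q := by
  filter_upwards [h.eventually_nhds, hω.eventually_analyticAt, hω.continuousAt.eventually_ne h0]
    with v hv ha hne u hu
  obtain ⟨e, he⟩ := exists_apply_eq_one hne
  have hlim : ContinuousAt (fun t : ℂ => v + t • u) 0 := by fun_prop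
  have hlim' : Tendsto (fun t : ℂ => v + t • u) (𝓝 0) (𝓝 v) := by simpa using hlim.tendsto
  have hψ : AnalyticAt ℂ (fun t : ℂ => ω (v + t • u) u) 0 :=
    AnalyticAt.fun_comp (g := fun v => ω v u) (by simpa using ha.form_apply u) (by fun_prop)
  -- the component of `u` along `e` with respect to the kernel of `ω`
  set s : ℂ → ℂ := fun t => ω (v + t • u) u / ω (v + t • u) e with hs
  set B : ℂ → Plane →L[ℂ] Plane →L[ℂ] ℂ := fun t => fderiv ℂ ω (v + t • u) with hB
  have hωc : ContinuousAt (fun t : ℂ => ω (v + t • u)) 0 :=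
    ContinuousAt.comp (g := ω) (by simpa using ha.continuousAt) hlim
  have hBc : ContinuousAt B 0 :=
    ContinuousAt.comp (g := fderiv ℂ ω) (by simpa using ha.fderiv.continuousAt) hlim
  have hne' : ω (v + (0 : ℂ) • u) e ≠ 0 := by simp [he]
  have hsc : ContinuousAt s 0 :=
    (hωc.clm_apply continuousAt_const).div (hωc.clm_apply continuousAt_const) hne'
  refine eventually_eq_zero_of_deriv_eq_mul
    (h := fun t => (B t e (u - s t • e) + B t (u - s t • e) e + s t * B t e e) /
      ω (v + t • u) e) hψ ?_ (by simpa using hu) ?_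
  · have hk : ContinuousAt (fun t => u - s t • e) 0 :=
      continuousAt_const.sub (hsc.smul continuousAt_const)
    refine ContinuousAt.div (ContinuousAt.add (ContinuousAt.add ?_ ?_) (hsc.mul ?_))
      (hωc.clm_apply continuousAt_const) hne'
    · exact (hBc.clm_apply continuousAt_const).clm_apply hk
    · exact (hBc.clm_apply hk).clm_apply continuousAt_const
    · exact (hBc.clm_apply continuousAt_const).clm_apply continuousAt_const
  · filter_upwards [hlim'.eventually hv, hlim'.eventually ha.eventually_analyticAt,
      (hωc.clm_apply continuousAt_const).eventually_ne hne'] with t h₁ h₂ h₃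
    have hd := hasDerivAt_comp_line (g := fun v => ω v u) (v := v) (u := u) (s := t)
      (h₂.form_apply u).differentiableAt
    rw [hd.deriv, fderiv_form_apply h₂.differentiableAt]
    have h₄ := h₁ (u - s t • e) (by simp [hs, h₃])
    simp only [map_sub, map_smul, sub_apply, smul_apply, smul_eq_mul] at h₄
    have h₅ : ω (v + t • u) u = s t * ω (v + t • u) e := by simp [hs, h₃]
    change B t u u = _
    change B t u u - s t * B t e u - s t * (B t u e - s t * B t e e) = 0 at h₄
    rw [h₅]
    simp only [map_sub, map_smul, sub_apply, smul_apply, smul_eq_mul]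
    field_simp
    linear_combination h₄

theorem fderiv_form_apply_apply {ω : Form} {v : Plane} (h : DifferentiableAt ℂ ω v)
    (u w : Plane) : HasDerivAt (fun t : ℂ => ω (v + t • u) w) (fderiv ℂ ω v u w) 0 := by
  have := hasDerivAt_comp_line (g := fun x => ω x w) (v := v) (u := u) (s := 0)
    (by simpa using h.clm_apply (differentiableAt_const w))
  rw [zero_smul, add_zero, fderiv_form_apply h] at this
  exact this

/-- Proportional forms have the same inflections. -/
theorem IsInflectionAt.congr {ω θ : Form} {v : Plane} (hθ : IsInflectionAt θ v)
    (hω' : DifferentiableAt ℂ ω v) (hθ' : DifferentiableAt ℂ θ v) (hω0 : ω v ≠ 0)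
    (hθ0 : θ v ≠ 0) (hw : ∀ᶠ z in 𝓝 v, wedge (ω z) (θ z) = 0) : IsInflectionAt ω v := by
  intro u hu
  have hu' := apply_eq_zero_of_wedge_eq_zero hω0 hw.self_of_nhds hu
  obtain ⟨e, he⟩ := exists_apply_eq_one hθ0
  have hlim : Tendsto (fun t : ℂ => v + t • u) (𝓝 0) (𝓝 v) := by
    simpa using (by fun_prop : Continuous fun t : ℂ => v + t • u).tendsto 0
  have h₁ := (((fderiv_form_apply_apply hω' u u).mul (fderiv_form_apply_apply hθ' u e)).sub
    ((fderiv_form_apply_apply hω' u e).mul (fderiv_form_apply_apply hθ' u u))).unique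
    ((hasDerivAt_const (0 : ℂ) (0 : ℂ)).congr_of_eventuallyEq (by
      filter_upwards [hlim.eventually hw] with t ht
      have := apply_mul_apply_sub (ω (v + t • u)) (θ (v + t • u)) u e
      rw [ht, zero_mul] at this
      exact this))
  simp only [zero_smul, add_zero, hu, hu', he, hθ u hu'] at h₁
  linear_combination h₁

/-! ### Algebraic webs are linear -/

theorem eq_zero_of_eventually_eval_eq_zero {σ : Type*} [Fintype σ] {G : MvPolynomial σ ℂ}
    {a : σ → ℂ} (h : ∀ᶠ x in 𝓝 a, MvPolynomial.eval x G = 0) : G = 0 := by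
  have ha : AnalyticOnNhd ℂ (fun x : σ → ℂ => MvPolynomial.eval x G) Set.univ :=
    AnalyticOnNhd.eval_mvPolynomial G
  refine MvPolynomial.funext fun x => ?_
  rw [map_zero]
  exact ha.eqOn_zero_of_preconnected_of_eventuallyEq_zero isPreconnected_univ (Set.mem_univ a) h
    (Set.mem_univ x)

theorem eval_smul_of_isHomogeneous {σ : Type*} {G : MvPolynomial σ ℂ} {n : ℕ}
    (hn : G.IsHomogeneous n) (s : ℂ) (x : σ → ℂ) :
    MvPolynomial.eval (s • x) G = s ^ n * MvPolynomial.eval x G := by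
  rw [MvPolynomial.eval_eq, MvPolynomial.eval_eq, Finset.mul_sum]
  refine Finset.sum_congr rfl fun d hd => ?_
  have hd' : ∑ i ∈ d.support, d i = n := by
    rw [← hn (MvPolynomial.mem_support_iff.1 hd)]
    simp [Finsupp.weight_apply, Finsupp.sum]
  simp only [Pi.smul_apply, smul_eq_mul, mul_pow, Finset.prod_mul_distrib]
  rw [Finset.prod_pow_eq_pow_sum, hd']
  ring

/-- A family of lines `ℓ z` that belong to an algebraic curve of the dual plane has rank at
most one. -/
theorem det_eq_zero_of_eval_eq_zero {G : MvPolynomial (Fin 3) ℂ} (hG : G ≠ 0) {n : ℕ}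
    (hn : G.IsHomogeneous n) {ℓ : Plane → Fin 3 → ℂ} {z : Plane} (hℓ : AnalyticAt ℂ ℓ z)
    (h : ∀ᶠ z in 𝓝 z, MvPolynomial.eval (ℓ z) G = 0) (u w : Plane) :
    (Matrix.of ![ℓ z, fderiv ℂ ℓ z u, fderiv ℂ ℓ z w]).det = 0 := by
  by_contra hdet
  refine hG (eq_zero_of_eventually_eval_eq_zero (a := ℓ z) ?_)
  have hs : HasStrictFDerivAt ℓ (fderiv ℂ ℓ z) z := hℓ.hasStrictFDerivAt
  have hΦ : HasStrictFDerivAt (fun x : ℂ × Plane => x.1 • ℓ x.2)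
      ((1 : ℂ) • (fderiv ℂ ℓ z).comp (ContinuousLinearMap.snd ℂ ℂ Plane) +
        (ContinuousLinearMap.fst ℂ ℂ Plane).smulRight (ℓ z)) ((1 : ℂ), z) :=
    hasStrictFDerivAt_fst.fun_smul (hs.comp ((1 : ℂ), z) hasStrictFDerivAt_snd)
  have hsurj : ((1 : ℂ) • (fderiv ℂ ℓ z).comp (ContinuousLinearMap.snd ℂ ℂ Plane) +
        (ContinuousLinearMap.fst ℂ ℂ Plane).smulRight (ℓ z)).range = ⊤ := by
    refine LinearMap.range_eq_top.2 fun c => ?_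
    set M := Matrix.of ![ℓ z, fderiv ℂ ℓ z u, fderiv ℂ ℓ z w] with hM
    set b := Matrix.vecMul c M⁻¹ with hb
    refine ⟨(b 0, b 1 • u + b 2 • w), ?_⟩
    have h₁ : Matrix.vecMul b M = c := by
      rw [hb, Matrix.vecMul_vecMul, Matrix.nonsing_inv_mul _ (Ne.isUnit hdet), Matrix.vecMul_one]
    rw [← h₁]
    ext i
    simp [Matrix.vecMul, dotProduct, Fin.sum_univ_three, hM]
    ring
  have hmap := hΦ.map_nhds_eq_of_surj hsurj
  rw [one_smul] at hmap
  rw [← hmap]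
  have h2 : ∀ᶠ x in 𝓝 ((1 : ℂ), z), MvPolynomial.eval (ℓ x.2) G = 0 :=
    (continuous_snd.tendsto ((1 : ℂ), z)).eventually h
  refine Filter.eventually_map.2 ?_
  filter_upwards [h2] with x hx
  rw [eval_smul_of_isHomogeneous hn, hx, mul_zero]

/-- The linear part of the chart `c`. -/
def chartDir (c : Fin 3) : Plane →L[ℂ] (Fin 3 → ℂ) :=
  LinearMap.toContinuousLinearMap
    { toFun := fun u => Fin.insertNth (α := fun _ => ℂ) c 0 u
      map_add' := fun u w => by
        rw [← Fin.insertNth_add, add_zero]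
      map_smul' := fun s u => by
        ext i
        refine Fin.succAboveCases c ?_ (fun j => ?_) i <;> simp }

theorem chartDir_apply (c : Fin 3) (u : Plane) :
    chartDir c u = Fin.insertNth (α := fun _ => ℂ) c 0 u := rfl

theorem chart_self (c : Fin 3) (v : Plane) : chart c v c = 1 := by
  simp [chart]

theorem chart_add (c : Fin 3) (v u : Plane) : chart c (v + u) = chart c v + chartDir c u := by
  rw [chart, chart, chartDir_apply, ← Fin.insertNth_add, add_zero]

theorem hasFDerivAt_chart (c : Fin 3) (v : Plane) : HasFDerivAt (chart c) (chartDir c) v := by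
  have h : chart c = fun y => chart c 0 + chartDir c y := by
    ext1 y; rw [← chart_add, zero_add]
  rw [h]
  exact (chartDir c).hasFDerivAt.const_add _

theorem analyticAt_chart (c : Fin 3) (v : Plane) : AnalyticAt ℂ (chart c) v := by
  have h : chart c = fun y => chart c 0 + chartDir c y := by
    ext1 y; rw [← chart_add, zero_add]
  rw [h]
  exact analyticAt_const.add ((chartDir c).analyticAt v)

theorem hasFDerivAt_dotProduct_chart (a : Fin 3 → ℂ) (c : Fin 3) (v : Plane) :
    HasFDerivAt (fun y : Plane => a ⬝ᵥ chart c y)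
      ((∑ i, a i • ContinuousLinearMap.proj (R := ℂ) (φ := fun _ : Fin 3 => ℂ) i).comp
        (chartDir c)) v := by
  have h : HasFDerivAt (fun x : Fin 3 → ℂ => a ⬝ᵥ x)
      (∑ i, a i • ContinuousLinearMap.proj (R := ℂ) (φ := fun _ : Fin 3 => ℂ) i) (chart c v) := by
    have : (fun x : Fin 3 → ℂ => a ⬝ᵥ x) =
        ⇑(∑ i, a i • ContinuousLinearMap.proj (R := ℂ) (φ := fun _ : Fin 3 => ℂ) i) := by
      ext x; simp [dotProduct]
    rw [this]
    exact ContinuousLinearMap.hasFDerivAt _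
  exact h.comp v (hasFDerivAt_chart c v)

theorem fderiv_dotProduct_chart (a : Fin 3 → ℂ) (c : Fin 3) (v u : Plane) :
    fderiv ℂ (fun y : Plane => a ⬝ᵥ chart c y) v u = a ⬝ᵥ chartDir c u := by
  rw [(hasFDerivAt_dotProduct_chart a c v).fderiv]
  simp [dotProduct]

theorem chart_two (v : Plane) : chart 2 v = ![v 0, v 1, 1] := by
  ext i; fin_cases i <;> rfl

theorem chartDir_two (v : Plane) : chartDir 2 v = ![v 0, v 1, 0] := by
  ext i; fin_cases i <;> rfl

theorem lineFieldForm_apply (ℓ : Plane → Fin 3 → ℂ) (z u : Plane) :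
    lineFieldForm ℓ z u = ℓ z 0 * u 0 + ℓ z 1 * u 1 := by
  rw [lineFieldForm, fderiv_dotProduct_chart, chartDir_two]
  simp [dotProduct, Fin.sum_univ_three]

theorem analyticAt_form {ω : Form} {v : Plane} (h : ∀ u, AnalyticAt ℂ (fun z => ω z u) v) :
    AnalyticAt ℂ ω v := by
  have : ω = fun z => ω z ![1, 0] • (ContinuousLinearMap.proj 0 : Plane →L[ℂ] ℂ) +
      ω z ![0, 1] • (ContinuousLinearMap.proj 1 : Plane →L[ℂ] ℂ) := by
    ext z u
    rw [covector_apply]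
    simp [mul_comm]
  rw [this]
  exact ((h _).smul analyticAt_const).add ((h _).smul analyticAt_const)

/-- The foliation whose tangents belong to an algebraic curve of the dual plane is linear. -/
theorem isInflectionAt_lineFieldForm {G : MvPolynomial (Fin 3) ℂ} (hG : G ≠ 0) {n : ℕ}
    (hn : G.IsHomogeneous n) {ℓ : Plane → Fin 3 → ℂ} {z : Plane} (hℓ : AnalyticAt ℂ ℓ z)
    (h0 : ℓ z ≠ 0) (hinc : ∀ᶠ z in 𝓝 z, ℓ z ⬝ᵥ chart 2 z = 0)
    (h : ∀ᶠ z in 𝓝 z, MvPolynomial.eval (ℓ z) G = 0) :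
    lineFieldForm ℓ z ≠ 0 ∧ AnalyticAt ℂ (lineFieldForm ℓ) z ∧
      IsInflectionAt (lineFieldForm ℓ) z := by
  have hcomp : ∀ i, AnalyticAt ℂ (fun z => ℓ z i) z := fun i =>
    ((ContinuousLinearMap.proj (R := ℂ) (φ := fun _ : Fin 3 => ℂ) i).analyticAt _).comp hℓ
  have han : AnalyticAt ℂ (lineFieldForm ℓ) z := analyticAt_form fun u => by
    simp only [lineFieldForm_apply]
    exact ((hcomp 0).mul analyticAt_const).add ((hcomp 1).mul analyticAt_const)
  have hz := hinc.self_of_nhds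
  simp only [chart_two, dotProduct, Fin.sum_univ_three] at hz
  simp at hz
  have hne : lineFieldForm ℓ z ≠ 0 := by
    intro h'
    have h₁ := lineFieldForm_apply ℓ z ![1, 0]
    have h₂ := lineFieldForm_apply ℓ z ![0, 1]
    rw [h'] at h₁ h₂
    simp at h₁ h₂
    refine h0 (funext fun i => ?_)
    fin_cases i
    · simpa using h₁.symm
    · simpa using h₂.symm
    · simpa [← h₁, ← h₂] using hz
  refine ⟨hne, han, fun u hu => ?_⟩
  set D := fderiv ℂ ℓ z with hD
  have hDi : ∀ w i, fderiv ℂ (fun z => ℓ z i) z w = D w i := fun w i => by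
    have := (hasFDerivAt_pi'.1 hℓ.differentiableAt.hasFDerivAt i).fderiv
    rw [this]; rfl
  -- the incidence relation, differentiated
  have hdinc : ∀ w, D w 0 * z 0 + D w 1 * z 1 + D w 2 + ℓ z 0 * w 0 + ℓ z 1 * w 1 = 0 := by
    intro w
    have h₁ : ∀ i, HasDerivAt (fun t : ℂ => ℓ (z + t • w) i) (D w i) 0 := fun i => by
      have := hasDerivAt_comp_line (g := fun z => ℓ z i) (v := z) (u := w) (s := 0)
        (by simpa using (hcomp i).differentiableAt)
      rwa [zero_smul, add_zero, hDi] at this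
    have h₂ : ∀ i, HasDerivAt (fun t : ℂ => (z + t • w) i) (w i) 0 := fun i => by
      simpa using ((hasDerivAt_id (0 : ℂ)).mul_const (w i)).const_add (z i)
    have hlim : Tendsto (fun t : ℂ => z + t • w) (𝓝 0) (𝓝 z) := by
      simpa using (by fun_prop : Continuous fun t : ℂ => z + t • w).tendsto 0
    have := ((((h₁ 0).mul (h₂ 0)).add ((h₁ 1).mul (h₂ 1))).add (h₁ 2)).unique
      ((hasDerivAt_const (0 : ℂ) (0 : ℂ)).congr_of_eventuallyEq (by
        filter_upwards [hlim.eventually hinc] with t ht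
        rw [chart_two] at ht
        simpa [dotProduct, Fin.sum_univ_three] using ht))
    simp only [zero_smul, add_zero] at this
    linear_combination this
  have hfd : fderiv ℂ (lineFieldForm ℓ) z u u = D u 0 * u 0 + D u 1 * u 1 := by
    rw [← fderiv_form_apply han.differentiableAt]
    simp only [lineFieldForm_apply]
    rw [fderiv_fun_add ((hcomp 0).differentiableAt.mul_const _)
      ((hcomp 1).differentiableAt.mul_const _), fderiv_mul_const (hcomp 0).differentiableAt,
      fderiv_mul_const (hcomp 1).differentiableAt]
    simp [hDi, mul_comm]
  obtain ⟨e, he⟩ := exists_apply_eq_one hne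
  rw [lineFieldForm_apply] at he hu
  have hdet := det_eq_zero_of_eval_eq_zero hG hn hℓ h u e
  rw [Matrix.det_fin_three] at hdet
  simp only [Matrix.of_apply, Matrix.cons_val] at hdet
  rw [← hD] at hdet
  have hu' := hdinc u
  have he' := hdinc e
  have hm : ℓ z 0 * D u 1 - ℓ z 1 * D u 0 = 0 := by
    have e1 : ℓ z 2 = -(ℓ z 0 * z 0 + ℓ z 1 * z 1) := by linear_combination hz
    have e2 : D u 2 = -(D u 0 * z 0 + D u 1 * z 1) := by linear_combination hu' - hu
    have e3 : D e 2 = -(D e 0 * z 0 + D e 1 * z 1) - 1 := by linear_combination he' - he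
    rw [e1, e2, e3] at hdet
    linear_combination -hdet
  rw [hfd]
  -- `u` is proportional to `(-ℓ z 1, ℓ z 0)`
  linear_combination (e 0 * u 1 - e 1 * u 0) * hm + (D u 0 * e 0 + D u 1 * e 1) * hu -
    (D u 0 * u 0 + D u 1 * u 1) * he

theorem IsAlgebraicAt.isInflectionAt {ι : Type} [Fintype ι] {α : ι → Form} {y : Plane}
    (h : IsAlgebraicAt α y) (i : ι) : ∀ᶠ z in 𝓝 y, IsInflectionAt (α i) z := by
  obtain ⟨hreg, G, hG, hn, ℓ, hℓ⟩ := h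
  obtain ⟨ha, h0, hev⟩ := hℓ i
  filter_upwards [hev.eventually_nhds, ha.eventually_analyticAt, ha.continuousAt.eventually_ne h0,
    (hreg.analytic i).eventually_analyticAt,
    (hreg.analytic i).continuousAt.eventually_ne (hreg.ne_zero i)] with z h₁ h₂ h₃ h₄ h₅
  obtain ⟨h₆, h₇, h₈⟩ := isInflectionAt_lineFieldForm hG hn h₂ h₃ (h₁.mono fun _ h => h.1)
    (h₁.mono fun _ h => h.2.1)
  exact h₈.congr h₄.differentiableAt h₇.differentiableAt h₅ h₆ (h₁.mono fun _ h => h.2.2)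

/-! ### Linear subwebs of four foliations determine the flat projective structure -/

/-- A binary cubic with four zeros vanishes. -/
theorem binary_cubic_eq_zero {c : Fin 4 → ℂ} {u : Fin 4 → Plane}
    (hu : ∀ i j, i ≠ j → u i 0 * u j 1 - u i 1 * u j 0 ≠ 0)
    (h : ∀ i, ∑ k : Fin 4, c k * (u i 0 ^ (k : ℕ) * u i 1 ^ (k.rev : ℕ)) = 0) : c = 0 := by
  refine Matrix.eq_zero_of_mulVec_eq_zero
    (M := Matrix.projVandermonde (fun i => u i 0) (fun i => u i 1)) ?_ ?_
  · rw [Matrix.det_projVandermonde]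
    refine Finset.prod_ne_zero_iff.2 fun i _ => Finset.prod_ne_zero_iff.2 fun j hj => ?_
    have := hu j i (Finset.mem_Ioi.1 hj).ne'
    intro h'
    exact this (by linear_combination h')
  · ext i
    refine Eq.trans ?_ (h i)
    rw [Matrix.mulVec, dotProduct]
    exact Finset.sum_congr rfl fun k _ => by rw [Matrix.projVandermonde_apply]; ring

/-- The derivative of a pullback. -/
theorem fderiv_pullback {α : Form} {φ : Plane → Plane} {v : Plane} (hφ : AnalyticAt ℂ φ v)
    (hα : AnalyticAt ℂ α (φ v)) (u w : Plane) :
    fderiv ℂ (fun z => (α (φ z)).comp (fderiv ℂ φ z)) v u w =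
      fderiv ℂ α (φ v) (fderiv ℂ φ v u) (fderiv ℂ φ v w) +
        α (φ v) (fderiv ℂ (fderiv ℂ φ) v u w) := by
  have h₁ : HasFDerivAt (fun z => α (φ z)) ((fderiv ℂ α (φ v)).comp (fderiv ℂ φ v)) v :=
    hα.differentiableAt.hasFDerivAt.comp v hφ.differentiableAt.hasFDerivAt
  have h₂ := h₁.clm_comp hφ.fderiv.differentiableAt.hasFDerivAt
  rw [h₂.fderiv]
  simp
  ring

theorem analyticAt_pullback {α : Form} {φ : Plane → Plane} {v : Plane} (hφ : AnalyticAt ℂ φ v)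
    (hα : AnalyticAt ℂ α (φ v)) :
    AnalyticAt ℂ (fun z => (α (φ z)).comp (fderiv ℂ φ z)) v := by
  refine analyticAt_form fun u => ?_
  have h₁ : ∀ i, AnalyticAt ℂ (fun z => fderiv ℂ φ z u i) v := fun i =>
    ((ContinuousLinearMap.proj (R := ℂ) (φ := fun _ : Fin 2 => ℂ) i).analyticAt _).comp
      (hφ.fderiv.form_apply u)
  have h₂ : ∀ w, AnalyticAt ℂ (fun z => α (φ z) w) v := fun w => (hα.form_apply w).comp hφ
  have : (fun z => (α (φ z)).comp (fderiv ℂ φ z) u) = fun z =>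
      fderiv ℂ φ z u 0 * α (φ z) ![1, 0] + fderiv ℂ φ z u 1 * α (φ z) ![0, 1] := by
    ext z
    exact covector_apply (α (φ z)) (fderiv ℂ φ z u)
  rw [this]
  exact ((h₁ 0).mul (h₂ _)).add ((h₁ 1).mul (h₂ _))

theorem cross_eq_zero_of_apply_eq_zero {α : Plane →L[ℂ] ℂ} (hα : α ≠ 0) {a b : Plane}
    (ha : α a = 0) (hb : α b = 0) : a 0 * b 1 - a 1 * b 0 = 0 := by
  by_contra h
  rw [covector_apply] at ha hb
  refine hα (covector_ext ?_ ?_) <;> refine mul_left_cancel₀ h ?_ <;>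
    simp only [zero_apply]
  · linear_combination (b 1) * ha - (a 1) * hb
  · linear_combination (a 0) * hb - (b 0) * ha

theorem apply_eq_zero_of_cross_eq_zero {α : Plane →L[ℂ] ℂ} {a b : Plane} (hb0 : b ≠ 0)
    (hb : α b = 0) (h : a 0 * b 1 - a 1 * b 0 = 0) : α a = 0 := by
  by_contra hne
  refine hb0 (funext fun i => ?_)
  rw [covector_apply] at hb hne
  fin_cases i <;> refine mul_left_cancel₀ hne ?_ <;> simp only [Pi.zero_apply, mul_zero]
  · simp only [Fin.zero_eta]
    linear_combination (a 0) * hb - α ![0, 1] * h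
  · simp only [Fin.mk_one]
    linear_combination (a 1) * hb + α ![1, 0] * h

/-- A web is not algebraizable if four of its foliations are linear and another one is not: a
biholomorphism that maps four linear foliations to linear ones preserves all lines. -/
theorem not_isAlgebraizableAt {ι : Type} [Fintype ι] {ω : ι → Form} {q : Plane}
    (hω : IsRegularWebAt ω q) {s : Fin 4 → ι} (hs : Function.Injective s)
    (hlin : ∀ k, ∀ᶠ v in 𝓝 q, IsInflectionAt (ω (s k)) v) {i : ι} (hi : ¬ IsLinearAt (ω i) q) :
    ¬ IsAlgebraizableAt ω q := by
  rintro ⟨α, y, hα, φ, rfl, hφ, hbij, σ, hσ⟩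
  refine hi (isLinearAt_of_isInflectionAt (hω.analytic i) (hω.ne_zero i) ?_)
  have hφc := hφ.continuousAt
  have hinj : ∀ᶠ v in 𝓝 q, ∀ u, fderiv ℂ φ v u = 0 → u = 0 := by
    have hnhds := ContinuousLinearEquiv.nhds (ContinuousLinearEquiv.ofBijective (fderiv ℂ φ q)
      (LinearMap.ker_eq_bot.2 hbij.1) (LinearMap.range_eq_top.2 hbij.2))
    rw [ContinuousLinearEquiv.coe_ofBijective] at hnhds
    filter_upwards [hφ.fderiv.continuousAt.eventually hnhds] with v hv u hu
    obtain ⟨E, hE⟩ := hv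
    rw [← hE] at hu
    exact E.map_eq_zero_iff.1 hu
  have hgood : ∀ l, ∀ᶠ v in 𝓝 q, ω l v ≠ 0 ∧ AnalyticAt ℂ (ω l) v ∧ α (σ l) (φ v) ≠ 0 ∧
      AnalyticAt ℂ (α (σ l)) (φ v) ∧ IsInflectionAt (α (σ l)) (φ v) ∧
      ∀ᶠ z in 𝓝 v, wedge (ω l z) ((α (σ l) (φ z)).comp (fderiv ℂ φ z)) = 0 := by
    intro l
    have hreg := hα.1
    filter_upwards [(hω.analytic l).continuousAt.eventually_ne (hω.ne_zero l),
      (hω.analytic l).eventually_analyticAt,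
      hφc.eventually ((hreg.analytic (σ l)).continuousAt.eventually_ne (hreg.ne_zero (σ l))),
      hφc.eventually (hreg.analytic (σ l)).eventually_analyticAt,
      hφc.eventually (hα.isInflectionAt (σ l)), (hσ l).eventually_nhds] with v h₁ h₂ h₃ h₄ h₅ h₆
    exact ⟨h₁, h₂, h₃, h₄, h₅, h₆⟩
  have htrans : ∀ᶠ v in 𝓝 q, ∀ k l, k ≠ l → wedge (ω (s k) v) (ω (s l) v) ≠ 0 := by
    simp only [eventually_all]
    intro k l hkl
    exact (wedge_analyticAt (hω.analytic _) (hω.analytic _)).continuousAt.eventually_ne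
      (hω.transverse _ _ (hs.ne hkl))
  filter_upwards [hφ.eventually_analyticAt, hinj, hgood i, eventually_all.2 fun k => hgood (s k),
    eventually_all.2 hlin, htrans] with v h₁ h₂ h₃ h₄ h₅ h₆
  -- the pullback of a linear foliation is linear along `u` if and only if the second derivative
  -- of `φ` along `u` is tangent to the image of `u`
  have hne : ∀ l, α (σ l) (φ v) ≠ 0 → (α (σ l) (φ v)).comp (fderiv ℂ φ v) ≠ 0 := by
    intro l hl h
    have hsurj : Function.Surjective (fderiv ℂ φ v) :=
      LinearMap.surjective_of_injective (f := (fderiv ℂ φ v : Plane →ₗ[ℂ] Plane))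
        ((injective_iff_map_eq_zero _).2 h₂)
    refine hl (ContinuousLinearMap.ext fun w => ?_)
    obtain ⟨u, rfl⟩ := hsurj w
    exact DFunLike.congr_fun h u
  have hsecond : ∀ k, α (σ (s k)) (φ v)
      (fderiv ℂ (fderiv ℂ φ) v (kerVec (ω (s k) v)) (kerVec (ω (s k) v))) = 0 ∧
      α (σ (s k)) (φ v) (fderiv ℂ φ v (kerVec (ω (s k) v))) = 0 := by
    intro k
    obtain ⟨g₁, g₂, g₃, g₄, g₅, g₆⟩ := h₄ k
    have hw : wedge ((α (σ (s k)) (φ v)).comp (fderiv ℂ φ v)) (ω (s k) v) = 0 := by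
      rw [wedge_comm, g₆.self_of_nhds, neg_zero]
    have hker : α (σ (s k)) (φ v) (fderiv ℂ φ v (kerVec (ω (s k) v))) = 0 := by
      have := apply_kerVec (ω (s k) v) ((α (σ (s k)) (φ v)).comp (fderiv ℂ φ v))
      rwa [g₆.self_of_nhds] at this
    refine ⟨?_, hker⟩
    have hinf := (h₅ k).congr (analyticAt_pullback h₁ g₄).differentiableAt g₂.differentiableAt
      (hne _ g₃) g₁ (g₆.mono fun z hz => by rw [wedge_comm, hz, neg_zero]) _ hker
    rwa [fderiv_pullback h₁ g₄, g₅ _ hker, zero_add] at hinf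
  set A : Plane →L[ℂ] Plane := fderiv ℂ φ v with hA
  set B : Plane →L[ℂ] Plane →L[ℂ] Plane := fderiv ℂ (fderiv ℂ φ) v with hB
  have hcubic : ∀ u, B u u 0 * A u 1 - B u u 1 * A u 0 = 0 := by
    set e₀ : Plane := ![1, 0]
    set e₁ : Plane := ![0, 1]
    set c : Fin 4 → ℂ := ![B e₁ e₁ 0 * A e₁ 1 - B e₁ e₁ 1 * A e₁ 0,
      (B e₀ e₁ 0 + B e₁ e₀ 0) * A e₁ 1 - (B e₀ e₁ 1 + B e₁ e₀ 1) * A e₁ 0 +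
        (B e₁ e₁ 0 * A e₀ 1 - B e₁ e₁ 1 * A e₀ 0),
      (B e₀ e₁ 0 + B e₁ e₀ 0) * A e₀ 1 - (B e₀ e₁ 1 + B e₁ e₀ 1) * A e₀ 0 +
        (B e₀ e₀ 0 * A e₁ 1 - B e₀ e₀ 1 * A e₁ 0),
      B e₀ e₀ 0 * A e₀ 1 - B e₀ e₀ 1 * A e₀ 0] with hc
    have hexp : ∀ u, B u u 0 * A u 1 - B u u 1 * A u 0 =
        ∑ k : Fin 4, c k * (u 0 ^ (k : ℕ) * u 1 ^ (k.rev : ℕ)) := by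
      intro u
      have hu : u = u 0 • e₀ + u 1 • e₁ := by
        ext i; fin_cases i <;> simp [e₀, e₁]
      have hAu : A u = u 0 • A e₀ + u 1 • A e₁ := by
        calc A u = A (u 0 • e₀ + u 1 • e₁) := congrArg A hu
          _ = _ := by rw [map_add, map_smul, map_smul]
      have hBu : B u u = (u 0 * u 0) • B e₀ e₀ + (u 0 * u 1) • (B e₀ e₁ + B e₁ e₀) +
          (u 1 * u 1) • B e₁ e₁ := by
        calc B u u = B (u 0 • e₀ + u 1 • e₁) (u 0 • e₀ + u 1 • e₁) := by rw [← hu]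
          _ = _ := by
            simp only [map_add, map_smul, add_apply, smul_apply]
            module
      rw [hAu, hBu, Fin.sum_univ_four]
      simp only [hc, Pi.add_apply, Pi.smul_apply, smul_eq_mul, Matrix.cons_val,
        Fin.val_zero, Fin.val_one, Fin.val_two, Fin.rev]
      norm_num
      ring
    have hc0 : c = 0 := by
      refine binary_cubic_eq_zero (u := fun k => kerVec (ω (s k) v)) (fun k l hkl => ?_)
        fun k => ?_
      · have := h₆ k l hkl
        intro h
        refine this ?_
        simp [kerVec] at h
        rw [wedge]
        linear_combination h
      · rw [← hexp]
        obtain ⟨g₁, g₂⟩ := hsecond k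
        exact cross_eq_zero_of_apply_eq_zero (h₄ k).2.2.1 g₁ g₂
    intro u
    rw [hexp, hc0]
    simp
  obtain ⟨g₁, g₂, g₃, g₄, g₅, g₆⟩ := h₃
  refine IsInflectionAt.congr (θ := fun z => (α (σ i) (φ z)).comp (fderiv ℂ φ z)) ?_
    g₂.differentiableAt (analyticAt_pullback h₁ g₄).differentiableAt g₁ (hne _ g₃) g₆
  intro u hu
  replace hu : α (σ i) (φ v) (fderiv ℂ φ v u) = 0 := hu
  rw [fderiv_pullback h₁ g₄, g₅ _ hu, zero_add]
  by_cases hu0 : u = 0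
  · simp [hu0]
  · exact apply_eq_zero_of_cross_eq_zero (fun h => hu0 (h₂ u h)) hu (hcubic u)

/-! ### Triple products in homogeneous coordinates -/

theorem triple_eq (a b c : Fin 3 → ℂ) : a ⬝ᵥ crossProduct b c =
    a 0 * (b 1 * c 2 - b 2 * c 1) + a 1 * (b 2 * c 0 - b 0 * c 2) +
      a 2 * (b 0 * c 1 - b 1 * c 0) := by
  simp [cross_apply, dotProduct, Fin.sum_univ_three]

theorem dot_eq (a b : Fin 3 → ℂ) : a ⬝ᵥ b = a 0 * b 0 + a 1 * b 1 + a 2 * b 2 := by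
  simp [dotProduct, Fin.sum_univ_three]

theorem exists_eq_smul_of_cross_eq_zero {a b : Fin 3 → ℂ} (ha : a ≠ 0)
    (h : crossProduct a b = 0) : ∃ s : ℂ, b = s • a := by
  obtain ⟨i, hi⟩ : ∃ i, a i ≠ 0 := by
    by_contra! h'
    exact ha (funext h')
  have h₀ := congrFun h 0
  have h₁ := congrFun h 1
  have h₂ := congrFun h 2
  simp [cross_apply] at h₀ h₁ h₂
  refine ⟨b i / a i, funext fun j => ?_⟩
  simp only [Pi.smul_apply, smul_eq_mul]
  rw [div_mul_eq_mul_div, eq_div_iff hi]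
  fin_cases i <;> fin_cases j <;> simp <;>
    first
    | ring1
    | linear_combination h₀
    | linear_combination h₁
    | linear_combination h₂
    | linear_combination -h₀
    | linear_combination -h₁
    | linear_combination -h₂

/-- Two vectors orthogonal to two independent vectors are proportional. -/
theorem cross_eq_zero_of_dot_eq_zero {a b x y : Fin 3 → ℂ} (h : crossProduct x y ≠ 0)
    (hax : a ⬝ᵥ x = 0) (hay : a ⬝ᵥ y = 0) (hbx : b ⬝ᵥ x = 0) (hby : b ⬝ᵥ y = 0) :
    crossProduct a b = 0 := by
  have key : ∀ c : Fin 3 → ℂ, c ⬝ᵥ x = 0 → c ⬝ᵥ y = 0 → ∃ s : ℂ, c = s • crossProduct x y := by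
    intro c hx hy
    refine exists_eq_smul_of_cross_eq_zero h ?_
    rw [dot_eq] at hx hy
    ext i
    fin_cases i <;> simp [cross_apply]
    · linear_combination (y 0) * hx - (x 0) * hy
    · linear_combination (y 1) * hx - (x 1) * hy
    · linear_combination (y 2) * hx - (x 2) * hy
  obtain ⟨s, rfl⟩ := key a hax hay
  obtain ⟨t, rfl⟩ := key b hbx hby
  ext i
  fin_cases i <;> simp [cross_apply] <;> ring

theorem triple_eq_zero_of_dot_eq_zero {l a b c : Fin 3 → ℂ} (hl : l ≠ 0) (ha : l ⬝ᵥ a = 0)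
    (hb : l ⬝ᵥ b = 0) (hc : l ⬝ᵥ c = 0) : a ⬝ᵥ crossProduct b c = 0 := by
  by_contra h
  refine hl (funext fun i => mul_left_cancel₀ h ?_)
  rw [dot_eq] at ha hb hc
  rw [triple_eq]
  have e : ∀ j, crossProduct b c j * (l ⬝ᵥ a) + crossProduct c a j * (l ⬝ᵥ b) +
      crossProduct a b j * (l ⬝ᵥ c) = a ⬝ᵥ crossProduct b c * l j := by
    intro j
    rw [triple_eq, dot_eq, dot_eq, dot_eq]
    fin_cases j <;> simp [cross_apply] <;> ring
  have := e i
  rw [dot_eq l a, dot_eq l b, dot_eq l c, ha, hb, hc, triple_eq] at this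
  simp only [Pi.zero_apply, mul_zero]
  linear_combination -this

/-- The form `det (p, x, dx)` in the chart `c`. -/
def radial (p : Fin 3 → ℂ) (c : Fin 3) : Form :=
  fun v => fderiv ℂ (fun y : Plane => p ⬝ᵥ crossProduct (chart c v) (chart c y)) v

theorem radial_apply (p : Fin 3 → ℂ) (c : Fin 3) (v u : Plane) :
    radial p c v u = p ⬝ᵥ crossProduct (chart c v) (chartDir c u) := by
  have h : (fun y : Plane => p ⬝ᵥ crossProduct (chart c v) (chart c y)) =
      fun y : Plane => crossProduct p (chart c v) ⬝ᵥ chart c y := by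
    ext y
    rw [triple_eq]
    simp [cross_apply, dotProduct, Fin.sum_univ_three]
    ring
  rw [radial, h, fderiv_dotProduct_chart, triple_eq]
  simp [cross_apply, dotProduct, Fin.sum_univ_three]
  ring

theorem chart_zero (v : Plane) : chart 0 v = ![1, v 0, v 1] := by
  ext i; fin_cases i <;> rfl

theorem chart_one (v : Plane) : chart 1 v = ![v 0, 1, v 1] := by
  ext i; fin_cases i <;> rfl

theorem chartDir_zero (v : Plane) : chartDir 0 v = ![0, v 0, v 1] := by
  ext i; fin_cases i <;> rfl

theorem chartDir_one (v : Plane) : chartDir 1 v = ![v 0, 0, v 1] := by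
  ext i; fin_cases i <;> rfl

/-- The orientation of the chart `c`. -/
def chartSign (c : Fin 3) : ℂ := ![1, -1, 1] c

theorem chartSign_ne_zero (c : Fin 3) : chartSign c ≠ 0 := by
  fin_cases c <;> simp [chartSign]

theorem triple_chart (c : Fin 3) (v u w : Plane) :
    chart c v ⬝ᵥ crossProduct (chartDir c u) (chartDir c w) =
      chartSign c * (u 0 * w 1 - u 1 * w 0) := by
  rw [triple_eq]
  fin_cases c
  · change chart 0 v 0 * (chartDir 0 u 1 * chartDir 0 w 2 - chartDir 0 u 2 * chartDir 0 w 1) +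
      chart 0 v 1 * (chartDir 0 u 2 * chartDir 0 w 0 - chartDir 0 u 0 * chartDir 0 w 2) +
      chart 0 v 2 * (chartDir 0 u 0 * chartDir 0 w 1 - chartDir 0 u 1 * chartDir 0 w 0) = _
    simp [chart_zero, chartDir_zero, chartSign]
  · change chart 1 v 0 * (chartDir 1 u 1 * chartDir 1 w 2 - chartDir 1 u 2 * chartDir 1 w 1) +
      chart 1 v 1 * (chartDir 1 u 2 * chartDir 1 w 0 - chartDir 1 u 0 * chartDir 1 w 2) +
      chart 1 v 2 * (chartDir 1 u 0 * chartDir 1 w 1 - chartDir 1 u 1 * chartDir 1 w 0) = _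
    simp [chart_one, chartDir_one, chartSign]
  · change chart 2 v 0 * (chartDir 2 u 1 * chartDir 2 w 2 - chartDir 2 u 2 * chartDir 2 w 1) +
      chart 2 v 1 * (chartDir 2 u 2 * chartDir 2 w 0 - chartDir 2 u 0 * chartDir 2 w 2) +
      chart 2 v 2 * (chartDir 2 u 0 * chartDir 2 w 1 - chartDir 2 u 1 * chartDir 2 w 0) = _
    simp [chart_two, chartDir_two, chartSign]

theorem chart_ne_zero (c : Fin 3) (v : Plane) : chart c v ≠ 0 := fun h => by
  have := chart_self c v
  rw [h] at this
  exact zero_ne_one this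

/-- The position vector of a point of a chart and two independent directions of the chart form a
basis. -/
theorem eq_zero_of_dot_chart {a : Fin 3 → ℂ} {c : Fin 3} {v : Plane} (h : a ⬝ᵥ chart c v = 0)
    (h' : ∀ u, a ⬝ᵥ chartDir c u = 0) : a = 0 := by
  by_contra ha
  have := triple_eq_zero_of_dot_eq_zero ha h (h' ![1, 0]) (h' ![0, 1])
  rw [triple_chart] at this
  simp [chartSign_ne_zero] at this

theorem wedge_radial (p p' : Fin 3 → ℂ) (c : Fin 3) (v : Plane) :
    wedge (radial p c v) (radial p' c v) =
      chartSign c * (p ⬝ᵥ crossProduct p' (chart c v)) := by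
  have h := triple_chart c v ![1, 0] ![0, 1]
  simp at h
  rw [← h, wedge, radial_apply, radial_apply, radial_apply, radial_apply]
  simp only [triple_eq]
  ring

theorem radial_analyticAt (p : Fin 3 → ℂ) (c : Fin 3) (v : Plane) :
    AnalyticAt ℂ (radial p c) v := by
  refine analyticAt_form fun u => ?_
  have h : ∀ i, AnalyticAt ℂ (fun v => chart c v i) v := fun i =>
    ((ContinuousLinearMap.proj (R := ℂ) (φ := fun _ : Fin 3 => ℂ) i).analyticAt _).comp
      (analyticAt_chart c v)
  have h₀ := h 0
  have h₁ := h 1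
  have h₂ := h 2
  simp only [radial_apply, triple_eq]
  fun_prop

theorem radial_ne_zero {p : Fin 3 → ℂ} {c : Fin 3} {v : Plane}
    (h : crossProduct p (chart c v) ≠ 0) : radial p c v ≠ 0 := by
  intro h'
  refine h (eq_zero_of_dot_chart (c := c) (v := v) ?_ fun u => ?_)
  · rw [dot_eq]; simp [cross_apply]; ring
  · have := DFunLike.congr_fun h' u
    rw [radial_apply, triple_eq, zero_apply] at this
    rw [dot_eq, ← this]; simp [cross_apply]; ring

/-- Radial foliations are linear. -/
theorem isInflectionAt_radial (p : Fin 3 → ℂ) (c : Fin 3) (v : Plane) :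
    IsInflectionAt (radial p c) v := by
  intro u _
  have h := fderiv_form_apply_apply (radial_analyticAt p c v).differentiableAt u u
  refine h.unique ((hasDerivAt_const (0 : ℂ) (radial p c v u)).congr_of_eventuallyEq
    (.of_forall fun t => ?_))
  simp only [radial_apply, chart_add, map_smul, triple_eq, Pi.add_apply, Pi.smul_apply, smul_eq_mul]
  ring

/-! ### Nets -/

/-- An `(r, m)`-net with its points and lines given by homogeneous coordinates: `pt p` is the
point `p`, `ln i k` the line `k` of the class `i`, and `inc i p` the line of the class `i`
through `p`. -/
structure LineNet (r m : ℕ) (ι : Type) (κ : Fin r → Type) [Fintype ι] [∀ i, Fintype (κ i)] where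
  pt : ι → Fin 3 → ℂ
  ln : ∀ i, κ i → Fin 3 → ℂ
  inc : ∀ i, ι → κ i
  three_le : 3 ≤ r
  two_le : 2 ≤ m
  card_eq : ∀ i, Fintype.card (κ i) = m
  pt_ne_zero : ∀ p, pt p ≠ 0
  bijective : ∀ i j, i ≠ j → Function.Bijective fun p => (inc i p, inc j p)
  dot_eq_zero_iff : ∀ i k p, ln i k ⬝ᵥ pt p = 0 ↔ inc i p = k

/-- An `(r, m)`-net, with its pencil of curves of degree `m`: the union of the lines of the class
`i` is the member `b i * A - a i * B = 0` of the pencil generated by `A` and `B`. -/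
structure Net (r m : ℕ) (ι : Type) (κ : Fin r → Type) [Fintype ι] [∀ i, Fintype (κ i)]
    extends LineNet r m ι κ where
  A : (Fin 3 → ℂ) → ℂ
  B : (Fin 3 → ℂ) → ℂ
  a : Fin r → ℂ
  b : Fin r → ℂ
  value_ne : ∀ i j, i ≠ j → a i * b j ≠ a j * b i
  fibre : ∀ i x, b i * A x - a i * B x = ∏ k, ln i k ⬝ᵥ x

namespace LineNet

variable {r m : ℕ} {ι : Type} {κ : Fin r → Type} [Fintype ι] [∀ i, Fintype (κ i)]
  (N : LineNet r m ι κ)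

theorem exists_ne (N : LineNet r m ι κ) (i : Fin r) (k : κ i) : ∃ k', k' ≠ k := by
  have : Nontrivial (κ i) := Fintype.one_lt_card_iff_nontrivial.1 (by
    rw [N.card_eq]; exact N.two_le)
  exact _root_.exists_ne k

theorem exists_class_ne (N : LineNet r m ι κ) (i : Fin r) : ∃ j, j ≠ i := by
  have := N.three_le
  have : Nontrivial (Fin r) := Fin.nontrivial_iff_two_le.2 (by omega)
  exact _root_.exists_ne i

theorem exists_inc_eq {i j : Fin r} (h : i ≠ j) (k : κ i) (k' : κ j) :
    ∃ p, N.inc i p = k ∧ N.inc j p = k' := by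
  obtain ⟨p, hp⟩ := (N.bijective i j h).2 (k, k')
  exact ⟨p, congrArg Prod.fst hp, congrArg Prod.snd hp⟩

theorem ln_ne_zero (i : Fin r) (k : κ i) : N.ln i k ≠ 0 := by
  obtain ⟨k', hk'⟩ := N.exists_ne i k
  obtain ⟨j, hj⟩ := N.exists_class_ne i
  obtain ⟨k'', -⟩ : ∃ k'' : κ j, True := by
    have : Nonempty (κ j) := Fintype.card_pos_iff.1 (by
      rw [N.card_eq]; exact zero_lt_two.trans_le N.two_le)
    exact ⟨Classical.arbitrary _, trivial⟩
  obtain ⟨p, hp, -⟩ := N.exists_inc_eq hj.symm k' k''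
  intro h
  have : N.ln i k ⬝ᵥ N.pt p = 0 := by rw [h, zero_dotProduct]
  rw [N.dot_eq_zero_iff] at this
  exact hk' (hp.symm.trans this)

theorem ln_dot_pt (i : Fin r) (p : ι) : N.ln i (N.inc i p) ⬝ᵥ N.pt p = 0 :=
  (N.dot_eq_zero_iff i _ p).2 rfl

/-- Two lines one of which contains a point of the net that the other one does not contain are
distinct. -/
theorem cross_ne_zero_of_inc_ne {i j : Fin r} {k : κ i} {k' : κ j} {p : ι} (hk : N.inc i p = k)
    (hk' : N.inc j p ≠ k') : crossProduct (N.ln i k) (N.ln j k') ≠ 0 := by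
  intro h
  obtain ⟨s, hs⟩ := exists_eq_smul_of_cross_eq_zero (N.ln_ne_zero i k) h
  refine hk' ((N.dot_eq_zero_iff j k' p).1 ?_)
  rw [hs, smul_dotProduct, (N.dot_eq_zero_iff i k p).2 hk, smul_zero]

theorem cross_ln_ne_zero {i j : Fin r} (h : i ≠ j) (k : κ i) (k' : κ j) :
    crossProduct (N.ln i k) (N.ln j k') ≠ 0 := by
  obtain ⟨k'', hk''⟩ := N.exists_ne j k'
  obtain ⟨p, hp, hp'⟩ := N.exists_inc_eq h k k''
  exact N.cross_ne_zero_of_inc_ne hp (by rwa [hp'])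

theorem cross_ln_ne_zero' {i : Fin r} {k k' : κ i} (h : k ≠ k') :
    crossProduct (N.ln i k) (N.ln i k') ≠ 0 := by
  obtain ⟨j, hj⟩ := N.exists_class_ne i
  obtain ⟨k'', -⟩ : ∃ k'' : κ j, True := by
    have : Nonempty (κ j) := Fintype.card_pos_iff.1 (by
      rw [N.card_eq]; exact zero_lt_two.trans_le N.two_le)
    exact ⟨Classical.arbitrary _, trivial⟩
  obtain ⟨p, hp, -⟩ := N.exists_inc_eq hj.symm k k''
  exact N.cross_ne_zero_of_inc_ne hp (by rwa [hp])

/-- A point common to two lines of different classes belongs to the net. -/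
theorem exists_cross_pt_eq_zero {i j : Fin r} (h : i ≠ j) {k : κ i} {k' : κ j} {x : Fin 3 → ℂ}
    (hx : N.ln i k ⬝ᵥ x = 0) (hx' : N.ln j k' ⬝ᵥ x = 0) :
    ∃ p, crossProduct (N.pt p) x = 0 := by
  obtain ⟨p, hp, hp'⟩ := N.exists_inc_eq h k k'
  refine ⟨p, cross_eq_zero_of_dot_eq_zero (N.cross_ln_ne_zero h k k') ?_ ?_ ?_ ?_⟩ <;>
    rw [dotProduct_comm]
  · exact (N.dot_eq_zero_iff i k p).2 hp
  · exact (N.dot_eq_zero_iff j k' p).2 hp'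
  · exact hx
  · exact hx'

/-- The product of the linear equations of the lines of the class `i`. -/
def f (i : Fin r) (x : Fin 3 → ℂ) : ℂ := ∏ k, N.ln i k ⬝ᵥ x

theorem f_analyticAt (i : Fin r) (x : Fin 3 → ℂ) : AnalyticAt ℂ (N.f i) x := by
  refine Finset.analyticAt_fun_prod _ fun k _ => ?_
  change AnalyticAt ℂ (fun x => N.ln i k ⬝ᵥ x) x
  simp only [dot_eq]
  have h : ∀ j, AnalyticAt ℂ (fun x : Fin 3 → ℂ => x j) x := fun j =>
    (ContinuousLinearMap.proj (R := ℂ) (φ := fun _ : Fin 3 => ℂ) j).analyticAt x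
  exact ((analyticAt_const.mul (h 0)).add (analyticAt_const.mul (h 1))).add
    (analyticAt_const.mul (h 2))

theorem f_smul (i : Fin r) (s : ℂ) (x : Fin 3 → ℂ) : N.f i (s • x) = s ^ m * N.f i x := by
  simp only [f, dotProduct_smul, smul_eq_mul, Finset.prod_mul_distrib, Finset.prod_const,
    Finset.card_univ, N.card_eq]

end LineNet

namespace Net

variable {r m : ℕ} {ι : Type} {κ : Fin r → Type} [Fintype ι] [∀ i, Fintype (κ i)]
  (N : Net r m ι κ)

/-- The web of a net in the chart `c`: the pencils of lines through its points and its pencil of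
curves. -/
def web (c : Fin 3) : Option ι → Form
  | some p => radial (N.pt p) c
  | none => pencilForm (fun v => N.A (chart c v)) (fun v => N.B (chart c v))

theorem A_eq {i j : Fin r} (h : i ≠ j) (x : Fin 3 → ℂ) :
    N.A x = (N.a i * N.b j - N.a j * N.b i)⁻¹ * (N.a i * N.f j x - N.a j * N.f i x) := by
  have hne := sub_ne_zero.2 (N.value_ne i j h)
  have h₁ := N.fibre i x
  have h₂ := N.fibre j x
  rw [eq_inv_mul_iff_mul_eq₀ hne, LineNet.f, LineNet.f, ← h₁, ← h₂]
  ring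

theorem B_eq {i j : Fin r} (h : i ≠ j) (x : Fin 3 → ℂ) :
    N.B x = (N.a i * N.b j - N.a j * N.b i)⁻¹ * (N.b i * N.f j x - N.b j * N.f i x) := by
  have hne := sub_ne_zero.2 (N.value_ne i j h)
  have h₁ := N.fibre i x
  have h₂ := N.fibre j x
  rw [eq_inv_mul_iff_mul_eq₀ hne, LineNet.f, LineNet.f, ← h₁, ← h₂]
  ring

theorem A_analyticAt (x : Fin 3 → ℂ) : AnalyticAt ℂ N.A x := by
  have h3 := N.three_le
  obtain ⟨j, hj⟩ := N.exists_class_ne ⟨0, by omega⟩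
  rw [funext (N.A_eq hj.symm)]
  exact analyticAt_const.mul ((analyticAt_const.mul (N.f_analyticAt _ _)).sub
    (analyticAt_const.mul (N.f_analyticAt _ _)))

theorem B_analyticAt (x : Fin 3 → ℂ) : AnalyticAt ℂ N.B x := by
  have h3 := N.three_le
  obtain ⟨j, hj⟩ := N.exists_class_ne ⟨0, by omega⟩
  rw [funext (N.B_eq hj.symm)]
  exact analyticAt_const.mul ((analyticAt_const.mul (N.f_analyticAt _ _)).sub
    (analyticAt_const.mul (N.f_analyticAt _ _)))

theorem _root_.PlanarWeb.fderiv_comp_chart {g : (Fin 3 → ℂ) → ℂ} {c : Fin 3} {v : Plane}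
    (hg : AnalyticAt ℂ g (chart c v)) :
    fderiv ℂ (fun v => g (chart c v)) v = (fderiv ℂ g (chart c v)).comp (chartDir c) :=
  (hg.differentiableAt.hasFDerivAt.comp v (hasFDerivAt_chart c v)).fderiv

theorem web_analyticAt (c : Fin 3) (s : Option ι) (v : Plane) : AnalyticAt ℂ (N.web c s) v := by
  cases s with
  | some p => exact radial_analyticAt _ _ _
  | none =>
    have hA : AnalyticAt ℂ (fun v => N.A (chart c v)) v :=
      (N.A_analyticAt _).comp (analyticAt_chart c v)
    have hB : AnalyticAt ℂ (fun v => N.B (chart c v)) v :=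
      (N.B_analyticAt _).comp (analyticAt_chart c v)
    exact (hB.smul hA.fderiv).sub (hA.smul hB.fderiv)

/-- The pencil of curves is generated by any two of its special members. -/
theorem value_mul_web_none (c : Fin 3) (v : Plane) (i j : Fin r) (u : Plane) :
    (N.a i * N.b j - N.a j * N.b i) * N.web c none v u =
      N.f j (chart c v) * fderiv ℂ (N.f i) (chart c v) (chartDir c u) -
        N.f i (chart c v) * fderiv ℂ (N.f j) (chart c v) (chartDir c u) := by
  set x := chart c v with hx
  have hA := (N.A_analyticAt x).differentiableAt
  have hB := (N.B_analyticAt x).differentiableAt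
  have hf : ∀ i, N.f i = fun x => N.b i * N.A x - N.a i * N.B x := fun i =>
    funext fun x => (N.fibre i x).symm
  have hfd : ∀ i, fderiv ℂ (N.f i) x = N.b i • fderiv ℂ N.A x - N.a i • fderiv ℂ N.B x := by
    intro i
    rw [hf, fderiv_fun_sub (hA.const_mul _) (hB.const_mul _), fderiv_const_mul hA,
      fderiv_const_mul hB]
  rw [web, pencilForm, fderiv_comp_chart (N.A_analyticAt _), fderiv_comp_chart (N.B_analyticAt _),
    hfd, hfd, hf i, hf j]
  simp only [← hx, sub_apply, smul_apply, smul_eq_mul, ContinuousLinearMap.comp_apply]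
  ring

theorem hasDerivAt_f (i : Fin r) (k : κ i) [DecidableEq (κ i)] {x : Fin 3 → ℂ}
    (hx : N.ln i k ⬝ᵥ x = 0) (y : Fin 3 → ℂ) :
    fderiv ℂ (N.f i) x y = (∏ k' ∈ Finset.univ.erase k, N.ln i k' ⬝ᵥ x) * (N.ln i k ⬝ᵥ y) := by
  have h₁ := hasDerivAt_comp_line (g := N.f i) (v := x) (u := y) (s := 0)
    (N.f_analyticAt i _).differentiableAt
  rw [zero_smul, add_zero] at h₁
  have h₂ : ∀ k', HasDerivAt (fun t : ℂ => N.ln i k' ⬝ᵥ (x + t • y)) (N.ln i k' ⬝ᵥ y) 0 := by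
    intro k'
    simp only [dotProduct_add, dotProduct_smul, smul_eq_mul]
    simpa using ((hasDerivAt_id (0 : ℂ)).mul_const (N.ln i k' ⬝ᵥ y)).const_add (N.ln i k' ⬝ᵥ x)
  have h₃ := HasDerivAt.fun_finsetProd (u := Finset.univ) fun k' _ => h₂ k'
  have h₄ := h₁.unique h₃
  rw [h₄, Finset.sum_eq_single k]
  · simp
  · intro k' _ hk'
    rw [Finset.prod_eq_zero (Finset.mem_erase.2 ⟨hk'.symm, Finset.mem_univ k⟩) (by simpa using hx),
      zero_smul]
  · simp

end Net

/-! ### Regular points of the web of a net -/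

theorem eventually_affine_ne_zero {a b : ℂ} (h : a ≠ 0 ∨ b ≠ 0) :
    ∀ᶠ t in 𝓝[≠] (0 : ℂ), a + t * b ≠ 0 := by
  by_cases ha : a = 0
  · subst ha
    filter_upwards [self_mem_nhdsWithin] with t ht
    simpa using ⟨ht, h.resolve_left (by simp)⟩
  · have : ContinuousAt (fun t : ℂ => a + t * b) 0 := by fun_prop
    exact (this.eventually_ne (by simpa using ha)).filter_mono nhdsWithin_le_nhds

/-- If the form `Ω` vanishes on the vector `u` at all points `q + t u`, so does at `q` any form
that defines the same foliation. -/
theorem apply_eq_zero_of_eventually {Ω ω : Form} {q u : Plane} (hω : ContinuousAt ω q)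
    (hw : ∀ᶠ v in 𝓝 q, wedge (ω v) (Ω v) = 0)
    (h : ∀ᶠ t in 𝓝[≠] (0 : ℂ), Ω (q + t • u) ≠ 0 ∧ Ω (q + t • u) u = 0) : ω q u = 0 := by
  have hc : ContinuousAt (fun t : ℂ => q + t • u) 0 := by fun_prop
  have hlim : Tendsto (fun t : ℂ => q + t • u) (𝓝 0) (𝓝 q) := by simpa using hc.tendsto
  have h₁ : ∀ᶠ t in 𝓝[≠] (0 : ℂ), ω (q + t • u) u = 0 := by
    filter_upwards [h, (hlim.eventually hw).filter_mono nhdsWithin_le_nhds] with t ht ht'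
    exact apply_eq_zero_of_wedge_eq_zero ht.1 (by rw [wedge_comm, ht', neg_zero]) ht.2
  have h₂ : ContinuousAt (fun t : ℂ => ω (q + t • u) u) 0 :=
    (ContinuousAt.comp (g := ω) (by simpa using hω) hc).clm_apply continuousAt_const
  have h₃ := tendsto_nhds_unique_of_eventuallyEq (h₂.tendsto.mono_left nhdsWithin_le_nhds)
    (tendsto_const_nhds (x := (0 : ℂ)) (f := 𝓝[≠] (0 : ℂ))) h₁
  simpa using h₃

/-- The lines `l` and `l'` are distinct if `x` and `x + y` span `l` and are not both on `l'`. -/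
theorem dot_ne_zero_or {l l' x y : Fin 3 → ℂ} (h : crossProduct l l' ≠ 0)
    (hxy : crossProduct x y ≠ 0) (hx : l ⬝ᵥ x = 0) (hy : l ⬝ᵥ y = 0) :
    l' ⬝ᵥ x ≠ 0 ∨ l' ⬝ᵥ y ≠ 0 := by
  by_contra! h'
  exact h (cross_eq_zero_of_dot_eq_zero hxy hx hy h'.1 h'.2)

theorem cross_chart_ne_zero {c : Fin 3} {v u : Plane} (hu : u ≠ 0) :
    crossProduct (chart c v) (chartDir c u) ≠ 0 := by
  intro h
  refine hu (funext fun i => ?_)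
  have key : ∀ w : Plane, u 0 * w 1 - u 1 * w 0 = 0 := fun w => by
    have h₁ := triple_chart c v u w
    have h₂ : chart c v ⬝ᵥ crossProduct (chartDir c u) (chartDir c w) =
        crossProduct (chart c v) (chartDir c u) ⬝ᵥ chartDir c w := by
      rw [triple_eq, dot_eq]; simp [cross_apply]; ring
    rw [h₂, h, zero_dotProduct] at h₁
    exact (mul_eq_zero.1 h₁.symm).resolve_left (chartSign_ne_zero c)
  fin_cases i
  · simpa using key ![0, 1]
  · simpa using key ![1, 0]

/-- A line that passes through a point of the chart `c` is not at infinity. -/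
theorem exists_direction {l : Fin 3 → ℂ} (hl : l ≠ 0) {c : Fin 3} {v : Plane}
    (h : l ⬝ᵥ chart c v = 0) :
    ∃ u w : Plane, u ≠ 0 ∧ l ⬝ᵥ chartDir c u = 0 ∧ l ⬝ᵥ chartDir c w ≠ 0 := by
  set α : Plane →L[ℂ] ℂ := fderiv ℂ (fun y : Plane => l ⬝ᵥ chart c y) v with hα
  have hα' : ∀ u, α u = l ⬝ᵥ chartDir c u := fderiv_dotProduct_chart l c v
  have h0 : α ≠ 0 := by
    intro h0
    refine hl (eq_zero_of_dot_chart h fun u => ?_)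
    rw [← hα', h0, zero_apply]
  obtain ⟨w, hw⟩ := exists_apply_eq_one h0
  refine ⟨kerVec α, w, kerVec_ne_zero h0, ?_, ?_⟩
  · rw [← hα', apply_kerVec, wedge_self]
  · rw [← hα', hw]; exact one_ne_zero

namespace Net

variable {r m : ℕ} {ι : Type} {κ : Fin r → Type} [Fintype ι] [∀ i, Fintype (κ i)]
  (N : Net r m ι κ)

/-- Along a line of the net, and away from finitely many points, the pencil of curves is regular
and tangent to the line. -/
theorem web_none_on_line {c : Fin 3} {v u w : Plane} {i : Fin r} {k : κ i} (hu : u ≠ 0)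
    (hv : N.ln i k ⬝ᵥ chart c v = 0) (hlu : N.ln i k ⬝ᵥ chartDir c u = 0)
    (hlw : N.ln i k ⬝ᵥ chartDir c w ≠ 0) :
    ∀ᶠ t in 𝓝[≠] (0 : ℂ), N.web c none (v + t • u) ≠ 0 ∧ N.web c none (v + t • u) u = 0 := by
  classical
  obtain ⟨j, hj⟩ := N.exists_class_ne i
  have hxy := cross_chart_ne_zero (c := c) (v := v) hu
  have h₁ : ∀ᶠ t in 𝓝[≠] (0 : ℂ), ∀ k' : κ j,
      N.ln j k' ⬝ᵥ chart c v + t * (N.ln j k' ⬝ᵥ chartDir c u) ≠ 0 :=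
    eventually_all.2 fun k' => eventually_affine_ne_zero
      (dot_ne_zero_or (N.cross_ln_ne_zero hj.symm k k') hxy hv hlu)
  have h₂ : ∀ᶠ t in 𝓝[≠] (0 : ℂ), ∀ k' : κ i, k' ≠ k →
      N.ln i k' ⬝ᵥ chart c v + t * (N.ln i k' ⬝ᵥ chartDir c u) ≠ 0 := by
    refine eventually_all.2 fun k' => ?_
    by_cases hk : k' = k
    · exact .of_forall fun t h => (h hk).elim
    · exact (eventually_affine_ne_zero
        (dot_ne_zero_or (N.cross_ln_ne_zero' (Ne.symm hk)) hxy hv hlu)).mono fun t ht _ => ht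
  filter_upwards [h₁, h₂] with t h₁ h₂
  have hx : chart c (v + t • u) = chart c v + t • chartDir c u := by rw [chart_add, map_smul]
  have hdot : ∀ l : Fin 3 → ℂ, l ⬝ᵥ chart c (v + t • u) =
      l ⬝ᵥ chart c v + t * (l ⬝ᵥ chartDir c u) := fun l => by
    rw [hx, dotProduct_add, dotProduct_smul, smul_eq_mul]
  have hline : N.ln i k ⬝ᵥ chart c (v + t • u) = 0 := by rw [hdot, hv, hlu]; ring
  have hfi : N.f i (chart c (v + t • u)) = 0 :=
    Finset.prod_eq_zero (Finset.mem_univ k) hline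
  have hval : ∀ y, (N.a i * N.b j - N.a j * N.b i) * N.web c none (v + t • u) y =
      N.f j (chart c (v + t • u)) * ((∏ k' ∈ Finset.univ.erase k,
        N.ln i k' ⬝ᵥ chart c (v + t • u)) * (N.ln i k ⬝ᵥ chartDir c y)) := fun y => by
    rw [N.value_mul_web_none, hfi, N.hasDerivAt_f i k hline]
    ring
  refine ⟨fun h => ?_, ?_⟩
  · have := hval w
    rw [h, zero_apply, mul_zero] at this
    refine (mul_ne_zero ?_ (mul_ne_zero ?_ hlw)) this.symm
    · refine Finset.prod_ne_zero_iff.2 fun k' _ => ?_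
      rw [hdot]
      exact h₁ k'
    · refine Finset.prod_ne_zero_iff.2 fun k' hk' => ?_
      rw [hdot]
      exact h₂ k' (Finset.ne_of_mem_erase hk')
  · have := hval u
    rw [hlu, mul_zero, mul_zero] at this
    exact (mul_eq_zero.1 this).resolve_left (sub_ne_zero.2 (N.value_ne i j hj.symm))

variable {N} {c : Fin 3} {q : Plane} {ω : Option ι → Form}

/-- The points of the net belong to the discriminant. -/
theorem cross_pt_chart_ne_zero (h : DefinesNear (N.web c) ω q) (p : ι) :
    crossProduct (N.pt p) (chart c q) ≠ 0 := by
  intro h0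
  obtain ⟨s, hs⟩ := exists_eq_smul_of_cross_eq_zero (N.pt_ne_zero p) h0
  have hs0 : s ≠ 0 := by
    rintro rfl
    exact chart_ne_zero c q (by rw [hs, zero_smul])
  refine h.regular.ne_zero (some p) (ContinuousLinearMap.ext fun u => ?_)
  by_cases hu : u = 0
  · rw [hu, map_zero, map_zero]
  refine apply_eq_zero_of_eventually (h.regular.analytic (some p)).continuousAt
    (h.wedge_eq_zero (some p)) ?_
  filter_upwards [self_mem_nhdsWithin] with t ht
  have hpt : N.pt p = s⁻¹ • chart c q := by rw [hs, smul_smul, inv_mul_cancel₀ hs0, one_smul]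
  have key : ∀ w, N.web c (some p) (q + t • u) w =
      s⁻¹ * t * (chartSign c * (u 0 * w 1 - u 1 * w 0)) := by
    intro w
    change radial (N.pt p) c (q + t • u) w = _
    rw [radial_apply, chart_add, map_smul, ← triple_chart c q, hpt]
    simp only [triple_eq, Pi.add_apply, Pi.smul_apply, smul_eq_mul]
    ring
  refine ⟨fun h' => hu (funext fun i => ?_), ?_⟩
  · have h₁ : ∀ w : Plane, u 0 * w 1 - u 1 * w 0 = 0 := fun w => by
      have := key w
      rw [h', zero_apply] at this
      have hne : s⁻¹ * t ≠ 0 := mul_ne_zero (inv_ne_zero hs0) ht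
      exact (mul_eq_zero.1 ((mul_eq_zero.1 this.symm).resolve_left hne)).resolve_left
        (chartSign_ne_zero c)
    fin_cases i
    · simpa using h₁ ![0, 1]
    · simpa using h₁ ![1, 0]
  · rw [key]; ring

theorem web_some_ne_zero (h : DefinesNear (N.web c) ω q) (p : ι) : N.web c (some p) q ≠ 0 :=
  radial_ne_zero (cross_pt_chart_ne_zero h p)

/-- The lines that join two points of the net belong to the discriminant. -/
theorem triple_pt_chart_ne_zero (h : DefinesNear (N.web c) ω q) {p p' : ι} (hp : p ≠ p') :
    N.pt p ⬝ᵥ crossProduct (N.pt p') (chart c q) ≠ 0 := by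
  intro h0
  refine h.regular.transverse (some p) (some p') (by simpa using hp) ?_
  have h₁ : wedge (N.web c (some p) q) (N.web c (some p') q) = 0 := by
    change wedge (radial _ _ _) (radial _ _ _) = 0
    rw [wedge_radial, h0, mul_zero]
  have h₂ := (h.wedge_eq_zero (some p)).self_of_nhds
  have h₃ := (h.wedge_eq_zero (some p')).self_of_nhds
  have h₄ := wedge_eq_zero_of_wedge_eq_zero (web_some_ne_zero h p) h₂
    (by rw [wedge_comm, h₁, neg_zero] : wedge (N.web c (some p') q) (N.web c (some p) q) = 0)
  exact wedge_eq_zero_of_wedge_eq_zero (web_some_ne_zero h p') h₄ h₃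

theorem apply_some_eq_zero (h : DefinesNear (N.web c) ω q) {p : ι} {u : Plane}
    (hu : N.pt p ⬝ᵥ crossProduct (chart c q) (chartDir c u) = 0) : ω (some p) q u = 0 := by
  refine apply_eq_zero_of_wedge_eq_zero (web_some_ne_zero h p)
    (by rw [wedge_comm, (h.wedge_eq_zero (some p)).self_of_nhds, neg_zero]) ?_
  change radial _ _ _ _ = 0
  rw [radial_apply, hu]

/-- The lines of the net belong to the discriminant. -/
theorem ln_dot_chart_ne_zero (h : DefinesNear (N.web c) ω q) (i : Fin r) (k : κ i) :
    N.ln i k ⬝ᵥ chart c q ≠ 0 := by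
  intro h0
  obtain ⟨u, w, hu, hlu, hlw⟩ := exists_direction (N.ln_ne_zero i k) h0
  obtain ⟨j, hj⟩ := N.exists_class_ne i
  obtain ⟨k'', -⟩ : ∃ k'' : κ j, True := by
    have : Nonempty (κ j) := Fintype.card_pos_iff.1 (by
      rw [N.card_eq]; exact zero_lt_two.trans_le N.two_le)
    exact ⟨Classical.arbitrary _, trivial⟩
  obtain ⟨p, hp, -⟩ := N.exists_inc_eq hj.symm k k''
  refine h.regular.transverse none (some p) (by simp) (wedge_eq_zero_of_apply_eq_zero hu ?_ ?_)
  · exact apply_eq_zero_of_eventually (h.regular.analytic none).continuousAt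
      (h.wedge_eq_zero none) (N.web_none_on_line hu h0 hlu hlw)
  · exact apply_some_eq_zero h (triple_eq_zero_of_dot_eq_zero (N.ln_ne_zero i k)
      ((N.dot_eq_zero_iff i k p).2 hp) h0 hlu)

theorem f_chart_ne_zero (h : DefinesNear (N.web c) ω q) (i : Fin r) : N.f i (chart c q) ≠ 0 :=
  Finset.prod_ne_zero_iff.2 fun k _ => ln_dot_chart_ne_zero h i k

/-- If the pencil of curves is tangent to the line through `q` of direction `u`, at all its
points near `q`, then each of its curves meets this line at the zeros of any other one. -/
theorem f_mul_f_eq {u : Plane} (hf : ∀ i, N.f i (chart c q) ≠ 0) (i j : Fin r)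
    (hu : ∀ᶠ t in 𝓝 (0 : ℂ), N.web c none (q + t • u) u = 0) (s t : ℂ) :
    N.f i (s • chart c q + t • chartDir c u) * N.f j (chart c q) =
      N.f j (s • chart c q + t • chartDir c u) * N.f i (chart c q) := by
  set x := chart c q with hx
  set y := chartDir c u with hy
  have han : ∀ i, AnalyticOnNhd ℂ (fun t : ℂ => N.f i (x + t • y)) Set.univ := fun i t _ =>
    AnalyticAt.fun_comp (N.f_analyticAt i _) (by fun_prop : AnalyticAt ℂ (fun t : ℂ => x + t • y) t)
  have hder : ∀ i (t : ℂ), HasDerivAt (fun t : ℂ => N.f i (x + t • y))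
      (fderiv ℂ (N.f i) (x + t • y) y) t := fun i t =>
    hasDerivAt_comp_line (N.f_analyticAt i _).differentiableAt
  -- the difference of the two sides solves a linear differential equation
  have hψ : ∀ᶠ t in 𝓝 (0 : ℂ),
      N.f i (x + t • y) * N.f j x - N.f j (x + t • y) * N.f i x = 0 := by
    have hne : N.f j (x + (0 : ℂ) • y) ≠ 0 := by simpa using hf j
    refine eventually_eq_zero_of_deriv_eq_mul
      (ψ := fun t : ℂ => N.f i (x + t • y) * N.f j x - N.f j (x + t • y) * N.f i x)
      (h := fun t => deriv (fun t : ℂ => N.f j (x + t • y)) t / N.f j (x + t • y))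
      (((han i 0 trivial).mul analyticAt_const).sub ((han j 0 trivial).mul analyticAt_const))
      ((han j 0 trivial).deriv.continuousAt.div (han j 0 trivial).continuousAt hne) ?_ ?_
    · simp only [zero_smul, add_zero]; ring
    · filter_upwards [hu, (han j 0 trivial).continuousAt.eventually_ne hne] with t ht ht'
      have h₁ := N.value_mul_web_none c (q + t • u) i j u
      rw [ht, mul_zero, chart_add, map_smul] at h₁
      rw [(((hder i t).mul_const _).fun_sub ((hder j t).mul_const _)).deriv, (hder j t).deriv]
      field_simp
      linear_combination -(N.f j x) * h₁
  have hall : ∀ t : ℂ, N.f i (x + t • y) * N.f j x = N.f j (x + t • y) * N.f i x := fun t =>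
    sub_eq_zero.1 (AnalyticOnNhd.eqOn_zero_of_preconnected_of_eventuallyEq_zero
      (fun t ht => ((han i t ht).mul analyticAt_const).sub ((han j t ht).mul analyticAt_const))
      isPreconnected_univ (Set.mem_univ 0) hψ (Set.mem_univ t))
  have hs : ∀ s : ℂ, s ≠ 0 →
      N.f i (s • x + t • y) * N.f j x = N.f j (s • x + t • y) * N.f i x := by
    intro s hs
    have h₁ : s • x + t • y = s • (x + (t / s) • y) := by
      rw [smul_add, smul_smul, mul_div_cancel₀ _ hs]
    rw [h₁, N.f_smul, N.f_smul, mul_assoc, hall]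
    ring
  by_cases hs0 : s = 0
  · have hc : ∀ i, ContinuousAt (fun s : ℂ => N.f i (s • x + t • y)) 0 := fun i =>
      ContinuousAt.comp (g := N.f i) (N.f_analyticAt i _).continuousAt (by fun_prop)
    have h₁ := tendsto_nhds_unique_of_eventuallyEq
      (((hc i).mul continuousAt_const).tendsto.mono_left nhdsWithin_le_nhds)
      (((hc j).mul continuousAt_const).tendsto.mono_left nhdsWithin_le_nhds)
      (eventually_of_mem (self_mem_nhdsWithin (a := (0 : ℂ)) (s := {0}ᶜ)) fun s h => hs s h)
    rw [hs0]
    exact h₁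
  · exact hs s hs0

/-- The pencil of curves is not linear: a line tangent to it meets a line of the net at one of
its points, so is a leaf of the pencil of lines through this point. -/
theorem not_isLinearAt (h : DefinesNear (N.web c) ω q) : ¬ IsLinearAt (ω none) q := by
  intro hlin
  set u := kerVec (ω none q) with hu
  have hu0 : u ≠ 0 := kerVec_ne_zero (h.regular.ne_zero none)
  have huq : ω none q u = 0 := by rw [hu, apply_kerVec, wedge_self]
  have hlim : Tendsto (fun t : ℂ => q + t • u) (𝓝 0) (𝓝 q) := by
    simpa using (by fun_prop : Continuous fun t : ℂ => q + t • u).tendsto 0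
  have htan : ∀ᶠ t in 𝓝 (0 : ℂ), N.web c none (q + t • u) u = 0 := by
    filter_upwards [hlin.self_of_nhds u huq, hlim.eventually (h.wedge_eq_zero none),
      hlim.eventually ((h.regular.analytic none).continuousAt.eventually_ne
        (h.regular.ne_zero none))] with t h₁ h₂ h₃
    exact apply_eq_zero_of_wedge_eq_zero h₃ h₂ h₁
  have h3 := N.three_le
  set i : Fin r := ⟨0, by omega⟩
  obtain ⟨j, hj⟩ := N.exists_class_ne i
  obtain ⟨k, -⟩ : ∃ k : κ i, True := by
    have : Nonempty (κ i) := Fintype.card_pos_iff.1 (by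
      rw [N.card_eq]; exact zero_lt_two.trans_le N.two_le)
    exact ⟨Classical.arbitrary _, trivial⟩
  set x := chart c q with hx
  -- the intersection with a line of the class `i`
  set y : Fin 3 → ℂ := (N.ln i k ⬝ᵥ chartDir c u) • x + (-(N.ln i k ⬝ᵥ x)) • chartDir c u with hy
  have hly : N.ln i k ⬝ᵥ y = 0 := by
    rw [hy, dotProduct_add, dotProduct_smul, dotProduct_smul, smul_eq_mul, smul_eq_mul]
    ring
  have hfi : N.f i y = 0 := Finset.prod_eq_zero (Finset.mem_univ k) hly
  have hfj : N.f j y = 0 := by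
    have := f_mul_f_eq (f_chart_ne_zero h) i j htan (N.ln i k ⬝ᵥ chartDir c u) (-(N.ln i k ⬝ᵥ x))
    rw [← hx, ← hy, hfi, zero_mul] at this
    exact (mul_eq_zero.1 this.symm).resolve_right (f_chart_ne_zero h i)
  obtain ⟨k', -, hk'⟩ := Finset.prod_eq_zero_iff.1 hfj
  obtain ⟨p, hp⟩ := N.exists_cross_pt_eq_zero hj.symm hly hk'
  obtain ⟨s, hs⟩ := exists_eq_smul_of_cross_eq_zero (N.pt_ne_zero p) hp
  have hs0 : s ≠ 0 := by
    rintro rfl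
    have h₁ : crossProduct x y = (-(N.ln i k ⬝ᵥ x)) • crossProduct x (chartDir c u) := by
      rw [hy]
      simp
    rw [hs, zero_smul, map_zero] at h₁
    exact smul_ne_zero (neg_ne_zero.2 (ln_dot_chart_ne_zero h i k)) (cross_chart_ne_zero hu0)
      h₁.symm
  refine h.regular.transverse none (some p) (by simp)
    (wedge_eq_zero_of_apply_eq_zero hu0 huq (apply_some_eq_zero h ?_))
  have h₂ : s * (N.pt p ⬝ᵥ crossProduct x (chartDir c u)) = 0 := by
    rw [← smul_eq_mul, ← smul_dotProduct, ← hs, hy, triple_eq]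
    simp only [Pi.add_apply, Pi.smul_apply, smul_eq_mul]
    ring
  exact (mul_eq_zero.1 h₂).resolve_left hs0

theorem isInflectionAt_some (h : DefinesNear (N.web c) ω q) (p : ι) :
    ∀ᶠ v in 𝓝 q, IsInflectionAt (ω (some p)) v := by
  filter_upwards [(h.wedge_eq_zero (some p)).eventually_nhds,
    (h.regular.analytic (some p)).eventually_analyticAt,
    (h.regular.analytic (some p)).continuousAt.eventually_ne (h.regular.ne_zero (some p)),
    (N.web_analyticAt c (some p) q).continuousAt.eventually_ne (web_some_ne_zero h p)]
    with v h₁ h₂ h₃ h₄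
  exact (isInflectionAt_radial (N.pt p) c v).congr h₂.differentiableAt
    (N.web_analyticAt c (some p) v).differentiableAt h₃ h₄ h₁

theorem card_points (N : Net r m ι κ) : Fintype.card ι = m ^ 2 := by
  have h3 := N.three_le
  obtain ⟨j, hj⟩ := N.exists_class_ne ⟨0, by omega⟩
  rw [Fintype.card_of_bijective (N.bijective _ j hj.symm), Fintype.card_prod, N.card_eq, N.card_eq,
    sq]

/-! ### Existence of regular points -/

theorem _root_.PlanarWeb.exists_forall_ne_zero {τ : Type*} [Finite τ] {g : τ → Plane → ℂ}
    (hg : ∀ i v, AnalyticAt ℂ (g i) v) (h : ∀ i, ∃ v, g i v ≠ 0) : ∃ v, ∀ i, g i v ≠ 0 := by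
  have hd : Dense (⋂ i, {v | g i v ≠ 0}) := by
    refine dense_iInter_of_isOpen (fun i => ?_) fun i => ?_
    · exact isOpen_ne_fun (continuous_iff_continuousAt.2 fun v => (hg i v).continuousAt)
        continuous_const
    · obtain ⟨w, hw⟩ := h i
      intro v₀
      by_contra hv
      refine hw (AnalyticOnNhd.eqOn_zero_of_preconnected_of_eventuallyEq_zero
        (fun v _ => hg i v) isPreconnected_univ (Set.mem_univ v₀) ?_ (Set.mem_univ w))
      filter_upwards [isClosed_closure.isOpen_compl.mem_nhds hv] with v hv
      by_contra hne
      exact hv (subset_closure hne)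
  obtain ⟨v, hv⟩ := hd.nonempty
  exact ⟨v, fun i => Set.mem_iInter.1 hv i⟩

theorem exists_wedge_none_some_ne_zero (N : Net r m ι κ) (p : ι) :
    ∃ v, wedge (N.web 2 none v) (N.web 2 (some p) v) ≠ 0 := by
  -- a line of the net that does not contain `p`, and is not the line at infinity
  obtain ⟨i, k, hk, w, hw⟩ : ∃ i k, N.inc i p ≠ k ∧ ∃ w, N.ln i k ⬝ᵥ chartDir 2 w ≠ 0 := by
    have h3 := N.three_le
    set i : Fin r := ⟨0, by omega⟩
    obtain ⟨j, hj⟩ := N.exists_class_ne i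
    obtain ⟨k, hk⟩ := N.exists_ne i (N.inc i p)
    obtain ⟨k', hk'⟩ := N.exists_ne j (N.inc j p)
    by_contra! hall
    refine N.cross_ln_ne_zero hj.symm k k' (cross_eq_zero_of_dot_eq_zero
      (x := chartDir 2 ![1, 0]) (y := chartDir 2 ![0, 1]) ?_ (hall i k hk.symm _)
      (hall i k hk.symm _) (hall j k' hk'.symm _) (hall j k' hk'.symm _))
    intro h
    have := triple_chart 2 0 ![1, 0] ![0, 1]
    rw [h, dotProduct_zero] at this
    simp [chartSign] at this
  have hl0 : N.ln i k 0 ≠ 0 ∨ N.ln i k 1 ≠ 0 := by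
    by_contra! h
    refine hw ?_
    rw [chartDir_two, dot_eq, h.1, h.2]
    simp
  obtain ⟨v, hv⟩ : ∃ v, N.ln i k ⬝ᵥ chart 2 v = 0 := by
    rcases hl0 with h | h
    · refine ⟨![-N.ln i k 2 / N.ln i k 0, 0], ?_⟩
      rw [chart_two, dot_eq]
      simp
      field_simp
      ring
    · refine ⟨![0, -N.ln i k 2 / N.ln i k 1], ?_⟩
      rw [chart_two, dot_eq]
      simp
      field_simp
      ring
  obtain ⟨u, -, hu, hlu, -⟩ := exists_direction (N.ln_ne_zero i k) hv
  obtain ⟨t, h₁, h₂⟩ := (N.web_none_on_line hu hv hlu hw).exists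
  refine ⟨v + t • u, fun h => hk ?_⟩
  have h₃ := apply_eq_zero_of_wedge_eq_zero h₁ h h₂
  replace h₃ : radial (N.pt p) 2 (v + t • u) u = 0 := h₃
  rw [radial_apply, chart_add, map_smul] at h₃
  refine (N.dot_eq_zero_iff i k p).1 ?_
  -- the line `ln i k` is spanned by the point `v` and the direction `u`
  obtain ⟨s, hs⟩ : ∃ s : ℂ, N.ln i k = s • crossProduct (chart 2 v) (chartDir 2 u) := by
    refine exists_eq_smul_of_cross_eq_zero (cross_chart_ne_zero hu) ?_
    rw [dot_eq] at hv hlu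
    ext i
    fin_cases i <;> simp [cross_apply]
    · linear_combination (chartDir 2 u 0) * hv - (chart 2 v 0) * hlu
    · linear_combination (chartDir 2 u 1) * hv - (chart 2 v 1) * hlu
    · linear_combination (chartDir 2 u 2) * hv - (chart 2 v 2) * hlu
  rw [hs, smul_dotProduct, dotProduct_comm]
  have : N.pt p ⬝ᵥ crossProduct (chart 2 v) (chartDir 2 u) = 0 := by
    rw [← h₃, triple_eq, triple_eq]
    simp only [Pi.add_apply, Pi.smul_apply, smul_eq_mul]
    ring
  rw [this, smul_zero]

theorem pt_cross_ne_zero (N : Net r m ι κ) {p p' : ι} (h : p ≠ p') :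
    crossProduct (N.pt p) (N.pt p') ≠ 0 := by
  intro h0
  obtain ⟨s, hs⟩ := exists_eq_smul_of_cross_eq_zero (N.pt_ne_zero p) h0
  have h3 := N.three_le
  obtain ⟨j, hj⟩ := N.exists_class_ne ⟨0, by omega⟩
  have key : ∀ i, N.inc i p' = N.inc i p := fun i => by
    refine (N.dot_eq_zero_iff i (N.inc i p) p').1 ?_
    rw [hs, dotProduct_smul, N.ln_dot_pt, smul_zero]
  exact h ((N.bijective _ j hj.symm).1 (by simp only [key]))

theorem exists_wedge_some_some_ne_zero (N : Net r m ι κ) {p p' : ι} (h : p ≠ p') :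
    ∃ v, wedge (N.web 2 (some p) v) (N.web 2 (some p') v) ≠ 0 := by
  by_contra! hall
  have key : ∀ v, crossProduct (N.pt p) (N.pt p') ⬝ᵥ chart 2 v = 0 := fun v => by
    have h₁ := hall v
    change wedge (radial _ _ _) (radial _ _ _) = 0 at h₁
    rw [wedge_radial] at h₁
    rw [← (mul_eq_zero.1 h₁).resolve_left (chartSign_ne_zero 2), triple_eq, dot_eq]
    simp [cross_apply]
    ring
  refine N.pt_cross_ne_zero h (eq_zero_of_dot_chart (key 0) fun u => ?_)
  have := key (0 + u)
  rwa [chart_add, dotProduct_add, key 0, zero_add] at this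

/-- The discriminant of the web of a net is not the whole plane. -/
theorem exists_definesNear (N : Net r m ι κ) : ∃ q, DefinesNear (N.web 2) (N.web 2) q := by
  obtain ⟨q, hq⟩ := exists_forall_ne_zero
    (τ := {s : Option ι × Option ι // s.1 ≠ s.2})
    (g := fun s v => wedge (N.web 2 s.1.1 v) (N.web 2 s.1.2 v))
    (fun s v => wedge_analyticAt (N.web_analyticAt _ _ _) (N.web_analyticAt _ _ _)) (by
      rintro ⟨⟨_ | p, _ | p'⟩, h⟩
      · exact (h rfl).elim
      · exact N.exists_wedge_none_some_ne_zero p'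
      · obtain ⟨v, hv⟩ := N.exists_wedge_none_some_ne_zero p
        exact ⟨v, by rw [wedge_comm]; exact neg_ne_zero.2 hv⟩
      · exact N.exists_wedge_some_some_ne_zero fun h' => h (by rw [h']))
  have htr : ∀ s t, s ≠ t → wedge (N.web 2 s q) (N.web 2 t q) ≠ 0 := fun s t h => hq ⟨(s, t), h⟩
  have hne : ∀ s, N.web 2 s q ≠ 0 := by
    intro s h0
    obtain ⟨t, ht⟩ : ∃ t, s ≠ t := by
      cases s with
      | some p => exact ⟨none, by simp⟩
      | none =>
        have : 0 < Fintype.card ι := by rw [N.card_points]; have := N.two_le; positivity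
        obtain ⟨p⟩ := Fintype.card_pos_iff.1 this
        exact ⟨some p, by simp⟩
    refine htr s t ht ?_
    rw [h0]
    simp [wedge]
  refine ⟨q, ⟨fun s => N.web_analyticAt 2 s q, hne, htr⟩, fun s => ?_, fun s => ?_⟩
  · exact ((N.web_analyticAt 2 s q).continuousAt.eventually_ne (hne s)).frequently
  · exact .of_forall fun v => wedge_self _

end Net

/-! ### Lower bounds for the rank -/

/-- A space of abelian relations whose nonzero elements have nonzero germs bounds the rank. -/
theorem rank_le_webRank {τ : Type} [Fintype τ] {ω : τ → Form} {q : Plane} {E : Type}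
    [AddCommGroup E] [Module ℂ E] (η : E →ₗ[ℂ] (τ → Form))
    (hη : ∀ θ, IsAbelianRelationAt ω (η θ) q)
    (h0 : ∀ θ, (∀ i, ∀ᶠ v in 𝓝 q, η θ i v = 0) → θ = 0) : Module.rank ℂ E ≤ webRank ω q := by
  let g : E →ₗ[ℂ] abelianRelations ω q :=
    { toFun := fun θ => ⟨fun i => ((η θ i : Form) : Germ (𝓝 q) (Plane →L[ℂ] ℂ)), η θ, hη θ, rfl⟩
      map_add' := fun θ θ' => by
        apply Subtype.ext
        funext i
        simp only [map_add]
        rfl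
      map_smul' := fun a θ => by
        apply Subtype.ext
        funext i
        simp only [map_smul]
        rfl }
  refine LinearMap.rank_le_of_injective g fun θ θ' h => sub_eq_zero.1 (h0 _ fun i => ?_)
  have h₁ : ((η θ i : Form) : Germ (𝓝 q) (Plane →L[ℂ] ℂ)) = ((η θ' i : Form) : Germ _ _) :=
    congrFun (congrArg Subtype.val h) i
  filter_upwards [Germ.coe_eq.1 h₁] with v hv
  rw [map_sub, Pi.sub_apply, Pi.sub_apply, hv, sub_self]

/-! ### Homogeneous polynomials that vanish on lines -/

/-- The number of monomials of degree `n` in three variables. -/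
theorem rank_homogeneousSubmodule (n : ℕ) :
    Module.rank ℂ (MvPolynomial.homogeneousSubmodule (Fin 3) ℂ n) =
      (((n + 2) * (n + 1) / 2 : ℕ) : Cardinal) := by
  rw [MvPolynomial.homogeneousSubmodule_eq_finsupp_supported]
  rw [LinearEquiv.rank_eq (AddMonoidAlgebra.supportedEquivFinsupp (S := ℂ) (R := ℂ)
    {d : Fin 3 →₀ ℕ | d.degree = n})]
  rw [rank_finsupp_self, Cardinal.lift_id]
  have e : {d : Fin 3 →₀ ℕ | d.degree = n} ≃ Sym (Fin 3) n :=
    (Equiv.subtypeEquivRight fun _ => Iff.rfl).trans (Sym.equivNatSum (Fin 3) n).symm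
  rw [Cardinal.mk_congr e, Cardinal.mk_fintype, Sym.card_sym_eq_choose, Fintype.card_fin,
    show 3 + n - 1 = n + 2 by omega, Nat.choose_symm_add, Nat.choose_two_right]
  rfl

/-- The linear form with coefficients `a`. -/
def linForm (a : Fin 3 → ℂ) : MvPolynomial (Fin 3) ℂ :=
  ∑ j, MvPolynomial.C (a j) * MvPolynomial.X j

theorem eval_linForm (a x : Fin 3 → ℂ) : MvPolynomial.eval x (linForm a) = a ⬝ᵥ x := by
  simp [linForm, dotProduct]

theorem linForm_ne_zero {a : Fin 3 → ℂ} (ha : a ≠ 0) : linForm a ≠ 0 := fun h0 =>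
  ha (dotProduct_eq_zero _ fun x => by rw [← eval_linForm, h0, map_zero])

/-- The restriction of a polynomial to the line through `y` of direction `z`. -/
def restrictLine (Q : MvPolynomial (Fin 3) ℂ) (y z : Fin 3 → ℂ) : Polynomial ℂ :=
  MvPolynomial.aeval (fun j => Polynomial.C (y j) + Polynomial.C (z j) * Polynomial.X) Q

theorem eval_restrictLine (Q : MvPolynomial (Fin 3) ℂ) (y z : Fin 3 → ℂ) (t : ℂ) :
    (restrictLine Q y z).eval t = MvPolynomial.eval (y + t • z) Q := by
  rw [restrictLine, MvPolynomial.aeval_def, ← Polynomial.coe_evalRingHom, MvPolynomial.hom_eval₂,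
    MvPolynomial.eval, MvPolynomial.coe_eval₂Hom]
  congr 1
  · ext a
    exact Polynomial.eval_C
  · ext j
    simp only [Polynomial.coe_evalRingHom, Polynomial.eval_add,
      Polynomial.eval_mul, Polynomial.eval_C, Polynomial.eval_X, Pi.add_apply, Pi.smul_apply,
      smul_eq_mul, mul_comm]

theorem natDegree_restrictLine_le {Q : MvPolynomial (Fin 3) ℂ} {n : ℕ} (hQ : Q.IsHomogeneous n)
    (y z : Fin 3 → ℂ) : (restrictLine Q y z).natDegree ≤ n := by
  have := MvPolynomial.aeval_natDegree_le Q hQ.totalDegree_le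
    (fun j => Polynomial.C (y j) + Polynomial.C (z j) * Polynomial.X) (n := 1)
    fun j => by compute_degree
  simpa [restrictLine] using this

theorem exists_eval_ne_zero {Q : MvPolynomial (Fin 3) ℂ} (hQ : Q ≠ 0) :
    ∃ x, MvPolynomial.eval x Q ≠ 0 := by
  by_contra! h
  exact hQ (MvPolynomial.funext fun x => by rw [h x, map_zero])

/-- A form of degree `d` that vanishes on `n` lines vanishes if `d < n`, or if `d = n` and it
vanishes at a point outside the lines: restrict it to general lines through this point. -/
theorem eq_zero_of_vanishing {τ : Type*} [Fintype τ] {l : τ → Fin 3 → ℂ}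
    (hl : ∀ i j, i ≠ j → crossProduct (l i) (l j) ≠ 0) {Q : MvPolynomial (Fin 3) ℂ} {d : ℕ}
    (hQ : Q.IsHomogeneous d) {z : Fin 3 → ℂ} (hz : ∀ i, l i ⬝ᵥ z ≠ 0)
    (hd : d < Fintype.card τ ∨ d = Fintype.card τ ∧ MvPolynomial.eval z Q = 0)
    (hv : ∀ i x, l i ⬝ᵥ x = 0 → MvPolynomial.eval x Q = 0) : Q = 0 := by
  classical
  by_contra hQ0
  -- the lines through `z` and the intersection of two of the lines
  let D₁ : MvPolynomial (Fin 3) ℂ := ∏ s ∈ (Finset.univ : Finset τ).offDiag,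
    linForm ((l s.1 ⬝ᵥ z) • l s.2 - (l s.2 ⬝ᵥ z) • l s.1)
  -- the translates of the lines that pass through `z`
  let D₂ : MvPolynomial (Fin 3) ℂ := ∏ i, (linForm (l i) - MvPolynomial.C (l i ⬝ᵥ z))
  have hD₁ : D₁ ≠ 0 := by
    refine Finset.prod_ne_zero_iff.2 fun s hs h0 => ?_
    refine smul_ne_zero (hz s.1) (hl s.1 s.2 (Finset.mem_offDiag.1 hs).2.2) ?_
    have h : (l s.1 ⬝ᵥ z) • l s.2 - (l s.2 ⬝ᵥ z) • l s.1 = 0 := by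
      by_contra hne
      exact linForm_ne_zero hne h0
    rw [← map_smul, ← sub_add_cancel ((l s.1 ⬝ᵥ z) • l s.2) ((l s.2 ⬝ᵥ z) • l s.1), h, zero_add,
      map_smul, cross_self, smul_zero]
  have hD₂ : D₂ ≠ 0 := by
    refine Finset.prod_ne_zero_iff.2 fun i _ h0 => hz i ?_
    have := congrArg (MvPolynomial.eval 0) h0
    rw [map_sub, eval_linForm, MvPolynomial.eval_C, dotProduct_zero, zero_sub, map_zero] at this
    exact neg_eq_zero.1 this
  obtain ⟨x, hx⟩ := exists_eval_ne_zero (mul_ne_zero (mul_ne_zero hD₁ hD₂) hQ0)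
  rw [map_mul, map_mul, mul_ne_zero_iff, mul_ne_zero_iff, map_prod, map_prod,
    Finset.prod_ne_zero_iff, Finset.prod_ne_zero_iff] at hx
  obtain ⟨⟨h₁, h₂⟩, hQx⟩ := hx
  have h₂ : ∀ i, l i ⬝ᵥ (x - z) ≠ 0 := fun i => by
    have := h₂ i (Finset.mem_univ i)
    rwa [map_sub, eval_linForm, MvPolynomial.eval_C, ← dotProduct_sub] at this
  have h₁ : ∀ i j, i ≠ j → (l i ⬝ᵥ z) * (l j ⬝ᵥ x) - (l j ⬝ᵥ z) * (l i ⬝ᵥ x) ≠ 0 := by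
    intro i j hij
    have := h₁ (i, j) (Finset.mem_offDiag.2 ⟨Finset.mem_univ i, Finset.mem_univ j, hij⟩)
    rwa [eval_linForm, sub_dotProduct, smul_dotProduct, smul_dotProduct] at this
  -- the restriction of `Q` to the line through `z` and `x` has too many roots
  let t : τ → ℂ := fun i => -(l i ⬝ᵥ z) / (l i ⬝ᵥ (x - z))
  have ht : ∀ i, (restrictLine Q z (x - z)).eval (t i) = 0 := fun i => by
    rw [eval_restrictLine]
    refine hv i _ ?_
    rw [dotProduct_add, dotProduct_smul, smul_eq_mul, div_mul_cancel₀ _ (h₂ i)]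
    ring
  have htinj : Function.Injective t := by
    intro i j hij
    by_contra hne
    refine h₁ i j hne ?_
    have := (div_eq_div_iff (h₂ i) (h₂ j)).1 hij
    simp only [dotProduct_sub] at this
    linear_combination -this
  have hcard : ∀ s : Finset ℂ, (∀ a ∈ s, (restrictLine Q z (x - z)).eval a = 0) →
      s.card ≤ d := by
    intro s hs
    have hne : restrictLine Q z (x - z) ≠ 0 := fun h0 => by
      refine hQx ?_
      have := eval_restrictLine Q z (x - z) 1
      rwa [h0, Polynomial.eval_zero, one_smul, add_sub_cancel, eq_comm] at this
    calc s.card ≤ (restrictLine Q z (x - z)).roots.toFinset.card :=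
          Finset.card_le_card fun a ha => by simpa [hne] using hs a ha
      _ ≤ (restrictLine Q z (x - z)).roots.card := Multiset.toFinset_card_le _
      _ ≤ _ := Polynomial.card_roots' _
      _ ≤ d := natDegree_restrictLine_le hQ _ _
  have himage : (Finset.univ.image t).card = Fintype.card τ :=
    Finset.card_image_of_injective _ htinj
  rcases hd with hd | ⟨rfl, hzQ⟩
  · have := hcard (Finset.univ.image t) (by simpa using ht)
    omega
  · have h0 : (0 : ℂ) ∉ Finset.univ.image t := by
      simp only [Finset.mem_image, not_exists, Finset.mem_univ, true_and]
      intro i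
      exact div_ne_zero (neg_ne_zero.2 (hz i)) (h₂ i)
    have := hcard (insert 0 (Finset.univ.image t)) (by
      intro a ha
      rcases Finset.mem_insert.1 ha with rfl | ha
      · rw [eval_restrictLine, zero_smul, add_zero, hzQ]
      · obtain ⟨i, -, rfl⟩ := Finset.mem_image.1 ha
        exact ht i)
    rw [Finset.card_insert_of_notMem h0] at this
    omega

/-- Lagrange's identity for binary forms: the polynomial `g` is the dehomogenization of a form of
degree at most `n - 2` in `α, β`, evaluated at `n` points. -/
theorem sum_div_prod_eq_zero {τ : Type*} [Fintype τ] [DecidableEq τ] {α β : τ → ℂ}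
    (hα : ∀ i, α i ≠ 0) (h : ∀ i j, i ≠ j → α i * β j - α j * β i ≠ 0) {g : Polynomial ℂ}
    (hg : g.natDegree + 2 ≤ Fintype.card τ) :
    ∑ i, α i ^ (Fintype.card τ - 2) * g.eval (β i / α i) /
      ∏ j ∈ Finset.univ.erase i, (α j * β i - α i * β j) = 0 := by
  have hinj : Set.InjOn (fun i => β i / α i) (Finset.univ : Finset τ) := by
    intro i _ j _ hij
    by_contra hne
    refine h i j hne ?_
    have := (div_eq_div_iff (hα i) (hα j)).1 hij
    linear_combination -this
  have hdeg : g.natDegree < Fintype.card τ := by omega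
  have h₁ := Lagrange.coeff_eq_sum (s := Finset.univ) hinj (P := g)
    (Polynomial.degree_le_natDegree.trans_lt (by rw [Finset.card_univ]; exact_mod_cast hdeg))
  rw [Finset.card_univ, Polynomial.coeff_eq_zero_of_natDegree_lt (by omega)] at h₁
  have hprod : ∀ i, ∏ j ∈ Finset.univ.erase i, (α j * β i - α i * β j) =
      α i ^ (Fintype.card τ - 2) * (∏ j, α j) *
        ∏ j ∈ Finset.univ.erase i, (β i / α i - β j / α j) := by
    intro i
    have e : ∀ j ∈ Finset.univ.erase i, α j * β i - α i * β j =
        α i * α j * (β i / α i - β j / α j) := fun j _ => by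
      have := hα i
      have := hα j
      field_simp
    rw [Finset.prod_congr rfl e, Finset.prod_mul_distrib, Finset.prod_mul_distrib,
      Finset.prod_const, Finset.card_erase_of_mem (Finset.mem_univ i), Finset.card_univ,
      ← Finset.mul_prod_erase Finset.univ α (Finset.mem_univ i),
      show Fintype.card τ - 1 = (Fintype.card τ - 2) + 1 by omega, pow_succ]
    ring
  have hp : ∏ j, α j ≠ 0 := Finset.prod_ne_zero_iff.2 fun j _ => hα j
  rw [← mul_right_inj' hp, mul_zero, Finset.mul_sum, h₁]
  refine Finset.sum_congr rfl fun i _ => ?_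
  rw [hprod]
  have := pow_ne_zero (Fintype.card τ - 2) (hα i)
  field_simp

/-! ### Abelian relations of pencils of lines -/

section Pencils

variable {τ : Type} [Fintype τ]

/-- The coefficient of `det (p, x, dx)`, as a function of `p × x` for the point `p = pt i`, in
the abelian relation of pencils of lines given by the form `Q`. By projective duality it is the
residue, along the `i`-th of the lines dual to the points `pt j`, of a rational `2`-form with
numerator `Q` and poles on these lines. -/
def pencilCoeff (pt : τ → Fin 3 → ℂ) (Q : MvPolynomial (Fin 3) ℂ) (i : τ) (h : Fin 3 → ℂ) : ℂ :=
  by classical exact MvPolynomial.eval h Q / ∏ j ∈ Finset.univ.erase i, pt j ⬝ᵥ h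

/-- The abelian relation of pencils of lines given by the form `Q`. -/
def pencilRelation (pt : τ → Fin 3 → ℂ) (Q : MvPolynomial (Fin 3) ℂ) (c : Fin 3) (i : τ) : Form :=
  fun v => pencilCoeff pt Q i (crossProduct (pt i) (chart c v)) • radial (pt i) c v

/-- The numerators of the components at `v` are the values of a binary form of degree `n - 2` at the
`n` points where the line dual to `v` meets the lines dual to the points, and the denominators are
those of Lagrange's interpolation formula. -/
theorem sum_pencilRelation {pt : τ → Fin 3 → ℂ} {Q : MvPolynomial (Fin 3) ℂ}
    (h3 : 3 ≤ Fintype.card τ) (hQ : Q.IsHomogeneous (Fintype.card τ - 3)) {c : Fin 3} {v : Plane}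
    (hv : ∀ i j, i ≠ j → pt i ⬝ᵥ crossProduct (pt j) (chart c v) ≠ 0)
    (hr : ∀ i, radial (pt i) c v ≠ 0) :
    ∑ i, pencilRelation pt Q c i v = 0 := by
  classical
  obtain ⟨u', hu'⟩ := exists_forall_ne_zero (g := fun i u => radial (pt i) c v u)
    (fun i u => (radial (pt i) c v).analyticAt u) (fun i => by
      obtain ⟨w, hw⟩ := exists_apply_eq_one (hr i)
      exact ⟨w, by rw [hw]; exact one_ne_zero⟩)
  obtain ⟨u'', hu''⟩ : ∃ u'' : Plane, u' 0 * u'' 1 - u' 1 * u'' 0 = 1 := by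
    have hu0 : u' 0 ≠ 0 ∨ u' 1 ≠ 0 := by
      by_contra! h
      obtain ⟨i⟩ : Nonempty τ := Fintype.card_pos_iff.1 (by omega)
      refine hu' i ?_
      rw [show u' = 0 from funext fun k => by fin_cases k <;> simp [h.1, h.2], map_zero]
    rcases hu0 with h | h
    · exact ⟨![0, (u' 0)⁻¹], by simp [h]⟩
    · exact ⟨![-(u' 1)⁻¹, 0], by simp [h]⟩
  ext u
  set x := chart c v with hx
  set y := chartDir c u' with hy
  set z := chartDir c u'' with hz
  have hΔ : x ⬝ᵥ crossProduct y z = chartSign c := by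
    rw [hx, hy, hz, triple_chart, hu'', mul_one]
  have hΔ0 := chartSign_ne_zero c
  set α : τ → ℂ := fun i => pt i ⬝ᵥ crossProduct x y with hα
  set β : τ → ℂ := fun i => pt i ⬝ᵥ crossProduct x z with hβ
  have hα0 : ∀ i, α i ≠ 0 := fun i => by
    have := hu' i
    rwa [radial_apply] at this
  have hr' : ∀ i, radial (pt i) c v u =
      α i * ((u 0 * u'' 1 - u 1 * u'' 0) + (u' 0 * u 1 - u' 1 * u 0) * (β i / α i)) := by
    intro i
    have h₁ : u = (u 0 * u'' 1 - u 1 * u'' 0) • u' + (u' 0 * u 1 - u' 1 * u 0) • u'' := by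
      funext k
      fin_cases k <;> simp
      · linear_combination -(u 0) * hu''
      · linear_combination -(u 1) * hu''
    rw [mul_add, mul_left_comm, mul_div_cancel₀ _ (hα0 i)]
    conv_lhs => rw [h₁]
    rw [map_add, map_smul, map_smul, radial_apply, radial_apply, smul_eq_mul, smul_eq_mul]
    ring
  set e₁ := (chartSign c)⁻¹ • crossProduct z x with he₁
  set e₂ := (chartSign c)⁻¹ • crossProduct x y with he₂
  have hcross : ∀ i, crossProduct (pt i) x = α i • (e₁ + (β i / α i) • e₂) := by
    intro i
    rw [smul_add, smul_smul (α i) (β i / α i) e₂, mul_div_cancel₀ _ (hα0 i), he₁, he₂,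
      smul_comm (α i), smul_comm (β i),
      ← smul_add, eq_inv_smul_iff₀ hΔ0, ← hΔ, hα, hβ]
    simp only [triple_eq]
    funext k
    fin_cases k <;> simp [cross_apply] <;> ring
  have hdot : ∀ i j, pt j ⬝ᵥ crossProduct (pt i) x =
      (chartSign c)⁻¹ * (α j * β i - α i * β j) := by
    intro i j
    rw [eq_inv_mul_iff_mul_eq₀ hΔ0, ← hΔ, hα, hβ]
    simp only [triple_eq]
    ring
  have hQs : ∀ i, MvPolynomial.eval (crossProduct (pt i) x) Q =
      α i ^ (Fintype.card τ - 3) * (restrictLine Q e₁ e₂).eval (β i / α i) := by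
    intro i
    rw [hcross, eval_smul_of_isHomogeneous hQ, eval_restrictLine]
  have key := sum_div_prod_eq_zero hα0 (fun i j hij h => by
    refine hv i j hij ?_
    rw [hdot, h, mul_zero]) (g := restrictLine Q e₁ e₂ *
      (Polynomial.C (u 0 * u'' 1 - u 1 * u'' 0) +
        Polynomial.C (u' 0 * u 1 - u' 1 * u 0) * Polynomial.X)) (by
      have h₁ := natDegree_restrictLine_le hQ e₁ e₂
      have h₂ := Polynomial.natDegree_linear_le (a := u' 0 * u 1 - u' 1 * u 0)
        (b := u 0 * u'' 1 - u 1 * u'' 0)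
      rw [add_comm] at h₂
      have h₃ := Polynomial.natDegree_mul_le (p := restrictLine Q e₁ e₂)
        (q := Polynomial.C (u 0 * u'' 1 - u 1 * u'' 0) +
        Polynomial.C (u' 0 * u 1 - u' 1 * u 0) * Polynomial.X)
      omega)
  rw [sum_apply, zero_apply, ← mul_zero (((chartSign c)⁻¹ ^ (Fintype.card τ - 1))⁻¹), ← key,
    Finset.mul_sum]
  refine Finset.sum_congr rfl fun i _ => ?_
  rw [pencilRelation, ← hx, smul_apply, smul_eq_mul, hr', pencilCoeff, hQs]
  simp only [hdot, Finset.prod_mul_distrib, Finset.prod_const,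
    Finset.card_erase_of_mem (Finset.mem_univ _), Finset.card_univ]
  rw [Polynomial.eval_mul, Polynomial.eval_add, Polynomial.eval_mul, Polynomial.eval_C,
    Polynomial.eval_C, Polynomial.eval_X,
    show Fintype.card τ - 2 = (Fintype.card τ - 3) + 1 by omega, pow_succ]
  have h₁ : ∏ j ∈ Finset.univ.erase i, (α j * β i - α i * β j) ≠ 0 :=
    Finset.prod_ne_zero_iff.2 fun j hj h => hv j i (Finset.ne_of_mem_erase hj) (by
      rw [hdot, h, mul_zero])
  have h₂ : (chartSign c)⁻¹ ^ (Fintype.card τ - 1) ≠ 0 := pow_ne_zero _ (inv_ne_zero hΔ0)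
  field_simp

/-- Closedness follows from Euler's identity for functions of degree `-2`. -/
theorem isClosedAt_smul_radial {p : Fin 3 → ℂ} {c : Fin 3} {v : Plane} {g : (Fin 3 → ℂ) → ℂ}
    (hg : DifferentiableAt ℂ g (crossProduct p (chart c v)))
    (hs : ∀ s : ℂ, s ≠ 0 → g (s • crossProduct p (chart c v)) =
      (s ^ 2)⁻¹ * g (crossProduct p (chart c v))) :
    IsClosedAt (fun v => g (crossProduct p (chart c v)) • radial p c v) v := by
  set h := crossProduct p (chart c v) with hh
  -- Euler's identity
  have heuler : fderiv ℂ g h h = -2 * g h := by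
    have h₁ : HasDerivAt (fun s : ℂ => g (s • h)) (fderiv ℂ g h h) 1 := by
      have h₂ : HasDerivAt (fun s : ℂ => s • h) h 1 := by
        simpa using (hasDerivAt_id (1 : ℂ)).smul_const h
      have h₃ : HasFDerivAt g (fderiv ℂ g h) ((1 : ℂ) • h) := by
        rw [one_smul]; exact hg.hasFDerivAt
      exact h₃.comp_hasDerivAt 1 h₂
    have h₂ : HasDerivAt (fun s : ℂ => (s ^ 2)⁻¹ * g h) (-2 * g h) 1 := by
      have := (((hasDerivAt_id (1 : ℂ)).fun_pow 2).fun_inv (by simp)).mul_const (g h)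
      simpa using this
    refine h₁.unique (h₂.congr_of_eventuallyEq ?_)
    filter_upwards [eventually_ne_nhds (one_ne_zero (α := ℂ))] with s hs'
    exact hs s hs'
  have hG' : HasFDerivAt (fun v => g (crossProduct p (chart c v))) ((fderiv ℂ g h).comp
      ((crossProduct p).toContinuousLinearMap.comp (chartDir c))) v :=
    HasFDerivAt.comp (g := g) v hg.hasFDerivAt
      ((crossProduct p).toContinuousLinearMap.hasFDerivAt.comp v (hasFDerivAt_chart c v))
  have hG := hG'.differentiableAt
  have hGd : ∀ u, fderiv ℂ (fun v => g (crossProduct p (chart c v))) v u =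
      fderiv ℂ g h (crossProduct p (chartDir c u)) := fun u => by
    rw [hG'.fderiv]
    rfl
  have hrd : ∀ u w, fderiv ℂ (radial p c) v u w =
      p ⬝ᵥ crossProduct (chartDir c u) (chartDir c w) := by
    intro u w
    have h₁ := fderiv_form_apply_apply (radial_analyticAt p c v).differentiableAt u w
    refine h₁.unique ?_
    have h₂ : HasDerivAt (fun t : ℂ => p ⬝ᵥ crossProduct (chart c v) (chartDir c w) +
        t * (p ⬝ᵥ crossProduct (chartDir c u) (chartDir c w)))
        (p ⬝ᵥ crossProduct (chartDir c u) (chartDir c w)) 0 := by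
      simpa using ((hasDerivAt_id (0 : ℂ)).mul_const
        (p ⬝ᵥ crossProduct (chartDir c u) (chartDir c w))).const_add
          (p ⬝ᵥ crossProduct (chart c v) (chartDir c w))
    refine h₂.congr_of_eventuallyEq (.of_forall fun t => ?_)
    simp only [radial_apply, chart_add, map_smul, triple_eq, Pi.add_apply, Pi.smul_apply,
      smul_eq_mul]
    ring
  intro u w
  have hr := (radial_analyticAt p c v).differentiableAt
  rw [fderiv_fun_smul hG hr]
  simp only [add_apply, smul_apply, ContinuousLinearMap.smulRight_apply, smul_eq_mul, hGd, hrd,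
    radial_apply]
  have hkey : (p ⬝ᵥ crossProduct (chart c v) (chartDir c w)) • crossProduct p (chartDir c u) -
      (p ⬝ᵥ crossProduct (chart c v) (chartDir c u)) • crossProduct p (chartDir c w) =
      (p ⬝ᵥ crossProduct (chartDir c u) (chartDir c w)) • h := by
    rw [hh]
    simp only [triple_eq]
    funext k
    fin_cases k <;> simp [cross_apply] <;> ring
  have h₁ := congrArg (fderiv ℂ g h) hkey
  rw [map_sub, map_smul, map_smul, map_smul, heuler] at h₁
  simp only [smul_eq_mul] at h₁
  have h₂ : p ⬝ᵥ crossProduct (chartDir c w) (chartDir c u) =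
      -(p ⬝ᵥ crossProduct (chartDir c u) (chartDir c w)) := by
    simp only [triple_eq]; ring
  rw [h₂]
  linear_combination h₁

theorem isHomogeneous_pencilCoeff {pt : τ → Fin 3 → ℂ} {Q : MvPolynomial (Fin 3) ℂ}
    (h3 : 3 ≤ Fintype.card τ) (hQ : Q.IsHomogeneous (Fintype.card τ - 3)) (i : τ) {s : ℂ}
    (hs : s ≠ 0) (h : Fin 3 → ℂ) :
    pencilCoeff pt Q i (s • h) = (s ^ 2)⁻¹ * pencilCoeff pt Q i h := by
  classical
  rw [pencilCoeff, pencilCoeff, eval_smul_of_isHomogeneous hQ]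
  simp only [dotProduct_smul, smul_eq_mul, Finset.prod_mul_distrib, Finset.prod_const,
    Finset.card_erase_of_mem (Finset.mem_univ _), Finset.card_univ]
  rw [show Fintype.card τ - 1 = (Fintype.card τ - 3) + 2 by omega, pow_add]
  have := pow_ne_zero (Fintype.card τ - 3) hs
  field_simp

theorem analyticAt_pencilCoeff {pt : τ → Fin 3 → ℂ} (Q : MvPolynomial (Fin 3) ℂ) {i : τ}
    {h : Fin 3 → ℂ} (hi : ∀ j, j ≠ i → pt j ⬝ᵥ h ≠ 0) :
    AnalyticAt ℂ (pencilCoeff pt Q i) h := by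
  classical
  refine AnalyticAt.div (AnalyticOnNhd.eval_mvPolynomial Q h (Set.mem_univ h)) ?_
    (Finset.prod_ne_zero_iff.2 fun j hj => hi j (Finset.ne_of_mem_erase hj))
  refine Finset.analyticAt_fun_prod _ fun j _ => ?_
  exact ((dotProductBilin ℂ ℂ (pt j)).toContinuousLinearMap).analyticAt h

theorem analyticAt_pencilRelation {pt : τ → Fin 3 → ℂ} (Q : MvPolynomial (Fin 3) ℂ) {c : Fin 3}
    {v : Plane} (hv : ∀ i j, i ≠ j → pt i ⬝ᵥ crossProduct (pt j) (chart c v) ≠ 0) (i : τ) :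
    AnalyticAt ℂ (pencilRelation pt Q c i) v := by
  refine AnalyticAt.fun_smul (AnalyticAt.fun_comp (analyticAt_pencilCoeff Q fun j hj => hv j i hj) ?_)
    (radial_analyticAt _ _ _)
  exact ((crossProduct (pt i)).toContinuousLinearMap.analyticAt _).comp (analyticAt_chart c v)

theorem isClosedAt_pencilRelation {pt : τ → Fin 3 → ℂ} {Q : MvPolynomial (Fin 3) ℂ}
    (h3 : 3 ≤ Fintype.card τ) (hQ : Q.IsHomogeneous (Fintype.card τ - 3)) {c : Fin 3} {v : Plane}
    (hv : ∀ i j, i ≠ j → pt i ⬝ᵥ crossProduct (pt j) (chart c v) ≠ 0) (i : τ) :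
    IsClosedAt (pencilRelation pt Q c i) v :=
  isClosedAt_smul_radial (analyticAt_pencilCoeff Q fun j hj => hv j i hj).differentiableAt
    fun _ hs => isHomogeneous_pencilCoeff h3 hQ i hs _

/-- The points `p × x`, for `x` near a point other than `p`, are Zariski dense in the line dual to
the point `p`. -/
theorem eval_eq_zero_of_pencil {p : Fin 3 → ℂ} {Q : MvPolynomial (Fin 3) ℂ} {c : Fin 3}
    {q : Plane} {d : ℕ} (hQ : Q.IsHomogeneous d)
    (h : ∀ᶠ v in 𝓝 q, MvPolynomial.eval (crossProduct p (chart c v)) Q = 0) (hp : p ≠ 0)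
    {y : Fin 3 → ℂ} (hy : p ⬝ᵥ y = 0) : MvPolynomial.eval y Q = 0 := by
  obtain ⟨z, rfl⟩ : ∃ z, y = crossProduct p z := by
    obtain ⟨k, hk⟩ : ∃ k, p k ≠ 0 := by
      by_contra! h'
      exact hp (funext h')
    rw [dot_eq] at hy
    fin_cases k
    · have hk : p 0 ≠ 0 := hk
      refine ⟨![0, y 2 / p 0, -y 1 / p 0], funext fun i => ?_⟩
      fin_cases i <;> simp [cross_apply] <;> field_simp
      linear_combination hy
    · have hk : p 1 ≠ 0 := hk
      refine ⟨![-y 2 / p 1, 0, y 0 / p 1], funext fun i => ?_⟩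
      fin_cases i <;> simp [cross_apply] <;> field_simp
      linear_combination hy
    · have hk : p 2 ≠ 0 := hk
      refine ⟨![y 1 / p 2, -y 0 / p 2, 0], funext fun i => ?_⟩
      fin_cases i <;> simp [cross_apply] <;> field_simp
      linear_combination hy
  have hF : AnalyticOnNhd ℂ (fun x => MvPolynomial.eval (crossProduct p x) Q) Set.univ :=
    fun x _ => AnalyticAt.fun_comp (g := fun x => MvPolynomial.eval x Q)
      (AnalyticOnNhd.eval_mvPolynomial Q _ (Set.mem_univ _))
      ((crossProduct p).toContinuousLinearMap.analyticAt x)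
  refine hF.eqOn_zero_of_preconnected_of_eventuallyEq_zero isPreconnected_univ
    (Set.mem_univ (chart c q)) ?_ (Set.mem_univ z)
  -- the vectors near `chart c q` are multiples of vectors `chart c v` with `v` near `q`
  have hc : ContinuousAt (fun x : Fin 3 → ℂ => (fun j => x (c.succAbove j) / x c : Plane))
      (chart c q) := by
    refine continuousAt_pi.2 fun j => ContinuousAt.div (continuous_apply _).continuousAt
      (continuous_apply _).continuousAt ?_
    rw [chart_self]
    exact one_ne_zero
  have hcq : (fun j => chart c q (c.succAbove j) / chart c q c : Plane) = q := by
    funext j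
    rw [chart_self, div_one, chart, Fin.insertNth_apply_succAbove]
  have h' := hc.eventually (p := fun v => MvPolynomial.eval (crossProduct p (chart c v)) Q = 0)
    (by
    change ∀ᶠ v in 𝓝 (fun j => chart c q (c.succAbove j) / chart c q c : Plane), _
    rwa [hcq])
  have hne : ∀ᶠ x : Fin 3 → ℂ in 𝓝 (chart c q), x c ≠ 0 := by
    refine (continuous_apply c).continuousAt.eventually_ne ?_
    rw [chart_self]
    exact one_ne_zero
  filter_upwards [h', hne] with x hx hx0
  have hx' : x = x c • chart c (fun j => x (c.succAbove j) / x c) := by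
    funext i
    refine Fin.succAboveCases c ?_ (fun j => ?_) i
    · rw [Pi.smul_apply, chart_self, smul_eq_mul, mul_one]
    · rw [Pi.smul_apply, chart, Fin.insertNth_apply_succAbove, smul_eq_mul, mul_div_cancel₀ _ hx0]
  change MvPolynomial.eval (crossProduct p x) Q = 0
  rw [hx', map_smul, eval_smul_of_isHomogeneous hQ, hx, mul_zero]

/-- The abelian relations given by distinct forms `Q` are distinct: a form of degree `n - 3` that
vanishes on `n` lines is zero. -/
theorem eq_zero_of_pencilRelation_eq_zero {pt : τ → Fin 3 → ℂ} {Q : MvPolynomial (Fin 3) ℂ}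
    (h3 : 3 ≤ Fintype.card τ) (hQ : Q.IsHomogeneous (Fintype.card τ - 3)) {c : Fin 3} {q : Plane}
    (hv : ∀ i j, i ≠ j → pt i ⬝ᵥ crossProduct (pt j) (chart c q) ≠ 0)
    (hr : ∀ i, crossProduct (pt i) (chart c q) ≠ 0)
    (h : ∀ i, ∀ᶠ v in 𝓝 q, pencilRelation pt Q c i v = 0) : Q = 0 := by
  classical
  have hpt : ∀ i, pt i ≠ 0 := fun i h0 => hr i (by rw [h0, map_zero, LinearMap.zero_apply])
  have hcross : ∀ i j, i ≠ j → crossProduct (pt i) (pt j) ≠ 0 := fun i j hij h0 => by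
    refine hv i j hij ?_
    have : pt i ⬝ᵥ crossProduct (pt j) (chart c q) =
        crossProduct (pt i) (pt j) ⬝ᵥ chart c q := by
      rw [triple_eq, dot_eq]; simp [cross_apply]; ring
    rw [this, h0, zero_dotProduct]
  obtain ⟨z, hz⟩ : ∃ z, ∀ i, pt i ⬝ᵥ z ≠ 0 := by
    obtain ⟨z, hz⟩ := exists_eval_ne_zero
      (Finset.prod_ne_zero_iff.2 fun i (_ : i ∈ Finset.univ) => linForm_ne_zero (hpt i))
    rw [map_prod, Finset.prod_ne_zero_iff] at hz
    exact ⟨z, fun i => by rw [← eval_linForm]; exact hz i (Finset.mem_univ i)⟩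
  refine eq_zero_of_vanishing hcross hQ hz (.inl (by omega)) fun i x hx =>
    eval_eq_zero_of_pencil (c := c) (q := q) hQ ?_ (hpt i) hx
  have hne : ∀ᶠ v in 𝓝 q, radial (pt i) c v ≠ 0 :=
    (radial_analyticAt _ _ _).continuousAt.eventually_ne (radial_ne_zero (hr i))
  have hne' : ∀ᶠ v in 𝓝 q, ∀ j, j ≠ i → pt j ⬝ᵥ crossProduct (pt i) (chart c v) ≠ 0 := by
    refine eventually_all.2 fun j => ?_
    by_cases hj : j = i
    · exact .of_forall fun _ h => (h hj).elim
    · have hc : ContinuousAt (fun v => pt j ⬝ᵥ crossProduct (pt i) (chart c v)) q :=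
        ContinuousAt.comp (g := fun x => pt j ⬝ᵥ crossProduct (pt i) x)
          ((dotProductBilin ℂ ℂ (pt j) ∘ₗ crossProduct (pt i)).continuous_of_finiteDimensional
            |>.continuousAt) (analyticAt_chart c q).continuousAt
      exact (hc.eventually_ne (hv j i hj)).mono fun v hv _ => hv
  filter_upwards [h i, hne, hne'] with v h₁ h₂ h₃
  rw [pencilRelation] at h₁
  have h₄ := (smul_eq_zero.1 h₁).resolve_right h₂
  refine (div_eq_zero_iff.1 h₄).resolve_right (Finset.prod_ne_zero_iff.2 fun j hj => ?_)
  exact h₃ j (Finset.ne_of_mem_erase hj)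

end Pencils

/-! ### Linear independence of logarithms over the rational functions -/

section Logarithms

open Polynomial

variable {σ : Type*} [Fintype σ]

/-- The product of the linear polynomials `X - c k`, for `k` other than `i`. -/
def cofactor (c : σ → ℂ) (i : σ) : ℂ[X] :=
  by classical exact ∏ k ∈ Finset.univ.erase i, (X - C (c k))

theorem mul_cofactor (c : σ → ℂ) (i : σ) : (X - C (c i)) * cofactor c i = ∏ k, (X - C (c k)) := by
  classical
  exact Finset.mul_prod_erase Finset.univ (fun k => X - C (c k)) (Finset.mem_univ i)

theorem eval_cofactor_of_ne (c : σ → ℂ) {i j : σ} (h : i ≠ j) : (cofactor c i).eval (c j) = 0 := by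
  classical
  rw [cofactor, eval_prod]
  exact Finset.prod_eq_zero (Finset.mem_erase.2 ⟨h.symm, Finset.mem_univ j⟩) (by simp)

theorem eval_cofactor_ne_zero {c : σ → ℂ} (hc : Function.Injective c) (i : σ) :
    (cofactor c i).eval (c i) ≠ 0 := by
  classical
  rw [cofactor, eval_prod, Finset.prod_ne_zero_iff]
  intro k hk
  simpa [sub_eq_zero] using fun h => Finset.ne_of_mem_erase hk (hc h).symm

/-- The cofactors are the Lagrange polynomials, up to scalars. -/
theorem eq_zero_of_sum_cofactor_eq_zero {c : σ → ℂ} (hc : Function.Injective c) {k : σ → ℂ}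
    (h : ∀ j, (∑ i, C (k i) * cofactor c i).eval (c j) = 0) (i : σ) : k i = 0 := by
  have h₁ := h i
  rw [eval_finsetSum, Finset.sum_eq_single i] at h₁
  · rw [eval_mul, eval_C] at h₁
    exact (mul_eq_zero.1 h₁).resolve_right (eval_cofactor_ne_zero hc i)
  · intro j _ hj
    rw [eval_mul, eval_cofactor_of_ne c hj, mul_zero]
  · simp

/-- A combination of the functions `1 / (X - c i)` is not the derivative of a rational function
`N / D ^ n`: its poles are simple. -/
theorem eq_zero_of_derivative_eq {c : σ → ℂ} (hc : Function.Injective c) {k : σ → ℂ} (n : ℕ) :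
    ∀ N : ℂ[X], derivative N * ∏ i, (X - C (c i)) - (n : ℂ[X]) * derivative (∏ i, (X - C (c i))) * N
      = (∑ i, C (k i) * cofactor c i) * (∏ i, (X - C (c i))) ^ n → ∀ i, k i = 0 := by
  set D : ℂ[X] := ∏ i, (X - C (c i)) with hD
  have hD0 : D ≠ 0 := Finset.prod_ne_zero_iff.2 fun i _ => X_sub_C_ne_zero _
  induction n with
  | zero =>
    intro N h
    refine eq_zero_of_sum_cofactor_eq_zero hc fun j => ?_
    have hDj : D.eval (c j) = 0 := by
      rw [hD, eval_prod]
      exact Finset.prod_eq_zero (Finset.mem_univ j) (by simp)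
    have := congrArg (eval (c j)) h
    simp only [Nat.cast_zero, zero_mul, sub_zero, pow_zero, mul_one] at this
    rw [← this, eval_mul, hDj, mul_zero]
  | succ n ih =>
    intro N h
    have hsep : IsCoprime D (derivative D) := separable_prod_X_sub_C_iff.2 hc
    obtain ⟨N', rfl⟩ : D ∣ N := by
      have h₁ : D ∣ derivative D * (((n + 1 : ℕ) : ℂ[X]) * N) :=
        ⟨derivative N - (∑ i, C (k i) * cofactor c i) * D ^ n, by
          rw [pow_succ] at h
          linear_combination -h⟩
      have h₂ := hsep.dvd_of_dvd_mul_left h₁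
      rw [← C_eq_natCast] at h₂
      have hu : IsUnit (C ((n + 1 : ℕ) : ℂ) : ℂ[X]) :=
        isUnit_C.2 (IsUnit.mk0 _ (Nat.cast_ne_zero.2 n.succ_ne_zero))
      exact hu.dvd_mul_left.1 h₂
    refine ih N' (mul_left_cancel₀ hD0 ?_)
    rw [derivative_mul, pow_succ] at h
    push_cast at h ⊢
    linear_combination h

theorem eq_zero_of_eventually_eval {t : ℂ → ℂ} (ht : AnalyticAt ℂ t 0) (ht' : deriv t 0 ≠ 0)
    {P : ℂ[X]} (h : ∀ᶠ s in 𝓝 (0 : ℂ), P.eval (t s) = 0) : P = 0 := by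
  have h₁ : ∀ᶠ x in 𝓝 (t 0), P.eval x = 0 := by
    rw [← ht.hasStrictDerivAt.map_nhds_eq ht']
    exact h
  refine eq_zero_of_infinite_isRoot P ?_
  exact Set.Infinite.mono (s := {x | P.eval x = 0}) (fun x hx => hx)
    (infinite_of_mem_nhds (t 0) h₁)

/-- Logarithms of the functions `t - c i` are linearly independent modulo the rational functions
of `t`, over the field of rational functions of `t`: differentiate a relation to lower
the degrees of its coefficients. -/
theorem eq_zero_of_sum_eval_mul_log {c : σ → ℂ} (hc : Function.Injective c) {t : ℂ → ℂ}
    {y : σ → ℂ → ℂ} (ht : AnalyticAt ℂ t 0) (ht' : deriv t 0 ≠ 0)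
    (hne : ∀ᶠ s in 𝓝 (0 : ℂ), ∀ i, t s ≠ c i)
    (hy : ∀ᶠ s in 𝓝 (0 : ℂ), ∀ i, HasDerivAt (y i) (deriv t s / (t s - c i)) s) (d : ℕ) :
    ∀ (P : σ → ℂ[X]) (N : ℂ[X]) (n : ℕ), (∀ i, (P i).natDegree ≤ d) →
      (∀ᶠ s in 𝓝 (0 : ℂ), (∑ i, (P i).eval (t s) * y i s) *
        (∏ i, (X - C (c i))).eval (t s) ^ n = N.eval (t s)) → ∀ i, P i = 0 := by
  set D : ℂ[X] := ∏ i, (X - C (c i)) with hD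
  have hstep : ∀ (P : σ → ℂ[X]) (N : ℂ[X]) (n : ℕ),
      (∀ᶠ s in 𝓝 (0 : ℂ), (∑ i, (P i).eval (t s) * y i s) * D.eval (t s) ^ n = N.eval (t s)) →
      ∀ᶠ s in 𝓝 (0 : ℂ), (∑ i, (derivative (P i)).eval (t s) * y i s) * D.eval (t s) ^ (n + 1) =
        (derivative N * D - (n : ℂ[X]) * derivative D * N -
          (∑ i, P i * cofactor c i) * D ^ n).eval (t s) := by
    intro P N n h
    filter_upwards [h.eventually_nhds, hne, hy, ht.eventually_analyticAt,
      ht.deriv.continuousAt.eventually_ne ht'] with s h hne hy ht ht'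
    have hts := ht.differentiableAt.hasDerivAt
    have hpoly : ∀ R : ℂ[X], HasDerivAt (fun s => R.eval (t s))
        ((derivative R).eval (t s) * deriv t s) s := fun R => (R.hasDerivAt (t s)).comp s hts
    have h₁ : HasDerivAt (fun s => ∑ i, (P i).eval (t s) * y i s)
        (∑ i, ((derivative (P i)).eval (t s) * deriv t s * y i s +
          (P i).eval (t s) * (deriv t s / (t s - c i)))) s :=
      HasDerivAt.fun_sum fun i _ => (hpoly (P i)).mul (hy i)
    have h₂ := ((h₁.fun_mul ((hpoly D).fun_pow n)).congr_of_eventuallyEq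
      (h.mono fun s hs => hs.symm)).unique (hpoly N)
    have h₃ : ∀ i, D.eval (t s) / (t s - c i) = (cofactor c i).eval (t s) := fun i => by
      rw [div_eq_iff (sub_ne_zero.2 (hne i)), hD, ← mul_cofactor c i]
      simp [mul_comm]
    have h₄ : (∑ i, ((derivative (P i)).eval (t s) * deriv t s * y i s +
          (P i).eval (t s) * (deriv t s / (t s - c i)))) * D.eval (t s) =
        deriv t s * ((∑ i, (derivative (P i)).eval (t s) * y i s) * D.eval (t s) +
          ∑ i, (P i).eval (t s) * (cofactor c i).eval (t s)) := by
      rw [Finset.sum_mul, mul_add, Finset.sum_mul, Finset.mul_sum, Finset.mul_sum,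
        ← Finset.sum_add_distrib]
      refine Finset.sum_congr rfl fun i _ => ?_
      rw [← h₃]
      ring
    have h₅ := h.self_of_nhds
    refine mul_left_cancel₀ ht' ?_
    simp only [eval_sub, eval_mul, eval_pow, eval_natCast, eval_finsetSum]
    rcases n with _ | n
    · simp only [pow_zero, mul_one, Nat.cast_zero, zero_mul, mul_zero, add_zero, sub_zero,
        zero_add, pow_one] at h₂ h₅ ⊢
      linear_combination D.eval (t s) * h₂ - h₄
    · simp only [Nat.add_sub_cancel, pow_succ] at h₂ h₅ ⊢
      linear_combination D.eval (t s) * h₂ - D.eval (t s) ^ n * D.eval (t s) * h₄ -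
        (n + 1 : ℕ) * (derivative D).eval (t s) * deriv t s * h₅
  induction d with
  | zero =>
    intro P N n hP h
    have hP' : ∀ i, P i = C ((P i).coeff 0) := fun i =>
      eq_C_of_natDegree_le_zero (hP i)
    have h₁ := hstep P N n h
    have h₂ : derivative N * D - (n : ℂ[X]) * derivative D * N -
        (∑ i, P i * cofactor c i) * D ^ n = 0 := by
      refine eq_zero_of_eventually_eval ht ht' (h₁.mono fun s hs => ?_)
      rw [← hs, Finset.sum_eq_zero, zero_mul]
      intro i _
      rw [hP' i, derivative_C, eval_zero, zero_mul]
    have h₃ := eq_zero_of_derivative_eq hc (k := fun i => (P i).coeff 0) n N (by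
      rw [← hD, sub_eq_zero.1 h₂]
      congr 1
      exact Finset.sum_congr rfl fun i _ => by rw [← hP' i])
    intro i
    rw [hP' i, h₃ i, C_0]
  | succ d ih =>
    intro P N n hP h
    have h₁ := ih _ _ _ (fun i => (natDegree_derivative_le _).trans (by have := hP i; omega))
      (hstep P N n h)
    -- by induction the coefficients are constants, which reduces to the case of degree zero
    exact ih P N n (fun i => by
      rw [derivative_eq_zero.1 (h₁ i)]; exact Nat.zero_le d) h

/-- A quadratic relation between functions `y i` with `d (y i) = d t / (t - c i)` is trivial. -/
theorem eq_zero_of_log_relation {c : σ → ℂ} (hc : Function.Injective c) {t : ℂ → ℂ}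
    {y : σ → ℂ → ℂ} (ht : AnalyticAt ℂ t 0) (ht' : deriv t 0 ≠ 0)
    (hne : ∀ᶠ s in 𝓝 (0 : ℂ), ∀ i, t s ≠ c i)
    (hy : ∀ᶠ s in 𝓝 (0 : ℂ), ∀ i, HasDerivAt (y i) (deriv t s / (t s - c i)) s)
    {M : σ → σ → ℂ} {a : σ → ℂ}
    (h : ∀ᶠ s in 𝓝 (0 : ℂ), ∑ j, (∑ i, M i j * y i s + a j) / (t s - c j) = 0) :
    (∀ i j, M i j = 0) ∧ ∀ j, a j = 0 := by
  have hD : ∀ᶠ s in 𝓝 (0 : ℂ), ∑ i, (∑ j, C (M i j) * cofactor c j).eval (t s) * y i s =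
      -(∑ j, C (a j) * cofactor c j).eval (t s) := by
    filter_upwards [h, hne] with s h hne
    have h₃ : ∀ j, (∏ k, (X - C (c k))).eval (t s) / (t s - c j) = (cofactor c j).eval (t s) :=
      fun j => by
        rw [div_eq_iff (sub_ne_zero.2 (hne j)), ← mul_cofactor c j]
        simp [mul_comm]
    rw [← sub_eq_zero, sub_neg_eq_add, ← mul_zero ((∏ k, (X - C (c k))).eval (t s)), ← h,
      Finset.mul_sum]
    simp only [eval_finsetSum, eval_mul, eval_C, Finset.sum_mul]
    rw [Finset.sum_comm, ← Finset.sum_add_distrib]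
    refine Finset.sum_congr rfl fun j _ => ?_
    rw [← h₃, add_div, mul_add, Finset.sum_div, Finset.mul_sum]
    congr 1
    · refine Finset.sum_congr rfl fun i _ => ?_
      ring
    · ring
  have hP := eq_zero_of_sum_eval_mul_log hc ht ht' hne hy
    (Finset.univ.sup fun i => (∑ j, C (M i j) * cofactor c j).natDegree)
    (fun i => ∑ j, C (M i j) * cofactor c j) (-∑ j, C (a j) * cofactor c j) 0
    (fun i => Finset.le_sup (f := fun i => (∑ j, C (M i j) * cofactor c j).natDegree)
      (Finset.mem_univ i))
    (hD.mono fun s hs => by rw [pow_zero, mul_one, hs, eval_neg])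
  refine ⟨fun i => eq_zero_of_sum_cofactor_eq_zero hc fun j => by rw [hP i, eval_zero], ?_⟩
  have hN : ∑ j, C (a j) * cofactor c j = 0 := by
    refine eq_zero_of_eventually_eval ht ht' (hD.mono fun s hs => ?_)
    rw [← neg_eq_zero, ← hs]
    exact Finset.sum_eq_zero fun i _ => by rw [hP i, eval_zero, zero_mul]
  exact eq_zero_of_sum_cofactor_eq_zero hc fun j => by rw [hN, eval_zero]

end Logarithms

/-! ### Quadratic relations between functions constant along a foliation -/

/-- The pairs `(M, a)` of a matrix with zero diagonal, and zero sums of rows and columns, and of a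
vector with zero sum. -/
def netRelations (r : ℕ) : Submodule ℂ ((Fin r → Fin r → ℂ) × (Fin r → ℂ)) where
  carrier := {x | (∀ i, x.1 i i = 0) ∧ (∀ i, ∑ j, x.1 i j = 0) ∧ (∀ j, ∑ i, x.1 i j = 0) ∧
    ∑ j, x.2 j = 0}
  zero_mem' := by simp
  add_mem' := by
    rintro x y ⟨h₁, h₂, h₃, h₄⟩ ⟨h₁', h₂', h₃', h₄'⟩
    refine ⟨fun i => ?_, fun i => ?_, fun j => ?_, ?_⟩ <;>
      simp [Finset.sum_add_distrib, *]
  smul_mem' := by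
    rintro c x ⟨h₁, h₂, h₃, h₄⟩
    refine ⟨fun i => ?_, fun i => ?_, fun j => ?_, ?_⟩ <;>
      simp [← Finset.mul_sum, *]

theorem le_rank_netRelations {r : ℕ} (hr : 0 < r) :
    ((r ^ 2 - 2 * r : ℕ) : Cardinal) ≤ Module.rank ℂ (netRelations r) := by
  -- the sum of the first column is determined by the sums of the rows and of the other columns
  let j₀ : Fin r := ⟨0, hr⟩
  let ψ : ((Fin r → Fin r → ℂ) × (Fin r → ℂ)) →ₗ[ℂ]
      (Fin r → ℂ) × (Fin r → ℂ) × (Fin r → ℂ) :=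
    { toFun := fun x => (fun i => x.1 i i, fun i => ∑ j, x.1 i j,
        fun j => if j = j₀ then ∑ k, x.2 k else ∑ i, x.1 i j)
      map_add' := fun x y => by
        refine Prod.ext (by ext; simp) (Prod.ext ?_ ?_)
        · ext; simp [Finset.sum_add_distrib]
        · ext j
          by_cases hj : j = j₀ <;> simp [hj, Finset.sum_add_distrib]
      map_smul' := fun c x => by
        refine Prod.ext (by ext; simp) (Prod.ext ?_ ?_)
        · ext; simp [Finset.mul_sum]
        · ext j
          by_cases hj : j = j₀ <;> simp [hj, Finset.mul_sum] }
  have hker : LinearMap.ker ψ ≤ netRelations r := by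
    intro x hx
    have hx' : ψ x = 0 := hx
    have h₁ : ∀ i, x.1 i i = 0 := fun i => congrFun (congrArg Prod.fst hx') i
    have h₂ : ∀ i, ∑ j, x.1 i j = 0 := fun i => congrFun (congrArg (fun z => z.2.1) hx') i
    have h₃ : ∀ j, (if j = j₀ then ∑ k, x.2 k else ∑ i, x.1 i j) = 0 := fun j =>
      congrFun (congrArg (fun z => z.2.2) hx') j
    have h₄ : ∀ j, j ≠ j₀ → ∑ i, x.1 i j = 0 := fun j hj => by simpa [hj] using h₃ j
    refine ⟨h₁, h₂, fun j => ?_, by simpa using h₃ j₀⟩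
    by_cases hj : j = j₀
    · have h₅ : ∑ j, ∑ i, x.1 i j = 0 := by
        rw [Finset.sum_comm]
        exact Finset.sum_eq_zero fun i _ => h₂ i
      rw [hj, ← h₅]
      exact (Finset.sum_eq_single j₀ (fun j _ hj => h₄ j hj) (by simp)).symm
    · exact h₄ j hj
  have h₁ := LinearMap.finrank_range_add_finrank_ker ψ
  have h₂ := Submodule.finrank_le (LinearMap.range ψ)
  have h₃ := Submodule.finrank_mono hker
  simp only [Module.finrank_prod, Module.finrank_pi_fintype, Module.finrank_self, Finset.sum_const,
    Finset.card_univ, Fintype.card_fin, smul_eq_mul, mul_one] at h₁ h₂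
  rw [← Module.finrank_eq_rank]
  have h₄ : r ^ 2 - 2 * r ≤ Module.finrank ℂ (netRelations r) := by
    rw [sq]
    omega
  exact_mod_cast h₄

section LogForm

variable {r : ℕ}

/-- The form `∑ i j, M i j * w i * d (w j) + ∑ j, a j * d (w j)`. -/
def logForm (x : (Fin r → Fin r → ℂ) × (Fin r → ℂ)) (w : Fin r → Plane → ℂ) : Form :=
  fun v => ∑ j, (∑ i, x.1 i j * w i v + x.2 j) • fderiv ℂ (w j) v

theorem analyticAt_logForm {q : Plane} {w : Fin r → Plane → ℂ} (hw : ∀ i, AnalyticAt ℂ (w i) q)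
    (x : (Fin r → Fin r → ℂ) × (Fin r → ℂ)) : AnalyticAt ℂ (logForm x w) q := by
  refine Finset.analyticAt_fun_sum _ fun j _ => AnalyticAt.fun_smul ?_ (hw j).fderiv
  refine AnalyticAt.fun_add (Finset.analyticAt_fun_sum _ fun i _ => ?_) analyticAt_const
  exact analyticAt_const.fun_mul (hw i)

theorem wedge_logForm {x : (Fin r → Fin r → ℂ) × (Fin r → ℂ)} (hx : x ∈ netRelations r)
    {w : Fin r → Plane → ℂ} {α : Plane →L[ℂ] ℂ} {v : Plane}
    (hd : ∀ i j, wedge (fderiv ℂ (w i) v - fderiv ℂ (w j) v) α = 0) :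
    wedge (logForm x w v) α = 0 := by
  obtain ⟨-, h₂, -, h₄⟩ := hx
  rcases isEmpty_or_nonempty (Fin r) with hr | ⟨⟨j₀⟩⟩
  · simp [logForm, wedge]
  have hd' : ∀ j, fderiv ℂ (w j) v (kerVec α) = fderiv ℂ (w j₀) v (kerVec α) := fun j => by
    have h := hd j j₀
    rw [wedge_comm, ← apply_kerVec, neg_eq_zero, sub_apply, sub_eq_zero] at h
    exact h
  rw [wedge_comm, ← apply_kerVec, logForm, sum_apply, neg_eq_zero]
  simp only [smul_apply, smul_eq_mul, hd']
  rw [← Finset.sum_mul, Finset.sum_add_distrib, h₄, Finset.sum_comm]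
  simp only [← Finset.sum_mul, h₂]
  simp

theorem isClosedAt_logForm {x : (Fin r → Fin r → ℂ) × (Fin r → ℂ)} (hx : x ∈ netRelations r)
    {w : Fin r → Plane → ℂ} {α : Plane →L[ℂ] ℂ} (hα : α ≠ 0) {v : Plane}
    (hw : ∀ i, AnalyticAt ℂ (w i) v)
    (hd : ∀ i j, wedge (fderiv ℂ (w i) v - fderiv ℂ (w j) v) α = 0) :
    IsClosedAt (logForm x w) v := by
  obtain ⟨-, h₂, h₃, -⟩ := hx
  rcases isEmpty_or_nonempty (Fin r) with hr | ⟨⟨j₀⟩⟩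
  · intro u u'
    have : logForm x w = fun _ => 0 := by
      funext v
      simp [logForm]
    rw [this]
    simp
  have hξ : ∀ j, ∃ ξ : ℂ, ∀ u, fderiv ℂ (w j) v u = fderiv ℂ (w j₀) v u + ξ * α u := fun j => by
    obtain ⟨ξ, hξ⟩ := exists_eq_smul_of_wedge_eq_zero hα
      (by rw [wedge_comm, hd j j₀, neg_zero] : wedge α (fderiv ℂ (w j) v - fderiv ℂ (w j₀) v) = 0)
    refine ⟨ξ, fun u => ?_⟩
    have := DFunLike.congr_fun hξ u
    rw [sub_apply, smul_apply, smul_eq_mul] at this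
    linear_combination this
  choose ξ hξ using hξ
  have hB : ∀ u u', ∑ j, (∑ i, x.1 i j * fderiv ℂ (w i) v u) * fderiv ℂ (w j) v u' =
      (∑ j, (∑ i, x.1 i j * ξ i) * ξ j) * (α u * α u') := by
    intro u u'
    have e₁ : ∀ j, ∑ i, x.1 i j * fderiv ℂ (w i) v u = (∑ i, x.1 i j * ξ i) * α u := fun j => by
      have e : ∀ i, x.1 i j * fderiv ℂ (w i) v u =
          x.1 i j * fderiv ℂ (w j₀) v u + x.1 i j * ξ i * α u := fun i => by rw [hξ i u]; ring
      rw [Finset.sum_congr rfl fun i _ => e i, Finset.sum_add_distrib, ← Finset.sum_mul,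
        ← Finset.sum_mul, h₃, zero_mul, zero_add]
    have e₂ : ∑ j, ∑ i, x.1 i j * ξ i = 0 := by
      rw [Finset.sum_comm]
      simp only [← Finset.sum_mul, h₂, zero_mul, Finset.sum_const_zero]
    have e₃ : ∀ j, (∑ i, x.1 i j * fderiv ℂ (w i) v u) * fderiv ℂ (w j) v u' =
        (∑ i, x.1 i j * ξ i) * (α u * fderiv ℂ (w j₀) v u') +
          (∑ i, x.1 i j * ξ i) * ξ j * (α u * α u') := fun j => by rw [e₁, hξ j u']; ring
    rw [Finset.sum_congr rfl fun j _ => e₃ j, Finset.sum_add_distrib, ← Finset.sum_mul,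
      ← Finset.sum_mul, e₂, zero_mul, zero_add]
  have hd₁ : ∀ j, HasFDerivAt (fun v => ∑ i, x.1 i j * w i v + x.2 j)
      (∑ i, x.1 i j • fderiv ℂ (w i) v) v := fun j =>
    (HasFDerivAt.fun_sum fun i _ =>
      (hw i).differentiableAt.hasFDerivAt.const_mul (x.1 i j)).add_const _
  have hd₂ : HasFDerivAt (logForm x w) _ v := HasFDerivAt.fun_sum fun j (_ : j ∈ Finset.univ) =>
    (hd₁ j).fun_smul (hw j).fderiv.differentiableAt.hasFDerivAt
  intro u u'
  rw [hd₂.fderiv]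
  simp only [sum_apply, add_apply, smul_apply, ContinuousLinearMap.smulRight_apply, smul_eq_mul,
    Finset.sum_add_distrib]
  rw [hB u u', hB u' u, mul_comm (α u)]
  congr 1
  refine Finset.sum_congr rfl fun j _ => ?_
  have hsymm : IsSymmSndFDerivAt ℂ (w j) v :=
    (hw j).contDiffAt.isSymmSndFDerivAt_of_omega
  rw [hsymm.eq u u']

end LogForm

/-! ### Abelian relations of the web of a net -/

namespace Net

variable {r m : ℕ} {ι : Type} {κ : Fin r → Type} [Fintype ι] [∀ i, Fintype (κ i)]
  (N : Net r m ι κ)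

/-- The logarithm of the equation of the line `k` of the class `i`, normalized at `q`. -/
def logLine (c : Fin 3) (q : Plane) (i : Fin r) (k : κ i) : Plane → ℂ :=
  fun v => Complex.log ((N.ln i k ⬝ᵥ chart c v) / (N.ln i k ⬝ᵥ chart c q))

/-- The logarithm of the equation of the class `i`, normalized at `q`. -/
def logClass (c : Fin 3) (q : Plane) (i : Fin r) : Plane → ℂ :=
  fun v => ∑ k, N.logLine c q i k v

/-- The points `v` near `q` where the principal branch of the logarithm is holomorphic on the
normalized equations of the lines. -/
def IsNear (c : Fin 3) (q v : Plane) : Prop :=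
  ∀ i k, (N.ln i k ⬝ᵥ chart c v) / (N.ln i k ⬝ᵥ chart c q) ∈ Complex.slitPlane

variable {N} {c : Fin 3} {q v : Plane}

theorem IsNear.ne_zero (h : N.IsNear c q v) (i : Fin r) (k : κ i) : N.ln i k ⬝ᵥ chart c v ≠ 0 :=
  fun h0 => Complex.slitPlane_ne_zero (h i k) (by rw [h0, zero_div])

theorem IsNear.f_ne_zero (h : N.IsNear c q v) (i : Fin r) : N.f i (chart c v) ≠ 0 :=
  Finset.prod_ne_zero_iff.2 fun k _ => h.ne_zero i k

theorem eventually_isNear (h : ∀ i k, N.ln i k ⬝ᵥ chart c q ≠ 0) :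
    ∀ᶠ v in 𝓝 q, N.IsNear c q v := by
  refine eventually_all.2 fun i => eventually_all.2 fun k => ?_
  have hc : ContinuousAt (fun v => (N.ln i k ⬝ᵥ chart c v) / (N.ln i k ⬝ᵥ chart c q)) q :=
    (hasFDerivAt_dotProduct_chart (N.ln i k) c q).continuousAt.div_const _
  refine hc.eventually (Complex.isOpen_slitPlane.mem_nhds ?_)
  change _ / _ ∈ _
  rw [div_self (h i k)]
  exact Complex.one_mem_slitPlane

theorem analyticAt_logLine (h : N.IsNear c q v) (i : Fin r) (k : κ i) :
    AnalyticAt ℂ (N.logLine c q i k) v := by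
  refine AnalyticAt.clog ?_ (h i k)
  refine AnalyticAt.fun_div ?_ analyticAt_const (fun h0 => ?_)
  · exact ((dotProductBilin ℂ ℂ (N.ln i k)).toContinuousLinearMap.analyticAt _).comp
      (analyticAt_chart c v)
  · exact Complex.slitPlane_ne_zero (h i k) (by rw [h0, div_zero])

theorem fderiv_logLine (h : N.IsNear c q v) (i : Fin r) (k : κ i) (u : Plane) :
    fderiv ℂ (N.logLine c q i k) v u =
      (N.ln i k ⬝ᵥ chartDir c u) / (N.ln i k ⬝ᵥ chart c v) := by
  have h0 : N.ln i k ⬝ᵥ chart c q ≠ 0 := fun h0 =>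
    Complex.slitPlane_ne_zero (h i k) (by rw [h0, div_zero])
  have h₁ := ((hasFDerivAt_dotProduct_chart (N.ln i k) c v).mul_const
    (N.ln i k ⬝ᵥ chart c q)⁻¹).clog (h i k)
  have h₂ : fderiv ℂ (N.logLine c q i k) v = _ := h₁.fderiv
  have h₃ := fderiv_dotProduct_chart (N.ln i k) c v u
  rw [(hasFDerivAt_dotProduct_chart (N.ln i k) c v).fderiv] at h₃
  rw [h₂, smul_apply, smul_apply, h₃, smul_eq_mul, smul_eq_mul]
  have := h.ne_zero i k
  field_simp

theorem analyticAt_logClass (h : N.IsNear c q v) (i : Fin r) :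
    AnalyticAt ℂ (N.logClass c q i) v :=
  Finset.analyticAt_fun_sum _ fun k _ => analyticAt_logLine h i k

theorem fderiv_logClass (h : N.IsNear c q v) (i : Fin r) :
    fderiv ℂ (N.logClass c q i) v = ∑ k, fderiv ℂ (N.logLine c q i k) v :=
  fderiv_fun_sum fun k _ => (analyticAt_logLine h i k).differentiableAt

theorem fderiv_logClass_apply (h : N.IsNear c q v) (i : Fin r) (u : Plane) :
    fderiv ℂ (N.logClass c q i) v u =
      fderiv ℂ (N.f i) (chart c v) (chartDir c u) / N.f i (chart c v) := by
  classical
  have h₁ := hasDerivAt_comp_line (g := N.f i) (v := chart c v) (u := chartDir c u) (s := 0)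
    (N.f_analyticAt i _).differentiableAt
  rw [zero_smul, add_zero] at h₁
  have h₂ : ∀ k', HasDerivAt (fun t : ℂ => N.ln i k' ⬝ᵥ (chart c v + t • chartDir c u))
      (N.ln i k' ⬝ᵥ chartDir c u) 0 := by
    intro k'
    simp only [dotProduct_add, dotProduct_smul, smul_eq_mul]
    simpa using ((hasDerivAt_id (0 : ℂ)).mul_const (N.ln i k' ⬝ᵥ chartDir c u)).const_add
      (N.ln i k' ⬝ᵥ chart c v)
  have h₃ := h₁.unique (HasDerivAt.fun_finsetProd (u := Finset.univ) fun k' _ => h₂ k')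
  rw [h₃, fderiv_logClass h, sum_apply, eq_div_iff (h.f_ne_zero i), Finset.sum_mul]
  refine Finset.sum_congr rfl fun k _ => ?_
  rw [fderiv_logLine h, LineNet.f, ← Finset.mul_prod_erase Finset.univ _ (Finset.mem_univ k)]
  simp only [zero_smul, add_zero, smul_eq_mul]
  have := h.ne_zero i k
  field_simp

/-- The quotient of the equations of two lines through a point of the net is constant along the
lines through this point. -/
theorem wedge_logLine (h : N.IsNear c q v) (p : ι) (i j : Fin r) :
    wedge (fderiv ℂ (N.logLine c q i (N.inc i p)) v - fderiv ℂ (N.logLine c q j (N.inc j p)) v)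
      (N.web c (some p) v) = 0 := by
  obtain ⟨s, hs⟩ : ∃ s : ℂ, crossProduct (N.ln i (N.inc i p)) (N.ln j (N.inc j p)) = s • N.pt p := by
    refine exists_eq_smul_of_cross_eq_zero (N.pt_ne_zero p) ?_
    have hi := N.ln_dot_pt i p
    have hj := N.ln_dot_pt j p
    set l := N.ln i (N.inc i p)
    set l' := N.ln j (N.inc j p)
    rw [dot_eq] at hi hj
    ext k
    fin_cases k <;> simp [cross_apply]
    · linear_combination (l 0) * hj - (l' 0) * hi
    · linear_combination (l 1) * hj - (l' 1) * hi
    · linear_combination (l 2) * hj - (l' 2) * hi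
  have hli := h.ne_zero i (N.inc i p)
  have hlj := h.ne_zero j (N.inc j p)
  have key : ∀ u, (fderiv ℂ (N.logLine c q i (N.inc i p)) v -
      fderiv ℂ (N.logLine c q j (N.inc j p)) v) u =
      -s / ((N.ln i (N.inc i p) ⬝ᵥ chart c v) * (N.ln j (N.inc j p) ⬝ᵥ chart c v)) *
        N.web c (some p) v u := by
    intro u
    change _ = _ * radial _ _ _ _
    rw [sub_apply, fderiv_logLine h, fderiv_logLine h, radial_apply]
    have h₁ : s * (N.pt p ⬝ᵥ crossProduct (chart c v) (chartDir c u)) =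
        crossProduct (N.ln i (N.inc i p)) (N.ln j (N.inc j p)) ⬝ᵥ
          crossProduct (chart c v) (chartDir c u) := by
      rw [hs, smul_dotProduct, smul_eq_mul]
    rw [div_mul_eq_mul_div, neg_mul, h₁, cross_dot_cross]
    field_simp
    ring
  simp only [wedge, key]
  ring

/-- The quotient of the equations of two classes is constant along the pencil of curves. -/
theorem wedge_logClass (h : N.IsNear c q v) (i j : Fin r) :
    wedge (fderiv ℂ (N.logClass c q i) v - fderiv ℂ (N.logClass c q j) v) (N.web c none v) = 0 := by
  have hi := h.f_ne_zero i
  have hj := h.f_ne_zero j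
  have key : ∀ u, (fderiv ℂ (N.logClass c q i) v - fderiv ℂ (N.logClass c q j) v) u =
      (N.a i * N.b j - N.a j * N.b i) / (N.f i (chart c v) * N.f j (chart c v)) *
        N.web c none v u := by
    intro u
    rw [sub_apply, fderiv_logClass_apply h, fderiv_logClass_apply h, div_mul_eq_mul_div,
      N.value_mul_web_none]
    field_simp
  simp only [wedge, key]
  ring

/-- Sums over the points of the net of products of functions of two of the lines through the point
are products of sums, since two lines of distinct classes meet in exactly one point. -/
theorem sum_logForm (h : N.IsNear c q v) {x : (Fin r → Fin r → ℂ) × (Fin r → ℂ)}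
    (hx : x ∈ netRelations r) :
    ∑ p, logForm (x.1, (m : ℂ)⁻¹ • x.2) (fun j => N.logLine c q j (N.inc j p)) v =
      logForm x (N.logClass c q) v := by
  classical
  have hm : (m : ℂ) ≠ 0 := Nat.cast_ne_zero.2 (by have := N.two_le; omega)
  have hprod : ∀ i j, i ≠ j → ∀ (g : κ i → ℂ) (g' : κ j → ℂ),
      ∑ p, g (N.inc i p) * g' (N.inc j p) = (∑ k, g k) * ∑ k, g' k := by
    intro i j hij g g'
    rw [Fintype.sum_bijective _ (N.bijective i j hij) (fun p => g (N.inc i p) * g' (N.inc j p))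
      (fun z => g z.1 * g' z.2) (fun _ => rfl), Fintype.sum_prod_type, Finset.sum_mul]
    simp only [Finset.mul_sum]
  have hsum : ∀ j, ∀ g' : κ j → ℂ, ∑ p, (m : ℂ)⁻¹ * g' (N.inc j p) = ∑ k, g' k := by
    intro j g'
    obtain ⟨i, hi⟩ := N.exists_class_ne j
    rw [hprod i j hi (fun _ => (m : ℂ)⁻¹) g', Finset.sum_const, Finset.card_univ, N.card_eq,
      nsmul_eq_mul, mul_inv_cancel₀ hm, one_mul]
  ext u
  simp only [logForm, Pi.smul_apply, smul_eq_mul, sum_apply, smul_apply, fderiv_logClass h]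
  rw [Finset.sum_comm]
  refine Finset.sum_congr rfl fun j _ => ?_
  simp only [add_mul, Finset.sum_add_distrib]
  congr 1
  · simp only [Finset.sum_mul]
    rw [Finset.sum_comm]
    refine Finset.sum_congr rfl fun i _ => ?_
    by_cases hij : i = j
    · subst hij
      simp [hx.1 i]
    · simp only [mul_assoc]
      rw [← Finset.mul_sum, hprod i j hij (fun k => N.logLine c q i k v)
        (fun k => fderiv ℂ (N.logLine c q j k) v u)]
      rfl
  · rw [← hsum j fun k => fderiv ℂ (N.logLine c q j k) v u, Finset.mul_sum]
    refine Finset.sum_congr rfl fun p _ => ?_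
    ring

/-- A combination of the logarithms of the classes that gives the zero form is trivial: these
logarithms are, up to a common function, logarithms of linear functions of a parameter of
the pencil of curves. -/
theorem eq_zero_of_logForm_eq_zero (hq : ∀ i k, N.ln i k ⬝ᵥ chart c q ≠ 0)
    (hweb : ∃ᶠ v in 𝓝 q, N.web c none v ≠ 0) {x : (Fin r → Fin r → ℂ) × (Fin r → ℂ)}
    (hx : x ∈ netRelations r) (h : ∀ᶠ v in 𝓝 q, logForm x (N.logClass c q) v = 0) : x = 0 := by
  classical
  obtain ⟨q', hq', hnear, hrel⟩ := (hweb.and_eventually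
    ((eventually_isNear hq).eventually_nhds.and h.eventually_nhds)).exists
  obtain ⟨e, he⟩ := exists_apply_eq_one hq'
  have h3 := N.three_le
  let i₀ : Fin r := ⟨0, by omega⟩
  let i₁ : Fin r := ⟨1, by omega⟩
  have h01 : i₀ ≠ i₁ := by simp [i₀, i₁]
  obtain ⟨hx₁, hx₂, hx₃, hx₄⟩ := hx
  set W : ℂ := N.a i₀ * N.b i₁ - N.a i₁ * N.b i₀ with hW
  have hW0 : W ≠ 0 := sub_ne_zero.2 (N.value_ne i₀ i₁ h01)
  let σ := {i : Fin r // i ≠ i₀}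
  let μ : σ → ℂ := fun i => N.a i * N.b i₁ - N.a i₁ * N.b i
  let ν : σ → ℂ := fun i => N.a i₀ * N.b i - N.a i * N.b i₀
  have hν : ∀ i, ν i ≠ 0 := fun i => sub_ne_zero.2 (N.value_ne i₀ i i.2.symm)
  have hf : ∀ i : σ, ∀ y, W * N.f i y = μ i * N.f i₀ y + ν i * N.f i₁ y := fun i y => by
    simp only [LineNet.f, ← N.fibre, hW, μ, ν]
    ring
  let c' : σ → ℂ := fun i => -μ i / ν i
  have hc' : Function.Injective c' := by
    intro i j hij
    by_contra hne
    have h₁ := (div_eq_div_iff (hν i) (hν j)).1 hij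
    have h₂ : W * (N.a i * N.b j - N.a j * N.b i) = 0 := by
      simp only [μ, ν] at h₁
      rw [hW]
      linear_combination -h₁
    exact N.value_ne i j (fun h => hne (Subtype.ext h))
      (sub_eq_zero.1 ((mul_eq_zero.1 h₂).resolve_left hW0))
  let γ : ℂ → Plane := fun s => q' + s • e
  have hγ : Tendsto γ (𝓝 0) (𝓝 q') := by
    simpa [γ] using (by fun_prop : Continuous γ).tendsto 0
  -- the parameter of the pencil of curves
  let t : ℂ → ℂ := fun s => N.f i₁ (chart c (γ s)) / N.f i₀ (chart c (γ s))
  let y : σ → ℂ → ℂ := fun i s => N.logClass c q i (γ s) - N.logClass c q i₀ (γ s)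
  have hfγ : ∀ i s, HasDerivAt (fun s => N.f i (chart c (γ s)))
      (fderiv ℂ (N.f i) (chart c (γ s)) (chartDir c e)) s := fun i s => by
    have := hasDerivAt_comp_line (g := fun v => N.f i (chart c v)) (v := q') (u := e) (s := s)
      ((N.f_analyticAt i _).comp (analyticAt_chart c _)).differentiableAt
    rw [fderiv_comp_chart (N.f_analyticAt i _)] at this
    exact this
  have htder : ∀ s, N.IsNear c q (γ s) → HasDerivAt t
      ((fderiv ℂ (N.f i₁) (chart c (γ s)) (chartDir c e) * N.f i₀ (chart c (γ s)) -
        N.f i₁ (chart c (γ s)) * fderiv ℂ (N.f i₀) (chart c (γ s)) (chartDir c e)) /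
        N.f i₀ (chart c (γ s)) ^ 2) s := fun s hs =>
    (hfγ i₁ s).fun_div (hfγ i₀ s) (hs.f_ne_zero i₀)
  have hnear0 : N.IsNear c q (γ 0) := by simpa [γ] using hnear.self_of_nhds
  have ht' : deriv t 0 ≠ 0 := by
    rw [(htder 0 hnear0).deriv]
    refine div_ne_zero ?_ (pow_ne_zero 2 (hnear0.f_ne_zero i₀))
    have h₁ := N.value_mul_web_none c (γ 0) i₁ i₀ e
    rw [show γ 0 = q' by simp [γ], he, mul_one] at h₁
    rw [show γ 0 = q' by simp [γ]]
    intro h₂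
    refine hW0 ?_
    linear_combination -h₁ - h₂
  have hγan : AnalyticAt ℂ (fun s => chart c (γ s)) 0 :=
    (analyticAt_chart c (γ 0)).fun_comp (by fun_prop)
  have ht : AnalyticAt ℂ t 0 :=
    AnalyticAt.fun_div ((N.f_analyticAt i₁ _).fun_comp hγan) ((N.f_analyticAt i₀ _).fun_comp hγan)
      (hnear0.f_ne_zero i₀)
  have htc : ∀ s, N.IsNear c q (γ s) → ∀ i : σ, t s - c' i =
      W * N.f i (chart c (γ s)) / (ν i * N.f i₀ (chart c (γ s))) := fun s hs i => by
    have h₀ := hs.f_ne_zero i₀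
    have h₁ := hν i
    rw [hf i]
    simp only [t, c']
    field_simp
    ring
  have hne : ∀ᶠ s in 𝓝 (0 : ℂ), ∀ i, t s ≠ c' i := by
    filter_upwards [hγ.eventually hnear] with s hs i
    rw [← sub_ne_zero, htc s hs]
    exact div_ne_zero (mul_ne_zero hW0 (hs.f_ne_zero i)) (mul_ne_zero (hν i) (hs.f_ne_zero i₀))
  have hydiff : ∀ s, N.IsNear c q (γ s) → ∀ i : σ, fderiv ℂ (N.logClass c q i) (γ s) e -
      fderiv ℂ (N.logClass c q i₀) (γ s) e = deriv t s / (t s - c' i) := fun s hs i => by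
    rw [fderiv_logClass_apply hs, fderiv_logClass_apply hs, (htder s hs).deriv, htc s hs]
    have h₀ := hs.f_ne_zero i₀
    have h₁ := hν i
    have h₂ := hs.f_ne_zero i
    have h₃ : W * fderiv ℂ (N.f i) (chart c (γ s)) (chartDir c e) =
        μ i * fderiv ℂ (N.f i₀) (chart c (γ s)) (chartDir c e) +
          ν i * fderiv ℂ (N.f i₁) (chart c (γ s)) (chartDir c e) := by
      refine ((hfγ i s).const_mul W).unique ((((hfγ i₀ s).const_mul (μ i)).fun_add
        ((hfγ i₁ s).const_mul (ν i))).congr_of_eventuallyEq (.of_forall fun s => hf i _))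
    have h₄ := hf i (chart c (γ s))
    field_simp
    linear_combination N.f i₀ (chart c (γ s)) * h₃ -
      fderiv ℂ (N.f i₀) (chart c (γ s)) (chartDir c e) * h₄
  have hy : ∀ᶠ s in 𝓝 (0 : ℂ), ∀ i, HasDerivAt (y i) (deriv t s / (t s - c' i)) s := by
    filter_upwards [hγ.eventually hnear] with s hs i
    rw [← hydiff s hs]
    exact (hasDerivAt_comp_line (analyticAt_logClass hs i).differentiableAt).fun_sub
      (hasDerivAt_comp_line (analyticAt_logClass hs i₀).differentiableAt)
  have hlog := eq_zero_of_log_relation hc' ht ht' hne hy (M := fun i j => x.1 i j)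
    (a := fun j => x.2 j) (by
      filter_upwards [hγ.eventually hnear, hγ.eventually hrel,
        ht.deriv.continuousAt.eventually_ne ht'] with s hs hrel hts
      refine mul_left_cancel₀ hts ?_
      have h₁ := DFunLike.congr_fun hrel e
      rw [logForm, sum_apply, zero_apply] at h₁
      simp only [smul_apply, smul_eq_mul] at h₁
      have h₂ : ∀ j, ∑ i, x.1 i j * N.logClass c q i (γ s) =
          ∑ i : σ, x.1 i j * y i s := fun j => by
        have e₁ : ∑ i, x.1 i j * N.logClass c q i (γ s) = ∑ i, x.1 i j *
            (N.logClass c q i (γ s) - N.logClass c q i₀ (γ s)) := by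
          simp only [mul_sub, Finset.sum_sub_distrib, ← Finset.sum_mul, hx₃, zero_mul, sub_zero]
        rw [e₁, ← Finset.add_sum_erase _ _ (Finset.mem_univ i₀), sub_self, mul_zero, zero_add]
        exact Finset.sum_subtype _ (by simp) _
      have h₃ : ∑ j, (∑ i : σ, x.1 i j * y i s + x.2 j) = 0 := by
        rw [Finset.sum_add_distrib, hx₄, Finset.sum_comm]
        simp only [← Finset.sum_mul, hx₂, zero_mul, Finset.sum_const_zero, add_zero]
      simp only [h₂] at h₁
      have h₄ : ∑ j, (∑ i : σ, x.1 i j * y i s + x.2 j) *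
          (fderiv ℂ (N.logClass c q j) (γ s) e - fderiv ℂ (N.logClass c q i₀) (γ s) e) = 0 := by
        simp only [mul_sub, Finset.sum_sub_distrib, ← Finset.sum_mul, h₁, h₃, zero_mul, sub_zero]
      rw [← Finset.add_sum_erase _ _ (Finset.mem_univ i₀), sub_self, mul_zero, zero_add,
        Finset.sum_subtype _ (p := fun j => j ≠ i₀) (by simp) _] at h₄
      rw [mul_zero, ← h₄, Finset.mul_sum]
      refine Finset.sum_congr rfl fun j _ => ?_
      rw [hydiff s hs]
      ring)
  obtain ⟨hM, ha⟩ := hlog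
  -- the remaining entries are determined by the zero sums
  have hM₁ : ∀ i j, j ≠ i₀ → x.1 i j = 0 := fun i j hj => by
    by_cases hi : i = i₀
    · have := hx₃ j
      rw [← Finset.add_sum_erase _ _ (Finset.mem_univ i₀), Finset.sum_eq_zero, add_zero] at this
      · rw [hi, this]
      · intro i' hi'
        exact hM ⟨i', Finset.ne_of_mem_erase hi'⟩ ⟨j, hj⟩
    · exact hM ⟨i, hi⟩ ⟨j, hj⟩
  have hM₂ : ∀ i, x.1 i i₀ = 0 := fun i => by
    have := hx₂ i
    rwa [← Finset.add_sum_erase _ _ (Finset.mem_univ i₀), Finset.sum_eq_zero, add_zero] at this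
    exact fun j hj => hM₁ i j (Finset.ne_of_mem_erase hj)
  have ha₂ : x.2 i₀ = 0 := by
    rwa [← Finset.add_sum_erase _ _ (Finset.mem_univ i₀), Finset.sum_eq_zero, add_zero] at hx₄
    exact fun j hj => ha ⟨j, Finset.ne_of_mem_erase hj⟩
  refine Prod.ext (funext fun i => funext fun j => ?_) (funext fun j => ?_)
  · by_cases hj : j = i₀
    · rw [hj]; exact hM₂ i
    · exact hM₁ i j hj
  · by_cases hj : j = i₀
    · rw [hj]; exact ha₂
    · exact ha ⟨j, hj⟩

end Net

namespace Net

variable {r m : ℕ} {ι : Type} {κ : Fin r → Type} [Fintype ι] [∀ i, Fintype (κ i)]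
  (N : Net r m ι κ)

/-- The abelian relations of the web of a net: to those of the pencils of lines one adds those
that involve the pencil of curves. -/
def relation (c : Fin 3) (q : Plane) :
    (MvPolynomial.homogeneousSubmodule (Fin 3) ℂ (Fintype.card ι - 3) × netRelations r) →ₗ[ℂ]
      (Option ι → Form) where
  toFun θ
    | some p => fun v => pencilRelation N.pt θ.1 c p v + logForm (θ.2.1.1, (m : ℂ)⁻¹ • θ.2.1.2)
        (fun j => N.logLine c q j (N.inc j p)) v
    | none => fun v => -logForm θ.2.1 (N.logClass c q) v
  map_add' θ θ' := by
    funext s v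
    cases s with
    | some p =>
      ext u
      simp [pencilRelation, pencilCoeff, logForm, Finset.sum_add_distrib, add_mul, add_div, mul_add]
      ring
    | none =>
      ext u
      simp [logForm, Finset.sum_add_distrib, add_mul]
      ring
  map_smul' a θ := by
    funext s v
    cases s with
    | some p =>
      ext u
      simp [pencilRelation, pencilCoeff, logForm, Finset.sum_add_distrib, Finset.mul_sum,
        Finset.sum_mul, add_mul, mul_add, mul_assoc, mul_div_assoc, mul_left_comm]
    | none =>
      ext u
      simp [logForm, Finset.sum_add_distrib, Finset.mul_sum, Finset.sum_mul, add_mul, mul_add,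
        mul_assoc]

variable {N} {c : Fin 3} {q : Plane} {ω : Option ι → Form}

theorem three_le_card (N : Net r m ι κ) : 3 ≤ Fintype.card ι := by
  rw [N.card_points]
  nlinarith [N.two_le]

theorem isAbelianRelationAt (h : DefinesNear (N.web c) ω q)
    (θ : MvPolynomial.homogeneousSubmodule (Fin 3) ℂ (Fintype.card ι - 3) × netRelations r) :
    IsAbelianRelationAt ω (N.relation c q θ) q := by
  have hnear := eventually_isNear (ln_dot_chart_ne_zero h)
  have hQ : (θ.1 : MvPolynomial (Fin 3) ℂ).IsHomogeneous (Fintype.card ι - 3) := θ.1.2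
  have hx := θ.2.2
  have hx' : (θ.2.1.1, (m : ℂ)⁻¹ • θ.2.1.2) ∈ netRelations r :=
    ⟨hx.1, hx.2.1, hx.2.2.1, by simp [← Finset.mul_sum, hx.2.2.2]⟩
  have hdet : ∀ᶠ v in 𝓝 q, ∀ p p', p ≠ p' →
      N.pt p ⬝ᵥ crossProduct (N.pt p') (chart c v) ≠ 0 := by
    refine eventually_all.2 fun p => eventually_all.2 fun p' => ?_
    by_cases hp : p = p'
    · exact .of_forall fun _ h => (h hp).elim
    · have hc : ContinuousAt (fun v => N.pt p ⬝ᵥ crossProduct (N.pt p') (chart c v)) q :=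
        ContinuousAt.comp (g := fun x => N.pt p ⬝ᵥ crossProduct (N.pt p') x)
          ((dotProductBilin ℂ ℂ (N.pt p) ∘ₗ crossProduct (N.pt p')).continuous_of_finiteDimensional
            |>.continuousAt) (analyticAt_chart c q).continuousAt
      exact (hc.eventually_ne (triple_pt_chart_ne_zero h hp)).mono fun v hv _ => hv
  have hrad : ∀ᶠ v in 𝓝 q, ∀ p, radial (N.pt p) c v ≠ 0 := eventually_all.2 fun p =>
    (radial_analyticAt _ _ _).continuousAt.eventually_ne (web_some_ne_zero h p)
  have hω : ∀ s, ∀ᶠ v in 𝓝 q, ω s v ≠ 0 := fun s =>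
    (h.regular.analytic s).continuousAt.eventually_ne (h.regular.ne_zero s)
  -- the differences of the logarithms are constant along the leaves
  have hline : ∀ p, ∀ᶠ v in 𝓝 q, ∀ i j, wedge (fderiv ℂ (N.logLine c q i (N.inc i p)) v -
      fderiv ℂ (N.logLine c q j (N.inc j p)) v) (ω (some p) v) = 0 := fun p =>
    eventually_all.2 fun i => eventually_all.2 fun j =>
      h.wedge_eq_zero_of_wedge_eq_zero (some p) (N.web_analyticAt c (some p) q)
        (((analyticAt_logLine hnear.self_of_nhds i _).fderiv).fun_sub
          (analyticAt_logLine hnear.self_of_nhds j _).fderiv)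
        (hnear.mono fun v hv => wedge_logLine hv p i j)
  have hclass : ∀ᶠ v in 𝓝 q, ∀ i j, wedge (fderiv ℂ (N.logClass c q i) v -
      fderiv ℂ (N.logClass c q j) v) (ω none v) = 0 :=
    eventually_all.2 fun i => eventually_all.2 fun j =>
      h.wedge_eq_zero_of_wedge_eq_zero none (N.web_analyticAt c none q)
        (((analyticAt_logClass hnear.self_of_nhds i).fderiv).fun_sub
          (analyticAt_logClass hnear.self_of_nhds j).fderiv)
        (hnear.mono fun v hv => wedge_logClass hv i j)
  have hanP : ∀ v, (∀ p p', p ≠ p' → N.pt p ⬝ᵥ crossProduct (N.pt p') (chart c v) ≠ 0) →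
      ∀ p, AnalyticAt ℂ (pencilRelation N.pt θ.1 c p) v := fun v hv p =>
    analyticAt_pencilRelation _ hv p
  have hanL : ∀ v, N.IsNear c q v → ∀ p, AnalyticAt ℂ (logForm (θ.2.1.1, (m : ℂ)⁻¹ • θ.2.1.2)
      (fun j => N.logLine c q j (N.inc j p))) v := fun v hv p =>
    analyticAt_logForm (fun j => analyticAt_logLine hv j _) _
  have hanC : ∀ v, N.IsNear c q v → AnalyticAt ℂ (logForm θ.2.1 (N.logClass c q)) v :=
    fun v hv => analyticAt_logForm (fun j => analyticAt_logClass hv j) _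
  refine ⟨fun s => ?_, fun s => ?_, fun s => ?_, ?_⟩
  · cases s with
    | some p => exact (hanP q hdet.self_of_nhds p).fun_add (hanL q hnear.self_of_nhds p)
    | none => exact (hanC q hnear.self_of_nhds).fun_neg
  · cases s with
    | some p =>
      filter_upwards [hnear, hdet, hline p, hω (some p)] with v h₁ h₂ h₃ h₄ u u'
      have e₁ := isClosedAt_pencilRelation N.three_le_card hQ h₂ p u u'
      have e₂ := isClosedAt_logForm hx' h₄ (fun j => analyticAt_logLine h₁ j (N.inc j p)) h₃ u u'
      have e₃ : fderiv ℂ (N.relation c q θ (some p)) v = _ :=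
        fderiv_fun_add (hanP v h₂ p).differentiableAt (hanL v h₁ p).differentiableAt
      rw [e₃, add_apply, add_apply, add_apply, add_apply, e₁, e₂]
    | none =>
      filter_upwards [hnear, hclass, hω none] with v h₁ h₃ h₄ u u'
      have e₂ := isClosedAt_logForm hx h₄ (fun j => analyticAt_logClass h₁ j) h₃ u u'
      have e₃ : fderiv ℂ (N.relation c q θ none) v = _ := fderiv_fun_neg
      rw [e₃, neg_apply, neg_apply, neg_apply, neg_apply, e₂]
  · cases s with
    | some p =>
      filter_upwards [hline p, h.wedge_eq_zero (some p)] with v h₃ h₄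
      have e₁ := wedge_logForm hx' h₃
      have e₂ : wedge (radial (N.pt p) c v) (ω (some p) v) = 0 := by
        rw [wedge_comm]
        exact neg_eq_zero.2 h₄
      change wedge (pencilCoeff N.pt θ.1 p _ • radial (N.pt p) c v + logForm _ _ v) _ = 0
      simp only [wedge, add_apply, smul_apply, smul_eq_mul] at e₁ e₂ ⊢
      linear_combination e₁ + pencilCoeff N.pt θ.1 p (crossProduct (N.pt p) (chart c v)) * e₂
    | none =>
      filter_upwards [hclass] with v h₃
      have e₁ := wedge_logForm hx h₃
      change wedge (-logForm _ _ v) _ = 0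
      simp only [wedge, neg_apply] at e₁ ⊢
      linear_combination -e₁
  · filter_upwards [hnear, hdet, hrad] with v h₁ h₂ h₃
    rw [Fintype.sum_option]
    change -logForm _ _ v + ∑ p, (pencilRelation N.pt θ.1 c p v + logForm _ _ v) = 0
    rw [Finset.sum_add_distrib, sum_pencilRelation N.three_le_card hQ h₂ h₃, zero_add,
      sum_logForm h₁ hx, neg_add_cancel]

/-- The abelian relations of the pencils of lines and of the net are independent: the
component along the pencil of curves determines the second ones. -/
theorem le_webRank (h : DefinesNear (N.web c) ω q) :
    (((m ^ 2 - 1) * (m ^ 2 - 2) / 2 + (r - 1) ^ 2 - 1 : ℕ) : Cardinal) ≤ webRank ω q := by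
  have h0 : ∀ θ, (∀ s, ∀ᶠ v in 𝓝 q, N.relation c q θ s v = 0) → θ = 0 := by
    rintro ⟨⟨Q, hQ⟩, ⟨x, hx⟩⟩ hθ
    have hx0 : x = 0 := eq_zero_of_logForm_eq_zero (ln_dot_chart_ne_zero h) (h.nontrivial none) hx
      ((hθ none).mono fun v hv => neg_eq_zero.1 hv)
    subst hx0
    have hQ0 : Q = 0 := eq_zero_of_pencilRelation_eq_zero N.three_le_card hQ
      (fun p p' hp => triple_pt_chart_ne_zero h hp) (fun p => cross_pt_chart_ne_zero h p)
      (fun p => (hθ (some p)).mono fun v hv => by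
        have h₁ : pencilRelation N.pt Q c p v + logForm ((0 : Fin r → Fin r → ℂ),
          (m : ℂ)⁻¹ • (0 : Fin r → ℂ)) (fun j => N.logLine c q j (N.inc j p)) v = 0 := hv
        have h₂ : logForm ((0 : Fin r → Fin r → ℂ),
            (m : ℂ)⁻¹ • (0 : Fin r → ℂ)) (fun j => N.logLine c q j (N.inc j p)) v = 0 := by
          ext u
          simp [logForm]
        rwa [h₂, add_zero] at h₁)
    subst hQ0
    rfl
  refine le_trans ?_ (rank_le_webRank (N.relation c q) (isAbelianRelationAt h) h0)
  rw [rank_prod', rank_homogeneousSubmodule]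
  have h3 := N.three_le
  refine le_trans ?_ (add_le_add_right (le_rank_netRelations (r := r) (by omega)) _)
  have hcard := N.three_le_card
  rw [N.card_points] at hcard ⊢
  rw [← Nat.cast_add, Nat.cast_le]
  have e₁ : m ^ 2 - 3 + 2 = m ^ 2 - 1 := by omega
  have e₂ : m ^ 2 - 3 + 1 = m ^ 2 - 2 := by omega
  have e₃ : (r - 1) ^ 2 = r ^ 2 - 2 * r + 1 := by
    obtain ⟨k, rfl⟩ : ∃ k, r = k + 2 := ⟨r - 2, by omega⟩
    have : (k + 2) ^ 2 = 2 * (k + 2) + (k ^ 2 + 2 * k) := by ring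
    rw [this, Nat.add_sub_cancel_left, show k + 2 - 1 = k + 1 by omega]
    ring
  rw [e₁, e₂, e₃]
  omega

/-- For `(3, 2)`-nets and `(4, 3)`-nets, the two bounds for the rank coincide. -/
theorem hasMaximalRank (h : DefinesNear (N.web c) ω q) (hrm : r = 3 ∧ m = 2 ∨ r = 4 ∧ m = 3) :
    HasMaximalRank ω q := by
  have h₁ := le_webRank h
  refine le_antisymm (webRank_le h.regular) ?_
  rw [Fintype.card_option, N.card_points]
  rcases hrm with ⟨hr, hm⟩ | ⟨hr, hm⟩ <;> rw [hr, hm] at h₁ <;> rw [hm]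
  · have e : castelnuovoNumber (2 ^ 2 + 1) = (2 ^ 2 - 1) * (2 ^ 2 - 2) / 2 + (3 - 1) ^ 2 - 1 := by
      decide
    rwa [e]
  · have e : castelnuovoNumber (3 ^ 2 + 1) = (3 ^ 2 - 1) * (3 ^ 2 - 2) / 2 + (4 - 1) ^ 2 - 1 := by
      decide
    rwa [e]

end Net

/-! ### The pencil of curves of a net -/

theorem isHomogeneous_linForm (a : Fin 3 → ℂ) : (linForm a).IsHomogeneous 1 :=
  MvPolynomial.IsHomogeneous.sum _ _ _ fun j _ => by
    simpa using (MvPolynomial.isHomogeneous_C (Fin 3) (a j)).mul (MvPolynomial.isHomogeneous_X ℂ j)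

theorem irreducible_linForm {a : Fin 3 → ℂ} (ha : a ≠ 0) : Irreducible (linForm a) := by
  refine MvPolynomial.irreducible_of_totalDegree_eq_one
    ((isHomogeneous_linForm a).totalDegree (linForm_ne_zero ha)) fun x hx => ?_
  refine IsUnit.mk0 x ?_
  rintro rfl
  refine linForm_ne_zero ha (MvPolynomial.ext _ _ fun d => ?_)
  rw [MvPolynomial.coeff_zero]
  exact zero_dvd_iff.1 (hx d)

/-- Equations of distinct lines are coprime. -/
theorem isRelPrime_linForm {a b : Fin 3 → ℂ} (h : crossProduct a b ≠ 0) :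
    IsRelPrime (linForm a) (linForm b) := by
  have ha : a ≠ 0 := fun h0 => h (by rw [h0, map_zero, LinearMap.zero_apply])
  refine (irreducible_linForm ha).isRelPrime_iff_not_dvd.2 fun ⟨g, hg⟩ => ?_
  refine h (dotProduct_eq_zero _ fun z => ?_)
  have h₁ : b ⬝ᵥ crossProduct z a = 0 := by
    rw [← eval_linForm, hg, map_mul, eval_linForm]
    have : a ⬝ᵥ crossProduct z a = 0 := by rw [triple_eq]; ring
    rw [this, zero_mul]
  rw [triple_eq] at h₁
  rw [dot_eq]
  simp [cross_apply]
  linear_combination h₁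

/-- The values of two linear forms that have the same zero on the line `l` are proportional on
this line. -/
theorem dot_mul_dot_eq {l a b p x y : Fin 3 → ℂ} (hl : l ≠ 0) (hp : p ≠ 0) (hlp : l ⬝ᵥ p = 0)
    (hap : a ⬝ᵥ p = 0) (hbp : b ⬝ᵥ p = 0) (hx : l ⬝ᵥ x = 0) (hy : l ⬝ᵥ y = 0) :
    (b ⬝ᵥ x) * (a ⬝ᵥ y) = (b ⬝ᵥ y) * (a ⬝ᵥ x) := by
  have h₁ : l ⬝ᵥ crossProduct a b = 0 := by
    refine triple_eq_zero_of_dot_eq_zero hp ?_ ?_ ?_ <;> rw [dotProduct_comm] <;> assumption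
  obtain ⟨s, hs⟩ : ∃ s : ℂ, crossProduct x y = s • l := by
    refine exists_eq_smul_of_cross_eq_zero hl ?_
    rw [dot_eq] at hx hy
    ext i
    fin_cases i <;> simp [cross_apply]
    · linear_combination (x 0) * hy - (y 0) * hx
    · linear_combination (x 1) * hy - (y 1) * hx
    · linear_combination (x 2) * hy - (y 2) * hx
  have h₂ : crossProduct x y ⬝ᵥ crossProduct a b = 0 := by
    rw [hs, smul_dotProduct, h₁, smul_zero]
  rw [cross_dot_cross] at h₂
  rw [dotProduct_comm b, dotProduct_comm a, dotProduct_comm b, dotProduct_comm a]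
  linear_combination -h₂

namespace LineNet

variable {r m : ℕ} {ι : Type} {κ : Fin r → Type} [Fintype ι] [∀ i, Fintype (κ i)]
  (N : LineNet r m ι κ)

/-- The product of the linear equations of the lines of the class `i`, as a polynomial. -/
def poly (i : Fin r) : MvPolynomial (Fin 3) ℂ := ∏ k, linForm (N.ln i k)

theorem eval_poly (i : Fin r) (x : Fin 3 → ℂ) : MvPolynomial.eval x (N.poly i) = N.f i x := by
  simp only [poly, map_prod, eval_linForm, f]

theorem isHomogeneous_poly (i : Fin r) : (N.poly i).IsHomogeneous m := by
  have := MvPolynomial.IsHomogeneous.prod Finset.univ (fun k => linForm (N.ln i k)) (fun _ => 1)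
    fun k _ => isHomogeneous_linForm (N.ln i k)
  simpa [poly, N.card_eq] using this

/-- A line of the class `i` and a line of another class `j` have no common point outside the net,
and through a point of the net passes only one line of the class `i`. -/
theorem f_cross_ne_zero {i j : Fin r} (hij : i ≠ j) {k k' : κ i} (hk : k ≠ k') :
    N.f j (crossProduct (N.ln i k) (N.ln i k')) ≠ 0 := by
  refine Finset.prod_ne_zero_iff.2 fun l _ h0 => ?_
  have h₁ : N.ln i k ⬝ᵥ crossProduct (N.ln i k) (N.ln i k') = 0 := dot_self_cross _ _
  have h₂ : N.ln i k' ⬝ᵥ crossProduct (N.ln i k) (N.ln i k') = 0 := dot_cross_self _ _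
  obtain ⟨p, hp, hp'⟩ := N.exists_inc_eq hij k l
  have h₃ : crossProduct (N.pt p) (crossProduct (N.ln i k) (N.ln i k')) = 0 := by
    refine cross_eq_zero_of_dot_eq_zero (N.cross_ln_ne_zero hij k l) ?_ ?_ ?_ ?_ <;>
      rw [dotProduct_comm]
    · exact (N.dot_eq_zero_iff i k p).2 hp
    · exact (N.dot_eq_zero_iff j l p).2 hp'
    · exact h₁
    · exact h0
  obtain ⟨s, hs⟩ := exists_eq_smul_of_cross_eq_zero (N.pt_ne_zero p) h₃
  have hs0 : s ≠ 0 := by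
    rintro rfl
    exact N.cross_ln_ne_zero' hk (by rw [hs, zero_smul])
  rw [hs, dotProduct_smul, smul_eq_mul, mul_eq_zero, N.dot_eq_zero_iff] at h₂
  exact hk (hp.symm.trans (h₂.resolve_left hs0))

/-- The products of the equations of two classes are proportional on the lines of another class,
since they have the same zeros there. -/
theorem f_mul_f_eq_on_line {i j₀ j₁ : Fin r} (h₀ : i ≠ j₀) (h₁ : i ≠ j₁) (k : κ i)
    {x y : Fin 3 → ℂ} (hx : N.ln i k ⬝ᵥ x = 0) (hy : N.ln i k ⬝ᵥ y = 0) :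
    N.f j₁ x * N.f j₀ y = N.f j₁ y * N.f j₀ x := by
  classical
  have hprod : ∀ j, i ≠ j → ∀ z, N.f j z =
      ∏ p ∈ Finset.univ.filter (fun p => N.inc i p = k), N.ln j (N.inc j p) ⬝ᵥ z := by
    intro j hj z
    refine (Finset.prod_bij (fun p _ => N.inc j p) (fun _ _ => Finset.mem_univ _) ?_ ?_
      fun _ _ => rfl).symm
    · intro p hp p' hp' hpp
      refine (N.bijective i j hj).1 (Prod.ext ?_ hpp)
      exact (Finset.mem_filter.1 hp).2.trans (Finset.mem_filter.1 hp').2.symm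
    · intro l _
      obtain ⟨p, hp, hp'⟩ := N.exists_inc_eq hj k l
      exact ⟨p, Finset.mem_filter.2 ⟨Finset.mem_univ p, hp⟩, hp'⟩
  rw [hprod j₁ h₁, hprod j₀ h₀, hprod j₁ h₁, hprod j₀ h₀, ← Finset.prod_mul_distrib,
    ← Finset.prod_mul_distrib]
  refine Finset.prod_congr rfl fun p hp => ?_
  exact dot_mul_dot_eq (N.ln_ne_zero i k) (N.pt_ne_zero p)
    ((N.dot_eq_zero_iff i k p).2 (Finset.mem_filter.1 hp).2) (N.ln_dot_pt j₀ p) (N.ln_dot_pt j₁ p)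
    hx hy

/-- All the classes belong to the pencil generated by two of them: a combination of two of the
equations vanishes on the `m` lines of the third class. -/
theorem exists_poly_eq {i₀ i₁ : Fin r} (h01 : i₀ ≠ i₁) (i : Fin r) :
    ∃ a b : ℂ, MvPolynomial.C b * N.poly i₀ - MvPolynomial.C a * N.poly i₁ = N.poly i := by
  by_cases hi₀ : i = i₀
  · exact ⟨0, 1, by simp [hi₀]⟩
  by_cases hi₁ : i = i₁
  · exact ⟨-1, 0, by simp [hi₁]⟩
  have : Nonempty (κ i₀) := Fintype.card_pos_iff.1 (by
    rw [N.card_eq]; exact zero_lt_two.trans_le N.two_le)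
  let k₀ : κ i₀ := Classical.arbitrary _
  obtain ⟨k₁, hk₁⟩ := N.exists_ne i₀ k₀
  let y := crossProduct (N.ln i₀ k₀) (N.ln i₀ k₁)
  let s := N.f i y / N.f i₁ y
  have hy : N.f i₁ y ≠ 0 := N.f_cross_ne_zero h01 hk₁.symm
  -- `f i - s * f i₁` vanishes on the line `k₀`, hence on the other lines of its class
  have hline₀ : ∀ x, N.ln i₀ k₀ ⬝ᵥ x = 0 → N.f i x = s * N.f i₁ x := fun x hx => by
    have := N.f_mul_f_eq_on_line h01 (Ne.symm hi₀) k₀ hx (dot_self_cross _ _ : _ ⬝ᵥ y = 0)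
    rw [div_mul_eq_mul_div, eq_div_iff hy, this]
  have hline : ∀ k x, N.ln i₀ k ⬝ᵥ x = 0 → N.f i x = s * N.f i₁ x := fun k x hx => by
    by_cases hk : k₀ = k
    · subst hk; exact hline₀ x hx
    have hne : N.f i₁ (crossProduct (N.ln i₀ k₀) (N.ln i₀ k)) ≠ 0 := N.f_cross_ne_zero h01 hk
    have h₁ := N.f_mul_f_eq_on_line h01 (Ne.symm hi₀) k hx
      (dot_cross_self (N.ln i₀ k₀) (N.ln i₀ k))
    rw [hline₀ _ (dot_self_cross _ _)] at h₁
    refine mul_right_cancel₀ hne ?_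
    linear_combination h₁
  obtain ⟨z, hz⟩ := exists_eval_ne_zero
    (Finset.prod_ne_zero_iff.2 fun k (_ : k ∈ Finset.univ) => linForm_ne_zero (N.ln_ne_zero i₀ k))
  rw [map_prod, Finset.prod_ne_zero_iff] at hz
  have hz : ∀ k, N.ln i₀ k ⬝ᵥ z ≠ 0 := fun k => by
    rw [← eval_linForm]; exact hz k (Finset.mem_univ k)
  have hfz : N.f i₀ z ≠ 0 := Finset.prod_ne_zero_iff.2 fun k _ => hz k
  let t := (N.f i z - s * N.f i₁ z) / N.f i₀ z
  refine ⟨-s, t, ?_⟩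
  have hC : ∀ (a : ℂ) j, (MvPolynomial.C a * N.poly j).IsHomogeneous m := fun a j => by
    simpa using (MvPolynomial.isHomogeneous_C (Fin 3) a).mul (N.isHomogeneous_poly j)
  refine sub_eq_zero.1 (eq_zero_of_vanishing (l := N.ln i₀) (d := m) (z := z)
    (fun k k' hk => N.cross_ln_ne_zero' hk)
    (((hC _ _).sub (hC _ _)).sub (N.isHomogeneous_poly i)) hz (.inr ⟨(N.card_eq i₀).symm, ?_⟩) ?_)
  · simp only [map_sub, map_mul, MvPolynomial.eval_C, eval_poly]
    have : t * N.f i₀ z = N.f i z - s * N.f i₁ z := div_mul_cancel₀ _ hfz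
    rw [this]
    ring
  · intro k x hx
    simp only [map_sub, map_mul, MvPolynomial.eval_C, eval_poly]
    have h₁ : N.f i₀ x = 0 := Finset.prod_eq_zero (Finset.mem_univ k) hx
    rw [h₁, hline k x hx]
    ring

theorem isRelPrime_poly {i j : Fin r} (h : i ≠ j) : IsRelPrime (N.poly i) (N.poly j) :=
  IsRelPrime.prod_left fun k _ => IsRelPrime.prod_right fun k' _ =>
    isRelPrime_linForm (N.cross_ln_ne_zero h k k')

/-- Different classes are different members of the pencil. -/
theorem value_ne_of_poly_eq {A B : MvPolynomial (Fin 3) ℂ} {a b : Fin r → ℂ}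
    (h : ∀ i, MvPolynomial.C (b i) * A - MvPolynomial.C (a i) * B = N.poly i) (i j : Fin r)
    (hij : i ≠ j) : a i * b j ≠ a j * b i := by
  intro hab
  have hval : ∀ i x, N.f i x = b i * MvPolynomial.eval x A - a i * MvPolynomial.eval x B := by
    intro i x
    rw [← eval_poly, ← h i]
    simp
  have : Nonempty (κ i) := Fintype.card_pos_iff.1 (by
    rw [N.card_eq]; exact zero_lt_two.trans_le N.two_le)
  let k : κ i := Classical.arbitrary _
  obtain ⟨k', hk'⟩ := N.exists_ne i k
  -- the class `i` contains the point `y`, which is not on the class `j`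
  let y := crossProduct (N.ln i k) (N.ln i k')
  have hi : N.f i y = 0 := Finset.prod_eq_zero (Finset.mem_univ k) (dot_self_cross _ _)
  have hj : N.f j y ≠ 0 := N.f_cross_ne_zero hij hk'.symm
  have hb : b i = 0 := by
    have h₁ : b j * N.f i y - b i * N.f j y = 0 := by
      rw [hval, hval]; linear_combination -(MvPolynomial.eval y B) * hab
    rw [hi, mul_zero, zero_sub, neg_eq_zero] at h₁
    exact (mul_eq_zero.1 h₁).resolve_right hj
  have ha : a i = 0 := by
    have h₁ : a j * N.f i y - a i * N.f j y = 0 := by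
      rw [hval, hval]; linear_combination -(MvPolynomial.eval y A) * hab
    rw [hi, mul_zero, zero_sub, neg_eq_zero] at h₁
    exact (mul_eq_zero.1 h₁).resolve_right hj
  obtain ⟨z, hz⟩ := exists_eval_ne_zero
    (Finset.prod_ne_zero_iff.2 fun k (_ : k ∈ Finset.univ) => linForm_ne_zero (N.ln_ne_zero i k))
  refine hz ?_
  have := hval i z
  rw [ha, hb, ← eval_poly] at this
  simpa [poly] using this

end LineNet

/-! ### Nets in the projective plane -/

theorem orthogonal_iff {p ℓ : ProjPlane} : p.orthogonal ℓ ↔ ℓ.rep ⬝ᵥ p.rep = 0 := by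
  conv_lhs => rw [← p.mk_rep, ← ℓ.mk_rep]
  rw [Projectivization.orthogonal_mk, dotProduct_comm]

theorem cross_rep_ne_zero {p p' : ProjPlane} (h : p ≠ p') : crossProduct p.rep p'.rep ≠ 0 :=
  fun h0 => h (by
    rw [← p.mk_rep, ← p'.mk_rep]
    exact (Projectivization.mk_eq_mk_iff_crossProduct_eq_zero p.rep_nonzero p'.rep_nonzero).2 h0)

namespace IsNet

variable {r m : ℕ} {L : Fin r → Finset ProjPlane} {P : Finset ProjPlane}

/-- The line of the class `i` through the point `p` of the net. -/
def line (h : IsNet r m L P) (i : Fin r) (p : P) : L i :=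
  ⟨(h.existsUnique p.1 p.2 i).choose, (h.existsUnique p.1 p.2 i).choose_spec.1.1⟩

theorem orthogonal_iff_line_eq (h : IsNet r m L P) (i : Fin r) (p : P) (ℓ : L i) :
    p.1.orthogonal ℓ.1 ↔ h.line i p = ℓ := by
  obtain ⟨h₁, h₂⟩ := (h.existsUnique p.1 p.2 i).choose_spec
  refine ⟨fun hp => Subtype.ext (h₂ ℓ.1 ⟨ℓ.2, hp⟩).symm, fun hp => ?_⟩
  rw [← hp]
  exact h₁.2

/-- The homogeneous coordinates of the points and of the lines of a net. -/
def lineNet (h : IsNet r m L P) (hm : 2 ≤ m) : LineNet r m P (fun i => L i) where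
  pt p := p.1.rep
  ln _ ℓ := ℓ.1.rep
  inc := h.line
  three_le := h.three_le
  two_le := hm
  card_eq i := by rw [Fintype.card_coe, h.card_eq]
  pt_ne_zero p := p.1.rep_nonzero
  dot_eq_zero_iff i ℓ p := by rw [← orthogonal_iff, h.orthogonal_iff_line_eq]
  bijective i j hij := by
    have hne : ∀ (ℓ : L i) (ℓ' : L j), crossProduct ℓ.1.rep ℓ'.1.rep ≠ 0 := fun ℓ ℓ' =>
      cross_rep_ne_zero fun h0 =>
        Finset.disjoint_left.1 (h.disjoint i j hij) ℓ.2 (by rw [h0]; exact ℓ'.2)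
    refine ⟨fun p p' hp => ?_, fun ⟨ℓ, ℓ'⟩ => ?_⟩
    · obtain ⟨h₁, h₂⟩ := Prod.ext_iff.1 hp
      by_contra hpp
      refine cross_rep_ne_zero (fun h0 => hpp (Subtype.ext h0)) ?_
      have e : ∀ i p, (h.line i p).1.rep ⬝ᵥ p.1.rep = 0 := fun i p =>
        orthogonal_iff.1 ((h.orthogonal_iff_line_eq i p _).2 rfl)
      refine cross_eq_zero_of_dot_eq_zero (hne (h.line i p) (h.line j p)) ?_ ?_ ?_ ?_ <;>
        rw [dotProduct_comm]
      · exact e i p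
      · exact e j p
      · rw [show h.line i p = h.line i p' from h₁]; exact e i p'
      · rw [show h.line j p = h.line j p' from h₂]; exact e j p'
    · have h₁ : (Projectivization.mk ℂ _ (hne ℓ ℓ')).orthogonal ℓ.1 := by
        conv_rhs => rw [← ℓ.1.mk_rep]
        rw [Projectivization.orthogonal_mk, dotProduct_comm]
        exact dot_self_cross _ _
      have h₂ : (Projectivization.mk ℂ _ (hne ℓ ℓ')).orthogonal ℓ'.1 := by
        conv_rhs => rw [← ℓ'.1.mk_rep]
        rw [Projectivization.orthogonal_mk, dotProduct_comm]
        exact dot_cross_self _ _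
      let p : P := ⟨_, h.meet_mem i j hij ℓ.1 ℓ.2 ℓ'.1 ℓ'.2 _ h₁ h₂⟩
      exact ⟨p, Prod.ext ((h.orthogonal_iff_line_eq i p ℓ).1 h₁)
        ((h.orthogonal_iff_line_eq j p ℓ').1 h₂)⟩

theorem poly_lineNet (h : IsNet r m L P) (hm : 2 ≤ m) (i : Fin r) :
    (h.lineNet hm).poly i = ∏ ℓ ∈ L i, lineEq ℓ :=
  Finset.prod_coe_sort (L i) fun ℓ => lineEq ℓ

theorem exists_isNetMap (h : IsNet r m L P) (hm : 2 ≤ m) : ∃ A B, IsNetMap m L A B := by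
  have h3 := h.three_le
  let i₀ : Fin r := ⟨0, by omega⟩
  let i₁ : Fin r := ⟨1, by omega⟩
  have h01 : i₀ ≠ i₁ := by simp [i₀, i₁]
  choose a b hab using (h.lineNet hm).exists_poly_eq h01
  refine ⟨_, _, (h.lineNet hm).isHomogeneous_poly i₀, (h.lineNet hm).isHomogeneous_poly i₁,
    (h.lineNet hm).isRelPrime_poly h01, a, b, (h.lineNet hm).value_ne_of_poly_eq hab, fun i => ?_⟩
  rw [hab, poly_lineNet]

/-- The web of a net in the projective plane is that of its homogeneous coordinates. -/
theorem exists_net (h : IsNet r m L P) (hm : 2 ≤ m) {A B : MvPolynomial (Fin 3) ℂ}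
    (hAB : IsNetMap m L A B) :
    ∃ N : Net r m P (fun i => L i), ∀ c, N.web c = netWeb P A B c := by
  obtain ⟨-, -, -, a, b, hne, hfib⟩ := hAB
  refine ⟨{ toLineNet := h.lineNet hm
            A := fun x => MvPolynomial.eval x A
            B := fun x => MvPolynomial.eval x B
            a := a
            b := b
            value_ne := hne
            fibre := fun i x => ?_ }, fun c => ?_⟩
  · have h₁ := congrArg (MvPolynomial.eval x) (hfib i)
    rw [← h.poly_lineNet hm, LineNet.eval_poly] at h₁
    rw [map_sub, map_mul, map_mul, MvPolynomial.eval_C, MvPolynomial.eval_C] at h₁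
    exact h₁
  · funext s
    cases s <;> rfl

end IsNet

/-! ### Reindexing the foliations of a web -/

theorem DefinesNear.reindex {τ τ' : Type} {Ω ω : τ → Form} {q : Plane}
    (h : DefinesNear Ω ω q) (e : τ' ≃ τ) :
    DefinesNear (Ω ∘ e) (ω ∘ e) q where
  regular := ⟨fun i => h.regular.analytic (e i), fun i => h.regular.ne_zero (e i),
    fun i j hij => h.regular.transverse (e i) (e j) (e.injective.ne hij)⟩
  nontrivial i := h.nontrivial (e i)
  wedge_eq_zero i := h.wedge_eq_zero (e i)

theorem webRank_reindex_le {τ τ' : Type} [Fintype τ] [Fintype τ'] (ω : τ → Form) (q : Plane)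
    (e : τ' ≃ τ) :
    webRank (ω ∘ e) q ≤ webRank ω q := by
  let g : abelianRelations (ω ∘ e) q →ₗ[ℂ] abelianRelations ω q :=
    { toFun := fun a => ⟨fun i => a.1 (e.symm i), by
        obtain ⟨η, hη, ha⟩ := a.2
        refine ⟨fun i => η (e.symm i), ⟨fun i => hη.analytic _, fun i => hη.closed _, fun i => ?_, ?_⟩,
          by rw [ha]⟩
        · have := hη.wedge_eq_zero (e.symm i)
          simpa using this
        · filter_upwards [hη.sum_eq_zero] with v hv
          rw [← hv]
          exact Equiv.sum_comp e.symm fun i => η i v⟩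
      map_add' := fun a b => rfl
      map_smul' := fun c a => rfl }
  refine LinearMap.rank_le_of_injective g fun a b hab => ?_
  have h := congrArg Subtype.val hab
  refine Subtype.ext (funext fun i => ?_)
  have h₁ : a.1 (e.symm (e i)) = b.1 (e.symm (e i)) := congrFun h (e i)
  rwa [e.symm_apply_apply] at h₁

/-- The web of a `(3, 2)`-net or of a `(4, 3)`-net is exceptional: it has maximal rank, and it
consists of more than three linear foliations and of one that is not linear. -/
theorem Net.isExceptional {r m : ℕ} {ι : Type} {κ : Fin r → Type} [Fintype ι]
    [∀ i, Fintype (κ i)] (N : Net r m ι κ) (hrm : r = 3 ∧ m = 2 ∨ r = 4 ∧ m = 3) {τ : Type}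
    [Fintype τ] (e : τ ≃ Option ι) {Ω : τ → Form} (hΩ : ∀ t, Ω t = N.web 2 (e t)) :
    IsExceptional Ω := by
  obtain rfl : Ω = N.web 2 ∘ e := funext hΩ
  refine ⟨?_, fun q ω h => ⟨?_, ?_⟩⟩
  · obtain ⟨q, hq⟩ := N.exists_definesNear
    exact ⟨q, _, hq.reindex e⟩
  · have h' : DefinesNear (N.web 2) (ω ∘ e.symm) q := by
      simpa [Function.comp_assoc] using h.reindex e.symm
    have h₁ := Net.hasMaximalRank h' hrm
    rw [HasMaximalRank, ← Fintype.card_congr e] at h₁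
    exact le_antisymm (webRank_le h.regular) (h₁.symm.le.trans (webRank_reindex_le ω q e.symm))
  · have h' : DefinesNear (N.web 2) (ω ∘ e.symm) q := by
      simpa [Function.comp_assoc] using h.reindex e.symm
    have h4 : Fintype.card (Fin 4) ≤ Fintype.card ι := by
      rw [N.card_points, Fintype.card_fin]
      nlinarith [N.two_le]
    obtain ⟨f⟩ := Function.Embedding.nonempty_of_card_le h4
    exact not_isAlgebraizableAt h.regular (s := fun k => e.symm (some (f k)))
      (e.symm.injective.comp ((Option.some_injective _).comp f.injective))
      (fun k => Net.isInflectionAt_some h' (f k)) (Net.not_isLinearAt h')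

/-! ### Bol's web -/

/-- The pencil generated by two lines. -/
theorem pencilForm_eq_radial {f g : Plane → ℂ} {l l' : Fin 3 → ℂ} {p : Fin 3 → ℂ}
    (hf : ∀ v, f v = l ⬝ᵥ chart 2 v) (hg : ∀ v, g v = l' ⬝ᵥ chart 2 v)
    (hp : p = crossProduct l' l) : pencilForm f g = radial p 2 := by
  obtain rfl := funext hf
  obtain rfl := funext hg
  funext v
  ext u
  rw [radial_apply, hp, cross_dot_cross, pencilForm, sub_apply, smul_apply, smul_apply,
    fderiv_dotProduct_chart, fderiv_dotProduct_chart, smul_eq_mul, smul_eq_mul]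
  ring

/-- The `(3, 2)`-net of the six lines of a complete quadrilateral. The point `(a, b)` is the
intersection of the line `a` of the first class and of the line `b` of the second one. -/
def bolNet : Net 3 2 (Fin 2 × Fin 2) (fun _ => Fin 2) where
  pt p := ![![![0, 1, 0], ![0, 1, 1]], ![![-1, 0, -1], ![-1, 0, 0]]] p.1 p.2
  ln := ![![![1, 0, 0], ![0, 1, 0]], ![![-1, 0, 1], ![0, -1, 1]], ![![0, 0, 1], ![1, 1, -1]]]
  inc i p := ![p.1, p.2, p.1 + p.2] i
  A x := x 0 * x 1
  B x := (x 2 - x 0) * (x 2 - x 1)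
  a := ![0, -1, 1]
  b := ![1, 0, 1]
  three_le := le_rfl
  two_le := le_rfl
  card_eq _ := rfl
  pt_ne_zero p h := by
    obtain ⟨a, b⟩ := p
    have h₀ := congrFun h 0
    have h₁ := congrFun h 1
    fin_cases a <;> fin_cases b <;> simp at h₀ h₁
  bijective := by decide
  dot_eq_zero_iff i k p := by
    obtain ⟨a, b⟩ := p
    fin_cases i <;> fin_cases k <;> fin_cases a <;> fin_cases b <;> simp
  value_ne i j hij := by
    fin_cases i <;> fin_cases j <;> simp at hij ⊢
  fibre i x := by
    fin_cases i <;> simp [Fin.prod_univ_two, dot_eq] <;> ring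

/-- The foliations of Bol's web, as foliations of the web of a net. -/
def bolIndex : Fin 5 → Option (Fin 2 × Fin 2) :=
  ![some (0, 0), some (1, 1), some (0, 1), some (1, 0), none]

theorem bolWeb_eq (t : Fin 5) : bolWeb t = bolNet.web 2 (bolIndex t) := by
  fin_cases t
  · exact pencilForm_eq_radial (l := ![1, 0, 0]) (l' := ![0, 0, 1]) (fun v => by simp [chart_two])
      (fun v => by simp [chart_two]) (by simp [bolNet, cross_apply])
  · exact pencilForm_eq_radial (l := ![0, 1, 0]) (l' := ![0, 0, 1]) (fun v => by simp [chart_two])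
      (fun v => by simp [chart_two]) (by simp [bolNet, cross_apply])
  · exact pencilForm_eq_radial (l := ![1, 0, 0]) (l' := ![0, -1, 1]) (fun v => by simp [chart_two])
      (fun v => by simp [chart_two]; ring) (by simp [bolNet, cross_apply])
  · exact pencilForm_eq_radial (l := ![0, 1, 0]) (l' := ![-1, 0, 1]) (fun v => by simp [chart_two])
      (fun v => by simp [chart_two]; ring) (by simp [bolNet, cross_apply])
  · have h : ∀ v : Plane, chart 2 v 0 = v 0 ∧ chart 2 v 1 = v 1 ∧ chart 2 v 2 = 1 := fun v => by
      simp [chart_two]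
    change pencilForm _ _ = pencilForm (fun v => chart 2 v 0 * chart 2 v 1)
      (fun v => (chart 2 v 2 - chart 2 v 0) * (chart 2 v 2 - chart 2 v 1))
    simp only [h]

theorem isExceptional_bolWeb : IsExceptional bolWeb :=
  bolNet.isExceptional (.inl ⟨rfl, rfl⟩) (Equiv.ofBijective bolIndex (by decide)) bolWeb_eq

/-! ### The web of the Hesse pencil -/

theorem isPrimitiveRoot_cubeRoot : IsPrimitiveRoot cubeRoot 3 := by
  have := Complex.isPrimitiveRoot_exp 3 (by norm_num)
  rw [cubeRoot]
  convert this using 2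
  push_cast
  ring

/-- The powers of the cube root of unity. -/
def root (i : Fin 3) : ℂ := cubeRoot ^ (i : ℕ)

theorem root_ne_zero (i : Fin 3) : root i ≠ 0 :=
  pow_ne_zero _ (isPrimitiveRoot_cubeRoot.ne_zero (by norm_num))

theorem root_add (i j : Fin 3) : root (i + j) = root i * root j := by
  rw [root, root, root, ← pow_add, Fin.val_add, ← pow_mod_orderOf, ← pow_mod_orderOf _ (_ + _),
    ← isPrimitiveRoot_cubeRoot.eq_orderOf, Nat.mod_mod]

theorem root_injective : Function.Injective root := fun i j h =>
  Fin.ext (isPrimitiveRoot_cubeRoot.pow_inj i.2 j.2 h)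

/-- The line of the class `c` of the Hesse configuration through the point `p`: the class `0` is
the triangle of the coordinate axes, and for `c = s + 1` the line `k` is
`x + ξ ^ k * y + ξ ^ (2 * k + s) * z = 0`. -/
def hesseLine (c : Fin 4) (p : Fin 3 × Fin 3) : Fin 3 :=
  Fin.cases p.1 (fun s => ![p.2, p.2 - s, s - p.2] p.1) c

/-- The `(4, 3)`-net of the nine inflection points of the cubics of the Hesse pencil. -/
def hesseNet : Net 4 3 (Fin 3 × Fin 3) (fun _ => Fin 3) where
  pt p := ![![-root p.2, 1, 0], ![0, -root p.2, 1], ![root p.2, 0, -1]] p.1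
  ln := Fin.cases ![![0, 0, 1], ![1, 0, 0], ![0, 1, 0]] fun s k => ![1, root k, root (2 * k + s)]
  inc := hesseLine
  A x := x 0 ^ 3 + x 1 ^ 3 + x 2 ^ 3
  B x := x 0 * x 1 * x 2
  a := Fin.cases (-1) fun s => 3 * root s
  b := Fin.cases 0 fun _ => 1
  three_le := by norm_num
  two_le := by norm_num
  card_eq _ := rfl
  pt_ne_zero p h := by
    obtain ⟨a, i⟩ := p
    have h₀ := congrFun h 0
    have h₁ := congrFun h 1
    have h₂ := congrFun h 2
    fin_cases a <;> simp at h₀ h₁ h₂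
  bijective := by decide
  dot_eq_zero_iff c k p := by
    obtain ⟨a, i⟩ := p
    have hi := root_ne_zero i
    induction c using Fin.cases with
    | zero =>
      fin_cases k <;> fin_cases a <;> simp [hesseLine, hi]
    | succ s =>
      have e₀ : ∀ i k s : Fin 3, k = i ↔ i = k := by decide
      have e₁ : ∀ i k s : Fin 3, 2 * k + s = k + i ↔ i - s = k := by decide
      have e₂ : ∀ i k s : Fin 3, i = 2 * k + s ↔ s - i = k := by decide
      have key : ∀ {x : ℂ} {j j' : Fin 3} {R : Prop}, x = root j - root j' → (j = j' ↔ R) →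
          (x = 0 ↔ R) := fun hx hR => by rw [hx, sub_eq_zero, root_injective.eq_iff, hR]
      fin_cases a
      · exact key (by simp; ring) (e₀ i k s)
      · exact key (by simp [root_add k i]; ring) (e₁ i k s)
      · exact key (by simp; ring) (e₂ i k s)
  value_ne i j hij := by
    induction i using Fin.cases with
    | zero =>
      induction j using Fin.cases with
      | zero => exact (hij rfl).elim
      | succ s => simp
    | succ s =>
      induction j using Fin.cases with
      | zero => simp
      | succ s' =>
        have : s ≠ s' := fun h => hij (by rw [h])
        simpa using root_injective.ne this
  fibre i x := by
    induction i using Fin.cases with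
    | zero => simp [Fin.prod_univ_three, dot_eq]; ring
    | succ s =>
      have h₁ : root 1 ^ 2 + root 1 + 1 = 0 := by
        have := isPrimitiveRoot_cubeRoot.geom_sum_eq_zero (by norm_num)
        simp [Finset.sum_range_succ] at this
        simp [root]
        linear_combination this
      have h₂ : root 2 = -1 - root 1 := by
        rw [show (2 : Fin 3) = 1 + 1 from rfl, root_add]
        linear_combination h₁
      have h₃ : root s ^ 3 = 1 := by
        rw [root, ← pow_mul, mul_comm, pow_mul, isPrimitiveRoot_cubeRoot.pow_eq_one, one_pow]
      have h₀ : root 0 = 1 := pow_zero _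
      simp only [Fin.prod_univ_three, dot_eq, Fin.cases_succ, root_add,
        show (2 * 0 : Fin 3) = 0 from rfl, show (2 * 1 : Fin 3) = 2 from rfl,
        show (2 * 2 : Fin 3) = 1 from rfl, h₀, h₂]
      simp
      linear_combination -(x 2 ^ 3) * h₃ +
        (x 0 + x 1 + root s * x 2) * (x 1 - root s * x 2) ^ 2 * h₁

/-- The foliations of the web of the Hesse pencil, as foliations of the web of a net. -/
def hesseIndex : Fin 3 ⊕ Fin 3 ⊕ Fin 3 ⊕ Unit → Option (Fin 3 × Fin 3)
  | .inl i => some (0, i)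
  | .inr (.inl i) => some (1, i)
  | .inr (.inr (.inl i)) => some (2, i)
  | .inr (.inr (.inr _)) => none

theorem hesseWeb_eq (t : Fin 3 ⊕ Fin 3 ⊕ Fin 3 ⊕ Unit) :
    hesseWeb t = hesseNet.web 2 (hesseIndex t) := by
  rcases t with i | i | i | -
  · exact pencilForm_eq_radial (l := ![1, root i, 0]) (l' := ![0, 0, 1])
      (fun v => by simp [chart_two, root]) (fun v => by simp [chart_two])
      (by simp [hesseNet, cross_apply])
  · exact pencilForm_eq_radial (l := ![0, 1, root i]) (l' := ![1, 0, 0])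
      (fun v => by simp [chart_two, root]) (fun v => by simp [chart_two])
      (by simp [hesseNet, cross_apply])
  · exact pencilForm_eq_radial (l := ![1, 0, root i]) (l' := ![0, 1, 0])
      (fun v => by simp [chart_two, root]) (fun v => by simp [chart_two])
      (by simp [hesseNet, cross_apply])
  · have h : ∀ v : Plane, chart 2 v 0 = v 0 ∧ chart 2 v 1 = v 1 ∧ chart 2 v 2 = 1 := fun v => by
      simp [chart_two]
    change pencilForm _ _ = pencilForm (fun v => chart 2 v 0 ^ 3 + chart 2 v 1 ^ 3 + chart 2 v 2 ^ 3)
      (fun v => chart 2 v 0 * chart 2 v 1 * chart 2 v 2)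
    simp only [h, one_pow, mul_one]

theorem isExceptional_hesseWeb : IsExceptional hesseWeb :=
  hesseNet.isExceptional (.inr ⟨rfl, rfl⟩) (Equiv.ofBijective hesseIndex (by decide)) hesseWeb_eq

end PlanarWeb

end

open PlanarWeb in
theorem theoremT :
    (∀ (r m : ℕ) (L : Fin r → Finset ProjPlane) (P : Finset ProjPlane),
      2 ≤ m → IsNet r m L P →
        P.card = m ^ 2 ∧
        (∃ A B : MvPolynomial (Fin 3) ℂ, IsNetMap m L A B) ∧
        ∀ A B : MvPolynomial (Fin 3) ℂ, IsNetMap m L A B →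
          (∃ c q ω, DefinesNear (netWeb P A B c) ω q) ∧
          ∀ c q ω, DefinesNear (netWeb P A B c) ω q →
            ¬ IsLinearAt (ω none) q ∧
            (((m ^ 2 - 1) * (m ^ 2 - 2) / 2 + (r - 1) ^ 2 - 1 : ℕ) : Cardinal) ≤ webRank ω q ∧
            ((r = 3 ∧ m = 2) ∨ (r = 4 ∧ m = 3) → HasMaximalRank ω q)) ∧
    IsExceptional bolWeb ∧ IsExceptional hesseWeb := by
  refine ⟨fun r m L P hm h => ⟨?_, h.exists_isNetMap hm, fun A B hAB => ?_⟩,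
    isExceptional_bolWeb, isExceptional_hesseWeb⟩
  · obtain ⟨A, B, hAB⟩ := h.exists_isNetMap hm
    obtain ⟨N, -⟩ := h.exists_net hm hAB
    rw [← Fintype.card_coe, N.card_points]
  · obtain ⟨N, hN⟩ := h.exists_net hm hAB
    refine ⟨?_, fun c q ω hω => ?_⟩
    · obtain ⟨q, hq⟩ := N.exists_definesNear
      exact ⟨2, q, _, hN 2 ▸ hq⟩
    · rw [← hN c] at hω
      exact ⟨Net.not_isLinearAt hω, Net.le_webRank hω, Net.hasMaximalRank hω⟩
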